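/- **Setting.** Let $X^\omega\subset\mathbb R$ be a homogeneous Poisson point process of intensity $\lambda>0$ on a probability space $(\Omega,\mathcal F,\mathbb P)$. For real $l\ge 1$ let $\Lambda_l=(-l/2,l/2)$, and let $h_l^0=-\tfrac12\Delta_D$ be the Dirichlet kinetic-energy operator on $L^2(\Lambda_l)$. It has an orthonormal basis of eigenfunctions $\psi_k=\psi_k^l$, $k\ge 1$, with eigenvalues $\varepsilon_1\le\varepsilon_2\le\cdots$. The Luttinger–Sy Hamiltonian $h_l^\omega$ (point impurities of infinite strength) is the direct sum of the operators $-\tfrac12\frac{d^2}{dx^2}$ with Dirichlet conditions on the intervals into which $X^\omega$ cuts $\Lambda_l$; equivalently, it is the self-adjoint operator of the form $\tfrac12\int_{\Lambda_l}|u'|^2$ on $\{u\in H_0^1(\Lambda_l): u=0 \text{ on } X^\omega\}$. It has an orthonormal basis of eigenfunctions $\phi_i=\phi_i^{\omega,l}$ with eigenvalues $E_1\le E_2\le\cdots$. For $\beta>0$ let $\langle\,\cdot\,\rangle_l$ be the grand-canonical equilibrium state on the symmetric Fock space over $L^2(\Lambda_l)$, $$\langle A\rangle_l=\frac{\operatorname{Tr}\big(e^{-\beta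 H_l(\mu)}A\big)}{\operatorname{Tr}e^{-\beta H_l(\mu)}},\qquad H_l(\mu)=\sum_i (E_i-\mu)\,a^*(\phi_i)a(\phi_i),$$ and let $N_l(f)=a^*(f)a(f)$ be the number of particles in the state $f$. Given $\bar\rho>0$, the chemical potential $\mu=\mu_l^\omega$ is the one for which this state exists and $\frac1l\sum_i\langle N_l(\phi_i)\rangle_l=\bar\rho$. **Theorem.** The eigenbases above exist. There is a non-random measure $\nu$ on $\mathbb R$ (the integrated density of states) such that almost surely $\lim_{l\to\infty}\frac1l\#\{i:E_i^{\omega,l}\le E\}=\nu((-\infty,E])$ for every $E\in\mathbb R$. For every $\beta>0$ the critical density $$\rho_c=\lim_{\mu\uparrow0}\int_{[0,\infty)}\frac{\nu(dE)}{e^{\beta(E-\mu)}-1}$$ is finite. For every $\bar\rho>0$, almost surely $\mu_l^\omega$ exists and is unique for every $l\ge1$, and the following hold. 1. No kinetic-energy eigenstate is macroscopically occupied: almost surely $$\lim_{l\to\infty}\frac1l\,\langle N_l(\psi_k)\rangle_l=0\qquad\text{for every } k,$$ where $k=k(l)\ge 1$ may be fixed or depend on $l$ in an arbitrary way. 2.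 If $\bar\rho>\rho_c$, there is nevertheless generalized Bose–Einstein condensation in the kinetic-energy eigenstates: there is a non-random function $G$ on $(0,\infty)$ such that almost surely, for every $\delta>0$, $$\lim_{l\to\infty}\frac1l\sum_{k:\varepsilon_k\le\delta}\langle N_l(\psi_k)\rangle_l=G(\delta),\qquad\text{and}\qquad \lim_{\delta\downarrow0}G(\delta)=\bar\rho-\rho_c>0 .$$ Thus for $\bar\rho>\rho_c$ the condensate in the kinetic-energy eigenstates is of type III. -/

import Mathlib

open MeasureTheory ProbabilityTheory Filter Topology Set
open scoped NNReal ENNReal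

namespace LuttingerSy

noncomputable section

/-! ### Poisson impurities -/

/-- `X` is a (homogeneous) Poisson point process on `ℝ` with intensity `lam`, under the
probability measure `P`: every realization is locally finite, the number of points in a bounded
Borel set `B` is a Poisson random variable of mean `lam * |B|`, and the numbers of points in
pairwise disjoint bounded Borel sets are independent. -/
structure IsPoissonProcess {Ω : Type*} [MeasurableSpace Ω] (P : Measure Ω) (lam : ℝ≥0)
    (X : Ω → Set ℝ) : Prop where
  locallyFinite : ∀ ω, ∀ r : ℝ, (X ω ∩ Icc (-r) r).Finite
  measurable_count : ∀ B : Set ℝ, MeasurableSet B → Bornology.IsBounded B →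
    Measurable fun ω => (X ω ∩ B).ncard
  law_count : ∀ B : Set ℝ, MeasurableSet B → Bornology.IsBounded B →
    P.map (fun ω => (X ω ∩ B).ncard) = poissonMeasure (lam * (volume B).toNNReal)
  indep_count : ∀ (n : ℕ) (B : Fin n → Set ℝ), (∀ j, MeasurableSet (B j)) →
    (∀ j, Bornology.IsBounded (B j)) → Pairwise (Function.onFun Disjoint B) →
    iIndepFun (fun j ω => (X ω ∩ B j).ncard) P

/-! ### One-particle Hamiltonians -/

/-- The box `Λ_l = (-l/2, l/2)`. -/
def box (l : ℝ) : Set ℝ := Ioo (-l / 2) (l / 2)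

/-- The one-particle Hilbert space `L²(Λ_l)`. -/
abbrev L2Box (l : ℝ) : Type := Lp ℂ 2 (volume.restrict (box l))

/-- The absolutely continuous function on `Λ_l` that vanishes at `-l/2` and has derivative `v`. -/
def primitive (l : ℝ) (v : L2Box l) (x : ℝ) : ℂ := ∫ t in (-l / 2)..x, v t

/-- `u` lies in the form domain `{u ∈ H¹₀(Λ_l) : u = 0 on X}` and has weak derivative `v`.
If `X ∩ Λ_l` is finite and cuts `Λ_l` into the intervals `I_j`, this form domain
is `⨁_j H¹₀(I_j)`; if `X = ∅` it is `H¹₀(Λ_l)`. -/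
def HasFormDeriv (l : ℝ) (X : Set ℝ) (u v : L2Box l) : Prop :=
  (∀ᵐ x ∂(volume.restrict (box l)), u x = primitive l v x) ∧
    primitive l v (l / 2) = 0 ∧ ∀ x ∈ X ∩ box l, primitive l v x = 0

/-- `h u = w`, where `h` is the self-adjoint operator of the closed form
`u ↦ ½ ∫ |u'|²` on `{u ∈ H¹₀(Λ_l) : u = 0 on X}`. For a locally finite `X` this is the direct sum
`⨁_j h_D(I_j)` of the operators `-½ d²/dx²` with Dirichlet conditions on the intervals `I_j` into
which `X` cuts `Λ_l`, that is, the Luttinger–Sy Hamiltonian with impurities at `X`;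
for `X = ∅` it is the kinetic-energy operator `-½ Δ_D` of the box. -/
def HamiltonianApply (l : ℝ) (X : Set ℝ) (u w : L2Box l) : Prop :=
  ∃ v : L2Box l, HasFormDeriv l X u v ∧
    ∀ η dη : L2Box l, HasFormDeriv l X η dη → (1 / 2 : ℂ) * inner ℂ dη v = inner ℂ η w

/-- An orthonormal basis of `L²(Λ_l)` of eigenfunctions of the Hamiltonian with impurities at `X`,
the eigenvalues being listed in increasing order with multiplicity (indices start at `0`). -/
structure Eigenbasis (l : ℝ) (X : Set ℝ) where
  vec : HilbertBasis ℕ ℂ (L2Box l)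
  energy : ℕ → ℝ
  energy_mono : Monotone energy
  eigen : ∀ i, HamiltonianApply l X (vec i) ((energy i : ℂ) • vec i)

/-- A choice of an eigenbasis in every box `Λ_l`, `l ≥ 1`. -/
abbrev EigenbasisFamily (X : Set ℝ) : Type := ∀ l : Ici (1 : ℝ), Eigenbasis (l : ℝ) X

/-! ### The perfect Bose gas

The symmetric Fock space over `L²(Λ_l)` in its occupation-number representation with respect to an
eigenbasis `φ`: a vector is given by its coefficients `Ψ n` with respect to the orthonormal basis
`|n⟩`, where `n : ℕ →₀ ℕ` and `n i` is the number of particles in the state `φ i`.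
Operators are given by their action on coefficients. -/

/-- The occupation-number vector `|n⟩`. -/
def occ (n : ℕ →₀ ℕ) : (ℕ →₀ ℕ) → ℂ := Pi.single n 1

section Gas

variable {l : ℝ} {X : Set ℝ}

/-- The annihilation operator `a(f) = ∑_i ⟨f, φ_i⟩ a(φ_i)`. -/
def annihilate (φ : Eigenbasis l X) (f : L2Box l) (Ψ : (ℕ →₀ ℕ) → ℂ) : (ℕ →₀ ℕ) → ℂ :=
  fun m => ∑' i, inner ℂ f (φ.vec i) * (Real.sqrt (m i + 1) : ℂ) * Ψ (m + Finsupp.single i 1)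

/-- The creation operator `a*(f) = ∑_i ⟨φ_i, f⟩ a*(φ_i)`. -/
def create (φ : Eigenbasis l X) (f : L2Box l) (Ψ : (ℕ →₀ ℕ) → ℂ) : (ℕ →₀ ℕ) → ℂ :=
  fun m => ∑ i ∈ m.support,
    inner ℂ (φ.vec i) f * (Real.sqrt (m i) : ℂ) * Ψ (m - Finsupp.single i 1)

/-- The operator `N_l(f) = a*(f) a(f)` of the number of particles in the state `f`. -/
def numberOp (φ : Eigenbasis l X) (f : L2Box l) (Ψ : (ℕ →₀ ℕ) → ℂ) : (ℕ →₀ ℕ) → ℂ :=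
  create φ f (annihilate φ f Ψ)

/-- The operator `exp(-β H_l(μ))`, where `H_l(μ) = ∑_i (E_i - μ) N_l(φ_i)`, so that
`H_l(μ) |n⟩ = (∑_i n_i (E_i - μ)) |n⟩`. -/
def gibbsOp (φ : Eigenbasis l X) (β μ : ℝ) (Ψ : (ℕ →₀ ℕ) → ℂ) : (ℕ →₀ ℕ) → ℂ :=
  fun n => (Real.exp (-β * n.sum fun i ni => (ni : ℝ) * (φ.energy i - μ)) : ℂ) * Ψ n

/-- The trace over the Fock space, `∑_n ⟨n| T |n⟩`, of an operator with nonnegative diagonal. -/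
def fockTrace (T : ((ℕ →₀ ℕ) → ℂ) → (ℕ →₀ ℕ) → ℂ) : ℝ≥0∞ :=
  ∑' n : ℕ →₀ ℕ, ENNReal.ofReal (T (occ n) n).re

/-- `⟨N_l(f)⟩_l(β, μ) = Tr (exp(-β H_l(μ)) N_l(f)) / Tr exp(-β H_l(μ))`. -/
def meanNumber (φ : Eigenbasis l X) (β μ : ℝ) (f : L2Box l) : ℝ≥0∞ :=
  fockTrace (fun Ψ => gibbsOp φ β μ (numberOp φ f Ψ)) / fockTrace (gibbsOp φ β μ)

/-- `μ` is a chemical potential for which the grand-canonical equilibrium state exists and has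
mean particle density `ρ`, the total number of particles being `N_l = ∑_i N_l(φ_i)`. -/
def IsChemicalPotential (φ : Eigenbasis l X) (β ρ μ : ℝ) : Prop :=
  fockTrace (gibbsOp φ β μ) ≠ ⊤ ∧
    (∑' i, meanNumber φ β μ (φ.vec i)) / ENNReal.ofReal l = ENNReal.ofReal ρ

/-- The finite-volume integrated density of states `(1/l) #{i : E_i ≤ e}`. -/
def finiteIDS (φ : Eigenbasis l X) (e : ℝ) : ℝ≥0∞ :=
  (({i : ℕ | φ.energy i ≤ e}.encard : ℕ∞) : ℝ≥0∞) / ENNReal.ofReal l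

/-- The mass `(1/l) ∑_{k : ε_k ≤ δ} ⟨N_l(ψ_k)⟩_l` which the occupation measure of the kinetic-energy
eigenstates `ψ_k` gives to `(-∞, δ]`. -/
def kineticOccupation (φ : Eigenbasis l X) (ψ : Eigenbasis l ∅) (β μ δ : ℝ) : ℝ≥0∞ :=
  (∑' k : {k : ℕ // ψ.energy k ≤ δ}, meanNumber φ β μ (ψ.vec k)) / ENNReal.ofReal l

end Gas

/-- `ρc = lim_{μ ↑ 0} ∫_{[0,∞)} (exp(β (E - μ)) - 1)⁻¹ ν(dE)`, the limit being finite. -/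
def IsCriticalDensity (β : ℝ) (ν : Measure ℝ) (ρc : ℝ≥0) : Prop :=
  Tendsto (fun μ : ℝ => ∫⁻ e in Ici (0 : ℝ), ENNReal.ofReal (1 / (Real.exp (β * (e - μ)) - 1)) ∂ν)
    (𝓝[<] 0) (𝓝 (ρc : ℝ≥0∞))

end

end LuttingerSy

/-! The impurities cut the box into gaps, and the Luttinger–Sy Hamiltonian is the direct sum of the
Dirichlet operators of the gaps. Its eigenfunctions are therefore the sine functions of single gaps,
and its energies are `gapEnergy m s` for gap lengths `s`. The occupation densities studied here are
sums over gaps and levels, with Bose–Einstein weights and overlaps with the sine functions of the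
whole box. Since the eigenbases in the theorem are arbitrary, these sums are first shown to depend
on spectral data only (`EigenSystem.tsum_sq_inner_eq`, `EigenSystem.tsum_energy_eq`).

Probability enters only through `HasGapLaw`: for every `s ≥ 0` the sum of `(L - s)₊` over the gap
lengths `L`, divided by `l`, tends to `exp (-λ s)`. This follows from the strong law for empty
cells, because `(L - s)₊` is essentially the mesh times the number of grid cells of length `s` that
fit into the gap. Approximation extends it to other functions `F`: averages of `F` over the gaps
converge to `∫ F(s) λ² exp (-λ s) ds` (`IsGapLimit`). All later claims are deterministic
consequences, so one null set serves for all densities, temperatures, indices and energies.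

Claim 1. A box eigenfunction is spread over the whole box, so its squared overlap with any state in
a gap of length `s` is at most `4 s / l`. The total particle number is `ρ l`, hence the density in
one kinetic state is at most `4 ρ` times the longest gap divided by `l`. The longest gap is `o(l)`,
and the bound is uniform in `k` (`Gaps.meanNumber_le`, `HasGapLaw.eventually_len_le`).

Claim 2. If `ρ > ρc`, then the chemical potential tends to `0`: it lies below the ground-state
energy, which tends to `0`, and a value bounded away from `0` would give a density close to at most
`ρc`. It is easier to count the particles of kinetic energy above `δ`. The condensate sits in levels
of low energy, and removing the impurity constraint does not raise the energy, so by Markov's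
inequality a level of energy `E` puts at most the fraction `E / δ` above `δ`
(`EigenSystem.sum_kinetic_le`, `Gaps.one_sub_kineticProb_le`). Levels of very high energy are
negligible. For the remaining levels the overlaps converge to the momentum distribution of the sine
function on the line, since the interference terms cancel for gaps away from the ends of the box
(`abs_sum_overlap_sq_sub_le`). The limit is `G δ = ρ - highDensity δ`. As `δ ↓ 0` the probability of
momentum at most `√(2δ)` vanishes, so `highDensity δ` tends to `ρc`. -/

namespace LuttingerSy

noncomputable section

/-! ### Traces over the Fock space -/

/-- The weight `∏ i, x i ^ n i` of an occupation-number configuration. -/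
def configWeight (x : ℕ → ℝ≥0∞) (n : ℕ →₀ ℕ) : ℝ≥0∞ := n.prod fun i k => x i ^ k

lemma configWeight_add (x : ℕ → ℝ≥0∞) (n m : ℕ →₀ ℕ) :
    configWeight x (n + m) = configWeight x n * configWeight x m := by
  unfold configWeight
  exact Finsupp.prod_add_index' (by simp) (by intros; rw [pow_add])

lemma configWeight_single (x : ℕ → ℝ≥0∞) (i k : ℕ) :
    configWeight x (Finsupp.single i k) = x i ^ k := by
  unfold configWeight
  exact Finsupp.prod_single_index (by simp)

/-- Adding `k` particles in mode `i` is a bijection onto the configurations with at least `k`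
particles there, and multiplies weights by `x i ^ k`. This replaces the factorization of the
partition sum over infinitely many modes. -/
lemma tsum_configWeight_ge (x : ℕ → ℝ≥0∞) (i k : ℕ) :
    ∑' n : ℕ →₀ ℕ, (if k ≤ n i then configWeight x n else 0)
      = x i ^ k * ∑' n : ℕ →₀ ℕ, configWeight x n := by
  have hinj : Function.Injective fun m : ℕ →₀ ℕ => m + Finsupp.single i k :=
    fun a b h => add_right_cancel h
  rw [← hinj.tsum_eq, ← ENNReal.tsum_mul_left]
  · refine tsum_congr fun m => ?_
    simp [configWeight_add, configWeight_single, mul_comm]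
  · intro n hn
    have hk : k ≤ n i := by
      by_contra h
      simp [h] at hn
    exact ⟨n - Finsupp.single i k, tsub_add_cancel_of_le (by simpa using hk)⟩

/-- Layer-cake formula: `n i` is the number of `k` with `k + 1 ≤ n i`. No finiteness of the
partition sum is required. -/
lemma tsum_mul_configWeight (x : ℕ → ℝ≥0∞) (i : ℕ) :
    ∑' n : ℕ →₀ ℕ, (n i : ℝ≥0∞) * configWeight x n
      = (∑' k : ℕ, x i ^ (k + 1)) * ∑' n : ℕ →₀ ℕ, configWeight x n := by
  have h : ∀ n : ℕ →₀ ℕ, (n i : ℝ≥0∞) * configWeight x n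
      = ∑' k : ℕ, if k + 1 ≤ n i then configWeight x n else 0 := by
    intro n
    rw [tsum_eq_sum (s := Finset.range (n i)), Finset.sum_congr rfl
      (g := fun _ => configWeight x n)]
    · simp
    · intro k hk
      rw [if_pos (Nat.succ_le_of_lt (Finset.mem_range.1 hk))]
    · intro k hk
      rw [if_neg]
      simpa using hk
  simp_rw [h]
  rw [ENNReal.tsum_comm, ← ENNReal.tsum_mul_right]
  exact tsum_congr fun k => tsum_configWeight_ge x i (k + 1)

lemma one_le_tsum_configWeight (x : ℕ → ℝ≥0∞) : 1 ≤ ∑' n : ℕ →₀ ℕ, configWeight x n := by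
  refine le_trans ?_ (ENNReal.le_tsum (0 : ℕ →₀ ℕ))
  simp [configWeight]

/-- Otherwise the configurations occupying mode `i` alone already have infinite total weight. -/
lemma lt_one_of_tsum_configWeight_ne_top {x : ℕ → ℝ≥0∞}
    (h : ∑' n : ℕ →₀ ℕ, configWeight x n ≠ ⊤) (i : ℕ) : x i < 1 := by
  by_contra hx
  push Not at hx
  apply h
  rw [eq_top_iff]
  calc (⊤ : ℝ≥0∞) = ∑' _ : ℕ, (1 : ℝ≥0∞) := by simp
    _ ≤ ∑' k : ℕ, configWeight x (Finsupp.single i k) := by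
        refine ENNReal.tsum_le_tsum fun k => ?_
        rw [configWeight_single]
        exact one_le_pow₀ hx
    _ ≤ _ := ENNReal.tsum_comp_le_tsum_of_injective (Finsupp.single_injective i) _

/-- A finite set of configurations uses only `N` modes with occupations below some `K`. Its weight
is part of the expansion of a product of `N` truncated geometric sums. -/
lemma configWeight_ne_top_of_bound {x : ℕ → ℝ≥0∞} {B : ℝ≥0∞} (hB : B ≠ ⊤)
    (h : ∀ N : ℕ, ∏ i ∈ Finset.range N, ∑' k : ℕ, x i ^ k ≤ B) :
    ∑' n : ℕ →₀ ℕ, configWeight x n ≠ ⊤ := by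
  refine ne_top_of_le_ne_top hB ?_
  rw [ENNReal.tsum_eq_iSup_sum]
  refine iSup_le fun s => ?_
  obtain ⟨N, hN⟩ : ∃ N : ℕ, ∀ n ∈ s, n.support ⊆ Finset.range N := by
    refine ⟨(s.sup fun n => n.support.sup id) + 1, fun n hn i hi => Finset.mem_range.2 ?_⟩
    exact Nat.lt_succ_of_le (le_trans (Finset.le_sup (f := id) hi)
      (Finset.le_sup (f := fun n : ℕ →₀ ℕ => n.support.sup id) hn))
  obtain ⟨K, hK⟩ : ∃ K : ℕ, ∀ n ∈ s, ∀ i, n i < K := by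
    refine ⟨(s.sup fun n => n.support.sup n) + 1, fun n hn i => Nat.lt_succ_of_le ?_⟩
    by_cases hi : i ∈ n.support
    · exact le_trans (Finset.le_sup (f := n) hi)
        (Finset.le_sup (f := fun n : ℕ →₀ ℕ => n.support.sup n) hn)
    · simp [Finsupp.notMem_support_iff.1 hi]
  refine le_trans ?_ (h N)
  calc ∑ n ∈ s, configWeight x n
      = ∑ n ∈ s, ∏ i : Fin N, x i ^ n i := by
        refine Finset.sum_congr rfl fun n hn => ?_
        unfold configWeight
        rw [Finsupp.prod_of_support_subset n (hN n hn) _ (by simp),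
          Finset.prod_range (fun i => x i ^ n i)]
    _ = ∑ g ∈ s.image (fun n => fun i : Fin N => n i), ∏ i : Fin N, x i ^ g i := by
        rw [Finset.sum_image]
        intro n hn m hm hnm
        ext i
        by_cases hi : i < N
        · exact congrFun hnm ⟨i, hi⟩
        · have h1 : i ∉ n.support := fun h' => hi (Finset.mem_range.1 (hN n hn h'))
          have h2 : i ∉ m.support := fun h' => hi (Finset.mem_range.1 (hN m hm h'))
          rw [Finsupp.notMem_support_iff.1 h1, Finsupp.notMem_support_iff.1 h2]
    _ ≤ ∑ g ∈ Fintype.piFinset fun _ : Fin N => Finset.range K, ∏ i : Fin N, x i ^ g i := by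
        refine Finset.sum_le_sum_of_subset fun g hg => ?_
        obtain ⟨n, hn, rfl⟩ := Finset.mem_image.1 hg
        simpa using fun i : Fin N => hK n hn i
    _ = ∏ i : Fin N, ∑ k ∈ Finset.range K, x i ^ k := (Finset.prod_univ_sum _ _).symm
    _ ≤ ∏ i : Fin N, ∑' k : ℕ, x i ^ k :=
        Finset.prod_le_prod' fun i _ => ENNReal.sum_le_tsum _
    _ = _ := (Finset.prod_range fun i => ∑' k : ℕ, x i ^ k).symm

/-! ### Mean occupation numbers in the Gibbs state -/

section Gas

variable {l : ℝ} {X : Set ℝ}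

/-- The Boltzmann factors `exp (-β (E i - μ))`. -/
def boltzmann (φ : Eigenbasis l X) (β μ : ℝ) (i : ℕ) : ℝ≥0∞ :=
  ENNReal.ofReal (Real.exp (-β * (φ.energy i - μ)))

/-- The Bose–Einstein occupation number `1 / (exp (β (E - μ)) - 1)`. -/
def bose (β μ E : ℝ) : ℝ := 1 / (Real.exp (β * (E - μ)) - 1)

lemma ofReal_gibbs_exponent (φ : Eigenbasis l X) (β μ : ℝ) (n : ℕ →₀ ℕ) :
    ENNReal.ofReal (Real.exp (-β * n.sum fun i ni => (ni : ℝ) * (φ.energy i - μ)))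
      = configWeight (boltzmann φ β μ) n := by
  unfold configWeight boltzmann Finsupp.sum Finsupp.prod
  rw [Finset.mul_sum, Real.exp_sum, ENNReal.ofReal_prod_of_nonneg (fun _ _ => (Real.exp_pos _).le)]
  refine Finset.prod_congr rfl fun i _ => ?_
  beta_reduce
  rw [← ENNReal.ofReal_pow (Real.exp_pos _).le, ← Real.exp_nat_mul]
  congr 2
  ring

lemma fockTrace_gibbsOp (φ : Eigenbasis l X) (β μ : ℝ) :
    fockTrace (gibbsOp φ β μ) = ∑' n, configWeight (boltzmann φ β μ) n := by
  unfold fockTrace gibbsOp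
  refine tsum_congr fun n => ?_
  rw [← ofReal_gibbs_exponent]
  simp only [occ, Pi.single_eq_same, mul_one, Complex.ofReal_re]

lemma annihilate_occ (φ : Eigenbasis l X) (f : L2Box l) (n : ℕ →₀ ℕ) {i : ℕ} (hi : n i ≠ 0) :
    annihilate φ f (occ n) (n - Finsupp.single i 1)
      = inner ℂ f (φ.vec i) * (Real.sqrt (n i) : ℂ) := by
  have hle : Finsupp.single i 1 ≤ n := by simpa using Nat.one_le_iff_ne_zero.2 hi
  unfold annihilate
  rw [tsum_eq_single i]
  · rw [tsub_add_cancel_of_le hle]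
    have h1 : (((n - Finsupp.single i 1 : ℕ →₀ ℕ) i : ℕ) : ℝ) + 1 = n i := by
      rw [Finsupp.tsub_apply, Finsupp.single_eq_same]
      exact_mod_cast Nat.succ_pred_eq_of_pos (Nat.pos_of_ne_zero hi)
    rw [h1]
    simp [occ]
  · intro j hj
    have : n - Finsupp.single i 1 + Finsupp.single j 1 ≠ n := by
      intro h
      nth_rewrite 2 [← tsub_add_cancel_of_le hle] at h
      exact hj (Finsupp.single_left_injective one_ne_zero (add_left_cancel h))
    simp [occ, this]

/-- The Gibbs operator is diagonal in the occupation basis, so only the terms of `a*(f) a(f)` that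
remove and restore a particle in the same mode enter the trace. -/
lemma numberOp_occ (φ : Eigenbasis l X) (f : L2Box l) (n : ℕ →₀ ℕ) :
    numberOp φ f (occ n) n
      = ((∑ i ∈ n.support, ‖inner ℂ (φ.vec i) f‖ ^ 2 * (n i : ℝ) : ℝ) : ℂ) := by
  unfold numberOp create
  push_cast
  refine Finset.sum_congr rfl fun i hi => ?_
  rw [annihilate_occ φ f n (Finsupp.mem_support_iff.1 hi)]
  have h1 : (inner ℂ (φ.vec i) f : ℂ) * inner ℂ f (φ.vec i) = (‖inner ℂ (φ.vec i) f‖ : ℂ) ^ 2 := by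
    rw [← inner_conj_symm f (φ.vec i), Complex.mul_conj]
    simp [Complex.normSq_eq_norm_sq]
  have h2 : (Real.sqrt (n i) : ℂ) * (Real.sqrt (n i) : ℂ) = (n i : ℂ) := by
    rw [← Complex.ofReal_mul, Real.mul_self_sqrt (Nat.cast_nonneg _)]
    simp
  calc _ = ((inner ℂ (φ.vec i) f : ℂ) * inner ℂ f (φ.vec i))
        * ((Real.sqrt (n i) : ℂ) * (Real.sqrt (n i) : ℂ)) := by ring
    _ = _ := by rw [h1, h2]

lemma fockTrace_gibbs_number (φ : Eigenbasis l X) (β μ : ℝ) (f : L2Box l) :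
    fockTrace (fun Ψ => gibbsOp φ β μ (numberOp φ f Ψ))
      = (∑' i, ENNReal.ofReal (‖inner ℂ (φ.vec i) f‖ ^ 2) *
          ∑' k : ℕ, boltzmann φ β μ i ^ (k + 1)) * ∑' n, configWeight (boltzmann φ β μ) n := by
  have h : ∀ n : ℕ →₀ ℕ, ENNReal.ofReal (gibbsOp φ β μ (numberOp φ f (occ n)) n).re
      = ∑' i, ENNReal.ofReal (‖inner ℂ (φ.vec i) f‖ ^ 2) *
          ((n i : ℝ≥0∞) * configWeight (boltzmann φ β μ) n) := by
    intro n
    unfold gibbsOp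
    rw [numberOp_occ, ← Complex.ofReal_mul, Complex.ofReal_re,
      ENNReal.ofReal_mul (Real.exp_pos _).le, ofReal_gibbs_exponent,
      ENNReal.ofReal_sum_of_nonneg (fun _ _ => by positivity), tsum_eq_sum (s := n.support),
      Finset.mul_sum]
    · refine Finset.sum_congr rfl fun i _ => ?_
      rw [ENNReal.ofReal_mul (by positivity), ENNReal.ofReal_natCast]
      ring
    · intro i hi
      simp [Finsupp.notMem_support_iff.1 hi]
  unfold fockTrace
  simp_rw [h]
  rw [ENNReal.tsum_comm, ← ENNReal.tsum_mul_right]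
  refine tsum_congr fun i => ?_
  rw [ENNReal.tsum_mul_left, tsum_mul_configWeight, mul_assoc]

lemma tsum_boltzmann_pow_succ {β μ E : ℝ} (h : 0 < β * (E - μ)) :
    ∑' k : ℕ, ENNReal.ofReal (Real.exp (-β * (E - μ))) ^ (k + 1)
      = ENNReal.ofReal (bose β μ E) := by
  set y := Real.exp (-β * (E - μ)) with hy
  have hy0 : 0 < y := Real.exp_pos _
  have hy1 : y < 1 := by
    rw [hy, Real.exp_lt_one_iff]
    linarith
  have hs : HasSum (fun k : ℕ => y ^ (k + 1)) (bose β μ E) := by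
    have := (hasSum_geometric_of_lt_one hy0.le hy1).mul_left y
    simp_rw [← pow_succ'] at this
    convert! this using 1
    have : Real.exp (β * (E - μ)) = y⁻¹ := by
      rw [hy, ← Real.exp_neg]
      congr 1
      ring
    rw [bose, this]
    have : 1 - y ≠ 0 := by linarith
    field_simp
  rw [← hs.tsum_eq, ENNReal.ofReal_tsum_of_nonneg (fun k => by positivity) hs.summable]
  exact tsum_congr fun k => (ENNReal.ofReal_pow hy0.le _).symm

lemma lt_energy_of_fockTrace_ne_top (φ : Eigenbasis l X) {β μ : ℝ} (hβ : 0 < β)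
    (h : fockTrace (gibbsOp φ β μ) ≠ ⊤) (i : ℕ) : μ < φ.energy i := by
  rw [fockTrace_gibbsOp] at h
  have := lt_one_of_tsum_configWeight_ne_top h i
  rw [boltzmann, ENNReal.ofReal_lt_one, Real.exp_lt_one_iff] at this
  by_contra h'
  push Not at h'
  nlinarith

/-- The mean number of particles in a state, in terms of Bose–Einstein occupation numbers. -/
lemma meanNumber_eq (φ : Eigenbasis l X) {β μ : ℝ} (hβ : 0 < β)
    (h : fockTrace (gibbsOp φ β μ) ≠ ⊤) (f : L2Box l) :
    meanNumber φ β μ f = ∑' i, ENNReal.ofReal (bose β μ (φ.energy i)) *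
      ENNReal.ofReal (‖inner ℂ (φ.vec i) f‖ ^ 2) := by
  have hlt := lt_energy_of_fockTrace_ne_top φ hβ h
  unfold meanNumber
  rw [fockTrace_gibbs_number]
  rw [fockTrace_gibbsOp] at h ⊢
  rw [mul_div_assoc, ENNReal.div_self (ne_of_gt (lt_of_lt_of_le one_pos
    (one_le_tsum_configWeight _))) h, mul_one]
  refine tsum_congr fun i => ?_
  rw [mul_comm]
  congr 1
  exact tsum_boltzmann_pow_succ (mul_pos hβ (sub_pos.2 (hlt i)))

lemma meanNumber_vec (φ : Eigenbasis l X) {β μ : ℝ} (hβ : 0 < β)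
    (h : fockTrace (gibbsOp φ β μ) ≠ ⊤) (i : ℕ) :
    meanNumber φ β μ (φ.vec i) = ENNReal.ofReal (bose β μ (φ.energy i)) := by
  rw [meanNumber_eq φ hβ h, tsum_eq_single i]
  · simp [φ.vec.orthonormal.1 i]
  · intro j hj
    simp [φ.vec.orthonormal.2 hj]

end Gas

end

end LuttingerSy

namespace LuttingerSy

noncomputable section

/-! ### Comparison of eigenbases -/

/-- An orthonormal basis of eigenfunctions with an arbitrary index type. -/
structure EigenSystem (l : ℝ) (X : Set ℝ) (ι : Type*) where
  vec : HilbertBasis ι ℂ (L2Box l)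
  energy : ι → ℝ
  eigen : ∀ i, HamiltonianApply l X (vec i) ((energy i : ℂ) • vec i)

/-- Forget the order of the eigenvalues. -/
def Eigenbasis.toSystem {l : ℝ} {X : Set ℝ} (φ : Eigenbasis l X) : EigenSystem l X ℕ :=
  ⟨φ.vec, φ.energy, φ.eigen⟩

variable {l : ℝ} {X : Set ℝ} {ι κ : Type*}

lemma HasFormDeriv.mono {Y : Set ℝ} {u v : L2Box l} (h : HasFormDeriv l X u v) (hY : Y ⊆ X) :
    HasFormDeriv l Y u v :=
  ⟨h.1, h.2.1, fun x hx => h.2.2 x ⟨hY hx.1, hx.2⟩⟩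

lemma conj_half : (starRingEnd ℂ) (1 / 2 : ℂ) = 1 / 2 := by
  rw [map_div₀, map_one, map_ofNat]

/-- The form is Hermitian: testing each eigenvector equation with the other eigenvector gives `E`
and `E'` times the same inner product. -/
lemma HamiltonianApply.inner_eq_zero {u u' : L2Box l} {E E' : ℝ}
    (h : HamiltonianApply l X u ((E : ℂ) • u)) (h' : HamiltonianApply l X u' ((E' : ℂ) • u'))
    (hE : E ≠ E') : (inner ℂ u u' : ℂ) = 0 := by
  obtain ⟨v, hv, hv2⟩ := h
  obtain ⟨v', hv', hv2'⟩ := h'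
  have h1 := hv2 u' v' hv'
  have h2 := hv2' u v hv
  rw [inner_smul_right] at h1 h2
  have h3 := congrArg (starRingEnd ℂ) h1
  rw [map_mul, map_mul, inner_conj_symm, inner_conj_symm, Complex.conj_ofReal] at h3
  rw [conj_half, h2] at h3
  have h5 : ((E' : ℂ) - E) * (inner ℂ u u' : ℂ) = 0 := by rw [sub_mul, h3, sub_self]
  rcases mul_eq_zero.1 h5 with h6 | h6
  · exact absurd (by exact_mod_cast (sub_eq_zero.1 h6).symm) hE
  · exact h6

lemma tsum_sq_inner (b : HilbertBasis ι ℂ (L2Box l)) (x : L2Box l) :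
    ∑' i, ENNReal.ofReal (‖(inner ℂ (b i) x : ℂ)‖ ^ 2) = ENNReal.ofReal (‖x‖ ^ 2) := by
  have h := b.hasSum_inner_mul_inner x x
  have h2 : HasSum (fun i => ‖(inner ℂ (b i) x : ℂ)‖ ^ 2) (‖x‖ ^ 2) := by
    have h3 := Complex.hasSum_re h
    convert! h3 using 1
    · ext i
      rw [← inner_conj_symm x (b i), mul_comm, Complex.mul_conj, Complex.ofReal_re,
        Complex.normSq_eq_norm_sq]
    · exact (inner_self_eq_norm_sq (𝕜 := ℂ) x).symm
  rw [← h2.tsum_eq, ENNReal.ofReal_tsum_of_nonneg (fun _ => by positivity) h2.summable]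

namespace EigenSystem

/-- The spectral projection of a vector. -/
lemma exists_projection (S : EigenSystem l X ι) (A : Set ℝ) (x : L2Box l) :
    ∃ y : L2Box l, ∀ i, (inner ℂ (S.vec i) y : ℂ)
      = A.indicator 1 (S.energy i) * inner ℂ (S.vec i) x := by
  have hmem : Memℓp (fun i => A.indicator (1 : ℝ → ℂ) (S.energy i) * S.vec.repr x i) 2 := by
    refine memℓp_gen (Summable.of_nonneg_of_le (fun i => by positivity) (fun i => ?_)
      ((lp.memℓp (S.vec.repr x)).summable (by norm_num)))
    refine Real.rpow_le_rpow (norm_nonneg _) ?_ (by norm_num)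
    by_cases h : S.energy i ∈ A
    · rw [indicator_of_mem h, Pi.one_apply, one_mul]
    · rw [indicator_of_notMem h, zero_mul, norm_zero]
      exact norm_nonneg _
  refine ⟨S.vec.repr.symm ⟨_, hmem⟩, fun i => ?_⟩
  rw [← S.vec.repr_apply_apply, LinearIsometryEquiv.apply_symm_apply, ← S.vec.repr_apply_apply]

/-- The spectral projection of `x` onto the energies in `A`, constructed from `T`, has the expected
coefficients in `S` too, because eigenvectors of different energies are orthogonal. Parseval in both
bases gives equal norms. -/
lemma tsum_indicator_sq_inner (S : EigenSystem l X ι) (T : EigenSystem l X κ) (A : Set ℝ)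
    (x : L2Box l) :
    ∑' i, A.indicator (1 : ℝ → ℝ≥0∞) (S.energy i) * ENNReal.ofReal (‖(inner ℂ (S.vec i) x : ℂ)‖ ^ 2)
      = ∑' j, A.indicator (1 : ℝ → ℝ≥0∞) (T.energy j) *
          ENNReal.ofReal (‖(inner ℂ (T.vec j) x : ℂ)‖ ^ 2) := by
  obtain ⟨y, hy⟩ := T.exists_projection A x
  have hS : ∀ i, (inner ℂ (S.vec i) y : ℂ)
      = A.indicator 1 (S.energy i) * inner ℂ (S.vec i) x := by
    intro i
    rw [← T.vec.tsum_inner_mul_inner (S.vec i) y, ← T.vec.tsum_inner_mul_inner (S.vec i) x,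
      ← tsum_mul_left]
    refine tsum_congr fun j => ?_
    rw [hy]
    by_cases h : S.energy i = T.energy j
    · rw [h]; ring
    · rw [(S.eigen i).inner_eq_zero (T.eigen j) h]; ring
  have key : ∀ (e : ℝ) (z w : ℂ), z = A.indicator 1 e * w → ENNReal.ofReal (‖z‖ ^ 2)
      = A.indicator (1 : ℝ → ℝ≥0∞) e * ENNReal.ofReal (‖w‖ ^ 2) := by
    rintro e z w rfl
    by_cases h : e ∈ A <;> simp [h]
  simp_rw [← fun i => key _ _ _ (hS i), ← fun i => key _ _ _ (hy i)]
  rw [tsum_sq_inner, tsum_sq_inner]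

lemma tsum_comp_energy (S : EigenSystem l X ι) (g : ℝ → ℝ≥0∞) (p : ι → ℝ≥0∞) :
    ∑' i, g (S.energy i) * p i
      = ∑' e : ℝ, g e * ∑' i, ({e} : Set ℝ).indicator (1 : ℝ → ℝ≥0∞) (S.energy i) * p i := by
  simp_rw [← ENNReal.tsum_mul_left]
  rw [ENNReal.tsum_comm]
  refine tsum_congr fun i => ?_
  rw [tsum_eq_single (S.energy i)]
  · simp
  · intro e he
    simp [he.symm]

/-- Diagonal sums `∑ g(E_i) |⟨φ_i, x⟩|²` do not depend on the choice of the eigenbasis. -/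
lemma tsum_sq_inner_eq (S : EigenSystem l X ι) (T : EigenSystem l X κ) (g : ℝ → ℝ≥0∞)
    (x : L2Box l) :
    ∑' i, g (S.energy i) * ENNReal.ofReal (‖(inner ℂ (S.vec i) x : ℂ)‖ ^ 2)
      = ∑' j, g (T.energy j) * ENNReal.ofReal (‖(inner ℂ (T.vec j) x : ℂ)‖ ^ 2) := by
  rw [S.tsum_comp_energy, T.tsum_comp_energy]
  simp_rw [S.tsum_indicator_sq_inner T]

/-- Traces `∑ g(E_i)` do not depend on the choice of the eigenbasis. -/
lemma tsum_energy_eq (S : EigenSystem l X ι) (T : EigenSystem l X κ) (g : ℝ → ℝ≥0∞) :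
    ∑' i, g (S.energy i) = ∑' j, g (T.energy j) := by
  have h1 : ∀ i, g (S.energy i) = ∑' j, g (T.energy j) *
      ENNReal.ofReal (‖(inner ℂ (T.vec j) (S.vec i) : ℂ)‖ ^ 2) := by
    intro i
    rw [← S.tsum_sq_inner_eq T g (S.vec i), tsum_eq_single i]
    · simp [S.vec.orthonormal.1 i]
    · intro j hj
      simp [S.vec.orthonormal.2 hj]
  simp_rw [h1]
  rw [ENNReal.tsum_comm]
  refine tsum_congr fun j => ?_
  have h2 := tsum_sq_inner S.vec (T.vec j)
  simp_rw [fun i => norm_inner_symm (𝕜 := ℂ) (S.vec i) (T.vec j)] at h2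
  rw [ENNReal.tsum_mul_left, h2, T.vec.orthonormal.1 j]
  simp

lemma norm_sq_deriv (S : EigenSystem l X ι) {i : ι} {v : L2Box l}
    (hv : HasFormDeriv l X (S.vec i) v)
    (hv2 : ∀ η dη : L2Box l, HasFormDeriv l X η dη →
      (1 / 2 : ℂ) * inner ℂ dη v = inner ℂ η ((S.energy i : ℂ) • S.vec i)) :
    ‖v‖ ^ 2 = 2 * S.energy i := by
  have h := hv2 _ _ hv
  rw [inner_smul_right, inner_self_eq_norm_sq_to_K, inner_self_eq_norm_sq_to_K,
    S.vec.orthonormal.1 i] at h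
  have h3 : (((1 / 2 : ℝ) * ‖v‖ ^ 2 : ℝ) : ℂ) = (S.energy i : ℂ) := by
    push_cast
    simpa using h
  have h4 : (1 / 2 : ℝ) * ‖v‖ ^ 2 = S.energy i := by exact_mod_cast h3
  linarith

/-- The kinetic energy of an eigenfunction of the Hamiltonian with impurities is at most its
energy. -/
lemma sum_kinetic_le (S : EigenSystem l X ι) (T : EigenSystem l ∅ κ) (i : ι) (s : Finset κ) :
    ∑ k ∈ s, T.energy k * ‖(inner ℂ (T.vec k) (S.vec i) : ℂ)‖ ^ 2 ≤ S.energy i := by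
  classical
  obtain ⟨v, hv, hv2⟩ := S.eigen i
  choose w hw hw2 using T.eigen
  set c : κ → ℂ := fun k => inner ℂ (T.vec k) (S.vec i) with hc
  set D : ℝ := ∑ k ∈ s, T.energy k * ‖c k‖ ^ 2 with hD
  have hww : ∀ j k, (inner ℂ (w j) (w k) : ℂ) = if j = k then (2 * T.energy k : ℂ) else 0 := by
    intro j k
    have h := hw2 k _ _ (hw j)
    rw [inner_smul_right] at h
    have h' : (inner ℂ (w j) (w k) : ℂ) = 2 * (T.energy k * inner ℂ (T.vec j) (T.vec k)) := by
      rw [← h]; ring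
    rw [h']
    by_cases hjk : j = k
    · subst hjk
      rw [inner_self_eq_norm_sq_to_K, T.vec.orthonormal.1 j]
      simp
    · rw [T.vec.orthonormal.2 hjk]
      simp [hjk]
  have hwv : ∀ k, (inner ℂ (w k) v : ℂ) = 2 * T.energy k * c k := by
    intro k
    have h := congrArg (starRingEnd ℂ) (hw2 k _ _ (hv.mono (empty_subset X)))
    rw [inner_smul_right, map_mul, map_mul, inner_conj_symm, inner_conj_symm,
      Complex.conj_ofReal] at h
    rw [conj_half] at h
    rw [hc, mul_assoc, ← h]
    ring
  have hvv := S.norm_sq_deriv hv hv2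
  -- `p` is the projection of `v` onto the span of the orthogonal derivatives `w k`. The form domain
  -- with impurities lies in the one without, so `S.vec i` may be tested in the kinetic eigenvalue
  -- equations. This gives `⟨p, v⟩ = ⟨p, p⟩ = 2 D`, while `‖v‖² = 2 E`. Bessel's inequality `0 ≤ ‖p
  -- - v‖²` is then the claim.
  set p : L2Box l := ∑ k ∈ s, c k • w k with hp
  have hcc : ∀ k, (starRingEnd ℂ) (c k) * c k = ((‖c k‖ ^ 2 : ℝ) : ℂ) := by
    intro k
    rw [mul_comm, Complex.mul_conj, Complex.normSq_eq_norm_sq]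
  have hpv : (inner ℂ p v : ℂ) = ((2 * D : ℝ) : ℂ) := by
    rw [hp, sum_inner, hD, Finset.mul_sum]
    push_cast
    refine Finset.sum_congr rfl fun k _ => ?_
    rw [inner_smul_left, hwv]
    have := hcc k
    push_cast at this
    rw [← this]
    ring
  have hpp : (inner ℂ p p : ℂ) = ((2 * D : ℝ) : ℂ) := by
    have : ∀ k ∈ s, (inner ℂ p (w k) : ℂ) = 2 * T.energy k * (starRingEnd ℂ) (c k) := by
      intro k hk
      rw [hp, sum_inner]
      simp_rw [inner_smul_left, hww]
      simp only [mul_ite, mul_zero]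
      rw [Finset.sum_ite_eq' s k, if_pos hk]
      ring
    nth_rewrite 2 [hp]
    rw [inner_sum, hD, Finset.mul_sum]
    push_cast
    refine Finset.sum_congr rfl fun k hk => ?_
    rw [inner_smul_right, this k hk]
    have := hcc k
    push_cast at this
    rw [← this]
    ring
  have h0 : 0 ≤ ‖p - v‖ ^ 2 := by positivity
  rw [norm_sub_sq (𝕜 := ℂ), ← inner_self_eq_norm_sq (𝕜 := ℂ) p, hpp, hpv, hvv] at h0
  simp only [RCLike.re_to_complex, Complex.ofReal_re] at h0
  linarith

end EigenSystem

end

end LuttingerSy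

/-! ### Integration by parts and truncated eigenfunctions -/

namespace LuttingerSy

noncomputable section

/-- Form-domain elements are primitives of integrable functions, hence merely absolutely continuous.
Integration by parts for absolutely continuous functions is combined with Lebesgue's differentiation
theorem. -/
lemma real_integral_mul_primitive {c d a b : ℝ} {h g g' : ℝ → ℝ}
    (hh : IntervalIntegrable h volume c d) (ha : a ∈ uIcc c d) (hb : b ∈ uIcc c d)
    (hg : ∀ x, HasDerivAt g (g' x) x) (hg' : Continuous g') :
    ∫ x in a..b, g x * h x = g b * (∫ t in c..b, h t) - g a * (∫ t in c..a, h t)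
      - ∫ x in a..b, g' x * ∫ t in c..x, h t := by
  have hsub : uIcc a b ⊆ uIcc c d := uIcc_subset_uIcc ha hb
  have h1 : AbsolutelyContinuousOnInterval (fun x => ∫ t in c..x, h t) a b :=
    (hh.absolutelyContinuousOnInterval_intervalIntegral left_mem_uIcc).mono hsub
  have hd : deriv g = g' := funext fun x => (hg x).deriv
  have h2 : AbsolutelyContinuousOnInterval g a b := by
    refine ContDiffOn.absolutelyContinuousOnInterval (ContDiff.contDiffOn ?_)
    rw [contDiff_one_iff_deriv]
    exact ⟨fun x => (hg x).differentiableAt, hd ▸ hg'⟩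
  have h3 := h2.integral_mul_deriv_eq_deriv_mul h1
  rw [hd] at h3
  rw [← h3]
  refine intervalIntegral.integral_congr_ae ?_
  filter_upwards [hh.ae_hasDerivAt_integral] with x hx hxab
  have hx' : x ∈ uIcc c d := hsub (uIoc_subset_uIcc hxab)
  rw [(hx hx' c left_mem_uIcc).deriv]

lemma integral_mul_primitive {c d a b : ℝ} {h : ℝ → ℂ} {g g' : ℝ → ℝ}
    (hh : IntervalIntegrable h volume c d) (ha : a ∈ uIcc c d) (hb : b ∈ uIcc c d)
    (hg : ∀ x, HasDerivAt g (g' x) x) (hg' : Continuous g') :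
    ∫ x in a..b, (g x : ℂ) * h x = g b * (∫ t in c..b, h t) - g a * (∫ t in c..a, h t)
      - ∫ x in a..b, (g' x : ℂ) * ∫ t in c..x, h t := by
  have hsub : uIcc a b ⊆ uIcc c d := uIcc_subset_uIcc ha hb
  have hgc : Continuous g := continuous_iff_continuousAt.2 fun x => (hg x).continuousAt
  have hcont : ContinuousOn (fun x => ∫ t in c..x, h t) (uIcc a b) :=
    (intervalIntegral.continuousOn_primitive_interval' hh left_mem_uIcc).mono hsub
  have hi1 : IntervalIntegrable (fun x => (g x : ℂ) * h x) volume a b :=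
    (hh.mono_set hsub).continuousOn_mul (Complex.continuous_ofReal.comp hgc).continuousOn
  have hi2 : IntervalIntegrable (fun x => (g' x : ℂ) * ∫ t in c..x, h t) volume a b :=
    ((Complex.continuous_ofReal.comp hg').continuousOn.mul hcont).intervalIntegrable
  have hre : ∀ x ∈ uIcc c d, (∫ t in c..x, h t).re = ∫ t in c..x, (h t).re := fun x hx =>
    (Complex.reCLM.intervalIntegral_comp_comm (hh.mono_set (uIcc_subset_uIcc_left hx))).symm
  have him : ∀ x ∈ uIcc c d, (∫ t in c..x, h t).im = ∫ t in c..x, (h t).im := fun x hx =>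
    (Complex.imCLM.intervalIntegral_comp_comm (hh.mono_set (uIcc_subset_uIcc_left hx))).symm
  apply Complex.ext
  · have h1 := real_integral_mul_primitive (h := fun t => (h t).re)
      ⟨Complex.reCLM.integrable_comp hh.1, Complex.reCLM.integrable_comp hh.2⟩ ha hb hg hg'
    have e1 := Complex.reCLM.intervalIntegral_comp_comm hi1
    have e2 := Complex.reCLM.intervalIntegral_comp_comm hi2
    simp only [Complex.reCLM_apply, Complex.re_ofReal_mul] at e1 e2
    simp only [Complex.sub_re, Complex.re_ofReal_mul]
    rw [← e1, ← e2, hre b hb, hre a ha, h1]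
    congr 1
    exact intervalIntegral.integral_congr fun x hx => by simp only [hre x (hsub hx)]
  · have h1 := real_integral_mul_primitive (h := fun t => (h t).im)
      ⟨Complex.imCLM.integrable_comp hh.1, Complex.imCLM.integrable_comp hh.2⟩ ha hb hg hg'
    have e1 := Complex.imCLM.intervalIntegral_comp_comm hi1
    have e2 := Complex.imCLM.intervalIntegral_comp_comm hi2
    simp only [Complex.imCLM_apply, Complex.im_ofReal_mul] at e1 e2
    simp only [Complex.sub_im, Complex.im_ofReal_mul]
    rw [← e1, ← e2, him b hb, him a ha, h1]
    congr 1
    exact intervalIntegral.integral_congr fun x hx => by simp only [him x (hsub hx)]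

/-! ### Functions supported in a subinterval -/

instance (l : ℝ) : IsFiniteMeasure (volume.restrict (box l)) := by
  unfold box; infer_instance

lemma memLp_piece (l a b : ℝ) (f : C(ℝ, ℝ)) :
    MemLp ((Ioo a b).indicator fun x => (f x : ℂ)) 2 (volume.restrict (box l)) := by
  obtain ⟨C, hC⟩ := (isCompact_Icc (a := a) (b := b)).exists_bound_of_continuousOn
    f.continuous.continuousOn
  refine MemLp.of_bound ?_ (max C 0) (Eventually.of_forall fun x => ?_)
  · exact ((Complex.continuous_ofReal.comp f.continuous).measurable.indicator
      measurableSet_Ioo).aestronglyMeasurable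
  · by_cases hx : x ∈ Ioo a b
    · rw [indicator_of_mem hx, Complex.norm_real]
      exact le_max_of_le_left (hC x (Ioo_subset_Icc_self hx))
    · simp [indicator_of_notMem hx]

/-- The element of `L²(Λ_l)` equal to `f` on the interval `(a, b)` and to `0` elsewhere. -/
def piece (l a b : ℝ) (f : C(ℝ, ℝ)) : L2Box l := (memLp_piece l a b f).toLp _

lemma coeFn_piece (l a b : ℝ) (f : C(ℝ, ℝ)) :
    piece l a b f =ᵐ[volume.restrict (box l)] (Ioo a b).indicator fun x => (f x : ℂ) :=
  MemLp.coeFn_toLp _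

variable {l a b : ℝ}

lemma Ioo_subset_box (ha : -l / 2 ≤ a) (hb : b ≤ l / 2) : Ioo a b ⊆ box l :=
  Ioo_subset_Ioo ha hb

lemma inner_piece (ha : -l / 2 ≤ a) (hab : a ≤ b) (hb : b ≤ l / 2) (f : C(ℝ, ℝ)) (u : L2Box l) :
    (inner ℂ (piece l a b f) u : ℂ) = ∫ x in a..b, (f x : ℂ) * u x := by
  rw [L2.inner_def, intervalIntegral.integral_of_le hab, integral_Ioc_eq_integral_Ioo]
  have h1 : (fun x => (inner ℂ (piece l a b f x) (u x) : ℂ)) =ᵐ[volume.restrict (box l)]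
      (Ioo a b).indicator fun x => (f x : ℂ) * u x := by
    filter_upwards [coeFn_piece l a b f] with x hx
    rw [hx]
    by_cases h : x ∈ Ioo a b
    · simp [h, mul_comm]
    · simp [h]
  rw [integral_congr_ae h1, setIntegral_indicator measurableSet_Ioo,
    inter_eq_right.2 (Ioo_subset_box ha hb)]

lemma intervalIntegrable_coe (h : -l / 2 ≤ l / 2) (v : L2Box l) :
    IntervalIntegrable v volume (-l / 2) (l / 2) := by
  rw [intervalIntegrable_iff_integrableOn_Ioo_of_le h]
  exact (Lp.memLp v).integrable (by norm_num)

lemma primitive_eq_setIntegral (v : L2Box l) {x : ℝ} (hx : -l / 2 ≤ x) :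
    primitive l v x = ∫ t in Ioo (-l / 2) x, v t := by
  rw [primitive, intervalIntegral.integral_of_le hx, integral_Ioc_eq_integral_Ioo]

/-- As `f` vanishes at both endpoints, its extension by zero is continuous, and its weak derivative
is the truncated derivative, without point masses. -/
lemma primitive_piece (ha : -l / 2 ≤ a) (hab : a ≤ b) {f g : C(ℝ, ℝ)}
    (hfg : ∀ x, HasDerivAt f (g x) x) (hfa : f a = 0) (hfb : f b = 0) {x : ℝ}
    (hx : x ∈ Icc (-l / 2) (l / 2)) :
    primitive l (piece l a b g) x = (Ioo a b).indicator (fun x => (f x : ℂ)) x := by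
  have hcongr : ∫ t in Ioo (-l / 2) x, piece l a b g t
      = ∫ t in Ioo (-l / 2) x, (Ioo a b).indicator (fun x => (g x : ℂ)) t :=
    integral_congr_ae (ae_mono (Measure.restrict_mono (Ioo_subset_Ioo_right hx.2) le_rfl)
      (coeFn_piece l a b g))
  have hftc : ∀ y, ∫ t in a..y, (g t : ℂ) = f y := by
    intro y
    rw [intervalIntegral.integral_ofReal, intervalIntegral.integral_eq_sub_of_hasDerivAt
      (fun t _ => hfg t) (g.continuous.intervalIntegrable _ _), hfa, sub_zero]
  rw [primitive_eq_setIntegral _ hx.1, hcongr, setIntegral_indicator measurableSet_Ioo,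
    Ioo_inter_Ioo, max_eq_right ha]
  rcases le_or_gt x a with hxa | hxa
  · rw [Ioo_eq_empty (not_lt.2 ((min_le_left _ _).trans hxa)), indicator_of_notMem (by simp [hxa])]
    simp
  · rcases lt_or_ge x b with hxb | hxb
    · rw [min_eq_left hxb.le, indicator_of_mem (show x ∈ Ioo a b from ⟨hxa, hxb⟩), ← hftc x,
        intervalIntegral.integral_of_le hxa.le, integral_Ioc_eq_integral_Ioo]
    · rw [min_eq_right hxb, indicator_of_notMem (by simp [hxb])]
      rw [← integral_Ioc_eq_integral_Ioo, ← intervalIntegral.integral_of_le hab, hftc, hfb]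
      simp

/-- Both endpoints of the interval are Dirichlet points of the form domain, so the boundary terms
vanish when `g` is integrated by parts against any test function. The equation `g' = -2 E f` then
yields the eigenvalue. -/
lemma hamiltonianApply_piece {X : Set ℝ} (ha : -l / 2 ≤ a) (hab : a ≤ b) (hb : b ≤ l / 2)
    (haX : a = -l / 2 ∨ a ∈ X ∩ box l) (hbX : b = l / 2 ∨ b ∈ X ∩ box l)
    (hX : Disjoint (Ioo a b) X)
    {f g : C(ℝ, ℝ)} {E : ℝ} (hfg : ∀ x, HasDerivAt f (g x) x)
    (hg : ∀ x, HasDerivAt g (-(2 * E) * f x) x) (hfa : f a = 0) (hfb : f b = 0) :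
    HamiltonianApply l X (piece l a b f) ((E : ℂ) • piece l a b f) := by
  refine ⟨piece l a b g, ⟨?_, ?_, ?_⟩, ?_⟩
  · filter_upwards [coeFn_piece l a b f, ae_restrict_mem measurableSet_Ioo] with x hx hxl
    rw [hx, primitive_piece ha hab hfg hfa hfb (Ioo_subset_Icc_self hxl)]
  · rw [primitive_piece ha hab hfg hfa hfb (right_mem_Icc.2 (ha.trans (hab.trans hb))),
      indicator_of_notMem (by simp [hb])]
  · intro x hx
    rw [primitive_piece ha hab hfg hfa hfb (Ioo_subset_Icc_self hx.2),
      indicator_of_notMem fun h => disjoint_left.1 hX h hx.1]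
  · rintro η dη ⟨h1, h2, h3⟩
    have hl : -l / 2 ≤ l / 2 := ha.trans (hab.trans hb)
    have hη : ∀ y, y = -l / 2 ∨ y = l / 2 ∨ y ∈ X ∩ box l → primitive l dη y = 0 := by
      rintro y (rfl | rfl | hy)
      · simp [primitive]
      · exact h2
      · exact h3 y hy
    have hpa : ∫ t in (-l / 2)..a, dη t = 0 := hη a (by tauto)
    have hpb : ∫ t in (-l / 2)..b, dη t = 0 := hη b (by tauto)
    have hibp := integral_mul_primitive (intervalIntegrable_coe hl dη)
      (a := a) (b := b) (by rw [uIcc_of_le hl]; exact ⟨ha, hab.trans hb⟩)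
      (by rw [uIcc_of_le hl]; exact ⟨ha.trans hab, hb⟩) hg (by fun_prop)
    rw [hpa, hpb, mul_zero, mul_zero, sub_zero, zero_sub] at hibp
    have hlast : ∫ x in a..b, ((-(2 * E) * f x : ℝ) : ℂ) * ∫ t in (-l / 2)..x, dη t
        = -(2 * E) * inner ℂ (piece l a b f) η := by
      rw [inner_piece ha hab hb, ← intervalIntegral.integral_const_mul,
        intervalIntegral.integral_of_le hab, intervalIntegral.integral_of_le hab,
        integral_Ioc_eq_integral_Ioo, integral_Ioc_eq_integral_Ioo]
      refine integral_congr_ae (ae_mono (Measure.restrict_mono (Ioo_subset_box ha hb) le_rfl) ?_)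
      filter_upwards [h1] with x hx
      rw [hx, primitive]
      push_cast
      ring
    rw [hlast, ← inner_piece ha hab hb] at hibp
    have := congrArg (starRingEnd ℂ) hibp
    rw [inner_conj_symm, map_neg, map_mul, inner_conj_symm] at this
    rw [this, inner_smul_right]
    have h2E : (starRingEnd ℂ) (-(2 * (E : ℂ))) = -(2 * E) := by simp [map_ofNat]
    rw [h2E]
    ring

end

end LuttingerSy

namespace LuttingerSy

noncomputable section

/-! ### Completeness of the sine functions -/

/-- Reflect oddly about `a`. On the doubled interval the Fourier coefficients of the reflected
function are multiples of the sine coefficients of `f`, so they all vanish, and Parseval gives zero.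
-/
lemma eq_zero_of_sine_coeff_eq_zero {a b : ℝ} (hab : a < b) {f : ℝ → ℂ} (hf : MemLp f 2 volume)
    (hsupp : ∀ x, x ∉ Ioo a b → f x = 0)
    (h : ∀ m : ℕ, ∫ x, (Real.sin ((m + 1) * Real.pi / (b - a) * (x - a)) : ℂ) * f x = 0) :
    f =ᵐ[volume] 0 := by
  have hba : 0 < b - a := sub_pos.2 hab
  have hlt : a - (b - a) < b := by linarith
  set F : ℝ → ℂ := fun x => f x - f (2 * a - x) with hF
  have hmp : MeasurePreserving (fun x : ℝ => 2 * a - x) volume volume :=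
    Measure.measurePreserving_sub_left volume (2 * a)
  have hF2 : MemLp F 2 volume := hf.sub (hf.comp_measurePreserving hmp)
  have hfi : Integrable f := by
    have h1 : Integrable f (volume.restrict (Ioo a b)) := hf.restrict _ |>.integrable (by norm_num)
    exact (integrableOn_iff_integrable_of_support_subset fun x hx => by
      by_contra h'; exact hx (hsupp x h')).1 h1
  have hFsupp : ∀ x, x ∉ Ioc (a - (b - a)) b → F x = 0 := by
    intro x hx
    rw [hF]
    simp only
    rw [hsupp x fun h' => hx ⟨by linarith [h'.1], h'.2.le⟩,
      hsupp (2 * a - x) fun h' => hx ⟨by linarith [h'.2], by linarith [h'.1]⟩, sub_zero]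
  -- Negative frequencies follow because sine is odd, and frequency zero is trivial.
  have hs : ∀ n : ℤ, ∫ x, (Real.sin (n * Real.pi / (b - a) * (x - a)) : ℂ) * f x = 0 := by
    intro n
    rcases lt_trichotomy n 0 with hn | hn | hn
    · obtain ⟨m, rfl⟩ : ∃ m : ℕ, n = -(m + 1) := ⟨(-n - 1).toNat, by omega⟩
      have h1 := congrArg Neg.neg (h m)
      rw [← integral_neg, neg_zero] at h1
      rw [← h1]
      refine integral_congr_ae (Eventually.of_forall fun x => ?_)
      simp only
      rw [← neg_mul, ← Complex.ofReal_neg, ← Real.sin_neg]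
      congr 3
      push_cast
      ring
    · subst hn
      simp
    · obtain ⟨m, rfl⟩ : ∃ m : ℕ, n = m + 1 := ⟨(n - 1).toNat, by omega⟩
      rw [← h m]
      push_cast
      rfl
  have hcoef : ∀ n : ℤ, fourierCoeffOn hlt F n = 0 := by
    intro n
    rw [fourierCoeffOn_eq_integral, intervalIntegral.integral_of_le hlt.le,
      setIntegral_eq_integral_of_forall_compl_eq_zero fun x hx => by rw [hFsupp x hx, smul_zero]]
    set e : ℝ → ℂ := fun x => fourier (-n) (x : AddCircle (b - (a - (b - a)))) with he
    have he' : ∀ x, e x = Complex.exp (-(Real.pi * n * x / (b - a)) * Complex.I) := by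
      intro x
      rw [he]
      simp only
      rw [fourier_coe_apply]
      congr 1
      have : ((b : ℂ) - a) ≠ 0 := by exact_mod_cast hba.ne'
      have h2 : ((b : ℂ) - (a - (b - a))) = 2 * (b - a) := by ring
      push_cast
      rw [h2]
      field_simp
    have hec : Continuous e := by
      have : e = fun x : ℝ => Complex.exp (-(Real.pi * n * x / (b - a)) * Complex.I) := funext he'
      rw [this]
      fun_prop
    have hebd : ∀ x, ‖e x‖ ≤ 1 := by
      intro x
      rw [he']
      have : (-(Real.pi * n * x / (b - a)) * Complex.I : ℂ)
          = ((-(Real.pi * n * x / (b - a)) : ℝ) : ℂ) * Complex.I := by push_cast; ring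
      rw [this, Complex.norm_exp_ofReal_mul_I]
    have hi1 : Integrable fun x => e x * f x :=
      hfi.bdd_mul hec.aestronglyMeasurable (Eventually.of_forall hebd)
    have hi2 : Integrable fun x => e x * f (2 * a - x) :=
      (hmp.integrable_comp_of_integrable hfi).bdd_mul hec.aestronglyMeasurable
        (Eventually.of_forall hebd)
    have hi3 : Integrable fun x => e (2 * a - x) * f x :=
      hfi.bdd_mul (hec.comp (by fun_prop)).aestronglyMeasurable
        (Eventually.of_forall fun x => hebd _)
    have hI : ∫ x, e x * f (2 * a - x) = ∫ x, e (2 * a - x) * f x := by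
      rw [← integral_sub_left_eq_self (fun x => e (2 * a - x) * f x) volume (2 * a)]
      simp
    have : ∫ x, e x • F x = 0 := by
      simp only [hF, smul_eq_mul, mul_sub]
      rw [integral_sub hi1 hi2, hI, ← integral_sub hi1 hi3]
      have h3 : ∀ x, e x * f x - e (2 * a - x) * f x
          = (-2 * Complex.I * Complex.exp (-(Real.pi * n * a / (b - a)) * Complex.I)) *
            ((Real.sin (n * Real.pi / (b - a) * (x - a)) : ℂ) * f x) := by
        intro x
        have hy : e x = Complex.exp (-(Real.pi * n * a / (b - a)) * Complex.I) *
            Complex.exp (-(n * Real.pi / (b - a) * (x - a)) * Complex.I) := by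
          rw [he', ← Complex.exp_add]
          congr 1
          ring
        have hz : e (2 * a - x) = Complex.exp (-(Real.pi * n * a / (b - a)) * Complex.I) *
            Complex.exp ((n * Real.pi / (b - a) * (x - a)) * Complex.I) := by
          rw [he', ← Complex.exp_add]
          congr 1
          push_cast
          ring
        rw [hy, hz, Complex.ofReal_sin, Complex.sin]
        push_cast
        have hI2 := Complex.I_mul_I
        linear_combination (Complex.exp (-(Real.pi * n * a / (b - a)) * Complex.I) *
          (Complex.exp (-(n * Real.pi / (b - a) * (x - a)) * Complex.I) -
            Complex.exp ((n * Real.pi / (b - a) * (x - a)) * Complex.I)) * f x) * hI2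
      simp_rw [h3]
      rw [integral_const_mul, hs n, mul_zero]
    rw [this, smul_zero]
  have hsum := hasSum_sq_fourierCoeffOn hlt (hF2.restrict (Ioc (a - (b - a)) b))
  simp only [hcoef, norm_zero, ne_eq, OfNat.ofNat_ne_zero, not_false_eq_true, zero_pow] at hsum
  have h0 : ∫ x in (a - (b - a))..b, ‖F x‖ ^ 2 = 0 := by
    have := hsum.unique hasSum_zero
    rcases smul_eq_zero.1 this with h' | h'
    · exact absurd h' (inv_ne_zero (by linarith))
    · exact h'
  rw [intervalIntegral.integral_of_le hlt.le, setIntegral_eq_zero_iff_of_nonneg_ae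
    (Eventually.of_forall fun x => by positivity)
    (hF2.restrict (Ioc (a - (b - a)) b)).norm.integrable_sq] at h0
  rw [EventuallyEq, ae_restrict_iff' measurableSet_Ioc] at h0
  filter_upwards [h0] with x hx
  by_cases hxab : x ∈ Ioo a b
  · have h1 := hx ⟨by linarith [hxab.1], hxab.2.le⟩
    have h2 : F x = 0 := by simpa using h1
    rw [hF] at h2
    simp only at h2
    rwa [hsupp (2 * a - x) (by simp only [mem_Ioo, not_and_or, not_lt]; left; linarith [hxab.1]),
      sub_zero] at h2
  · exact hsupp x hxab

/-! ### The sine functions of an interval -/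

/-- The energy levels of an interval of length `s`. -/
def gapEnergy (m : ℕ) (s : ℝ) : ℝ := Real.pi ^ 2 * (m + 1) ^ 2 / (2 * s ^ 2)

/-- The Dirichlet eigenfunctions of the interval `(a, b)`. -/
def sineFun (a b : ℝ) (m : ℕ) : C(ℝ, ℝ) :=
  ⟨fun x => √(2 / (b - a)) * Real.sin ((m + 1) * Real.pi / (b - a) * (x - a)), by fun_prop⟩

/-- The derivatives of the functions `sineFun`. -/
def sineFunDeriv (a b : ℝ) (m : ℕ) : C(ℝ, ℝ) :=
  ⟨fun x => √(2 / (b - a)) * ((m + 1) * Real.pi / (b - a) *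
    Real.cos ((m + 1) * Real.pi / (b - a) * (x - a))), by fun_prop⟩

lemma sineFun_apply (a b : ℝ) (m : ℕ) (x : ℝ) :
    sineFun a b m x = √(2 / (b - a)) * Real.sin ((m + 1) * Real.pi / (b - a) * (x - a)) := rfl

lemma hasDerivAt_sineFun (a b : ℝ) (m : ℕ) (x : ℝ) :
    HasDerivAt (sineFun a b m) (sineFunDeriv a b m x) x := by
  have h1 : HasDerivAt (fun x : ℝ => (m + 1) * Real.pi / (b - a) * (x - a))
      ((m + 1) * Real.pi / (b - a)) x := by
    simpa using ((hasDerivAt_id x).sub_const a).const_mul ((m + 1) * Real.pi / (b - a))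
  convert! (h1.sin.const_mul (√(2 / (b - a)))) using 1
  simp only [sineFunDeriv, ContinuousMap.coe_mk]
  ring

lemma hasDerivAt_sineFunDeriv (a b : ℝ) (m : ℕ) (x : ℝ) :
    HasDerivAt (sineFunDeriv a b m) (-(2 * gapEnergy m (b - a)) * sineFun a b m x) x := by
  have h1 : HasDerivAt (fun x : ℝ => (m + 1) * Real.pi / (b - a) * (x - a))
      ((m + 1) * Real.pi / (b - a)) x := by
    simpa using ((hasDerivAt_id x).sub_const a).const_mul ((m + 1) * Real.pi / (b - a))
  convert! ((h1.cos.const_mul ((m + 1) * Real.pi / (b - a))).const_mul (√(2 / (b - a)))) using 1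
  simp only [sineFun, ContinuousMap.coe_mk, gapEnergy]
  rcases eq_or_ne (b - a) 0 with h | h
  · simp [h]
  · field_simp

lemma sineFun_left (a b : ℝ) (m : ℕ) : sineFun a b m a = 0 := by simp [sineFun]

lemma sineFun_right (a b : ℝ) (m : ℕ) : sineFun a b m b = 0 := by
  rcases eq_or_ne (b - a) 0 with h | h
  · simp [sineFun, h]
  · have : (m + 1) * Real.pi / (b - a) * (b - a) = ((m + 1 : ℕ) : ℝ) * Real.pi := by
      field_simp
      push_cast
      ring
    rw [sineFun_apply, this, Real.sin_nat_mul_pi, mul_zero]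

lemma integral_sineFun_sq {a b : ℝ} (hab : a < b) (m : ℕ) :
    ∫ x in a..b, sineFun a b m x * sineFun a b m x = 1 := by
  have hL : b - a ≠ 0 := (sub_pos.2 hab).ne'
  have hq : (m + 1) * Real.pi / (b - a) ≠ 0 := by positivity
  set q := (m + 1) * Real.pi / (b - a) with hqd
  have hd : ∀ x, HasDerivAt (fun x => (2 / (b - a)) * (x / 2 - Real.sin (q * (x - a)) *
      Real.cos (q * (x - a)) / (2 * q))) (sineFun a b m x * sineFun a b m x) x := by
    intro x
    have h1 : HasDerivAt (fun x : ℝ => q * (x - a)) q x := by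
      simpa using ((hasDerivAt_id x).sub_const a).const_mul q
    convert! ((((hasDerivAt_id x).div_const 2).sub ((h1.sin.mul h1.cos).div_const (2 * q))).const_mul
      (2 / (b - a))) using 1
    rw [sineFun_apply, ← hqd]
    have h2 : √(2 / (b - a)) * √(2 / (b - a)) = 2 / (b - a) :=
      Real.mul_self_sqrt (by have := sub_pos.2 hab; positivity)
    have h3 := Real.sin_sq_add_cos_sq (q * (x - a))
    calc _ = (√(2 / (b - a)) * √(2 / (b - a))) * Real.sin (q * (x - a)) ^ 2 := by ring
      _ = _ := by
        rw [h2]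
        field_simp
        linear_combination h3
  rw [intervalIntegral.integral_eq_sub_of_hasDerivAt (fun x _ => hd x)
    ((((sineFun a b m).continuous.mul (sineFun a b m).continuous)).intervalIntegrable _ _)]
  have hb : q * (b - a) = ((m + 1 : ℕ) : ℝ) * Real.pi := by
    rw [hqd]
    field_simp
    push_cast
    ring
  rw [hb, Real.sin_nat_mul_pi]
  simp
  field_simp

end

end LuttingerSy

namespace LuttingerSy

noncomputable section

/-! ### The gaps between the impurities -/

/-- The intervals `(a, right a)`, `a ∈ lefts`, into which `X` cuts the box `Λ_l`. -/
structure Gaps (l : ℝ) (X : Set ℝ) where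
  lefts : Finset ℝ
  right : ℝ → ℝ
  lt_right : ∀ a ∈ lefts, a < right a
  le_left : ∀ a ∈ lefts, -l / 2 ≤ a
  right_le : ∀ a ∈ lefts, right a ≤ l / 2
  left_eq : ∀ a ∈ lefts, a = -l / 2 ∨ a ∈ X ∩ box l
  right_eq : ∀ a ∈ lefts, right a = l / 2 ∨ right a ∈ X ∩ box l
  right_le_left : ∀ a ∈ lefts, ∀ a' ∈ lefts, a < a' → right a ≤ a'
  disjoint : ∀ a ∈ lefts, Disjoint (Ioo a (right a)) X
  cover : ∀ x ∈ box l, x ∉ X → ∃ a ∈ lefts, x ∈ Ioo a (right a)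

lemma nonempty_gaps {l : ℝ} (hl : 0 < l) {X : Set ℝ} (hX : (X ∩ box l).Finite) :
    Nonempty (Gaps l X) := by
  classical
  have hll : -l / 2 < l / 2 := by linarith
  set S : Finset ℝ := hX.toFinset with hS
  have hmem : ∀ x, x ∈ S ↔ x ∈ X ∩ box l := fun x => hX.mem_toFinset
  have hbox : ∀ x ∈ S, -l / 2 < x ∧ x < l / 2 := fun x hx => ((hmem x).1 hx).2
  -- The right endpoint of a gap is the successor of its left endpoint among the impurities and the
  -- wall `l / 2`.
  have hex : ∀ a, ∃ b, a < l / 2 → b ∈ insert (l / 2) S ∧ a < b ∧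
      ∀ y ∈ insert (l / 2) S, a < y → b ≤ y := by
    intro a
    by_cases ha : a < l / 2
    · obtain ⟨b, hb, hmin⟩ := ((insert (l / 2) S).filter (a < ·)).exists_min_image id
        ⟨l / 2, by simp [ha]⟩
      rw [Finset.mem_filter] at hb
      exact ⟨b, fun _ => ⟨hb.1, hb.2, fun y hy hay => hmin y (Finset.mem_filter.2 ⟨hy, hay⟩)⟩⟩
    · exact ⟨0, fun h => absurd h ha⟩
  choose r hr using hex
  have hlt : ∀ a ∈ insert (-l / 2) S, a < l / 2 := by
    intro a ha
    rcases Finset.mem_insert.1 ha with rfl | ha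
    · exact hll
    · exact (hbox a ha).2
  have hle : ∀ a ∈ insert (-l / 2) S, -l / 2 ≤ a := by
    intro a ha
    rcases Finset.mem_insert.1 ha with rfl | ha
    · exact le_rfl
    · exact (hbox a ha).1.le
  have hrle : ∀ a ∈ insert (-l / 2) S, r a ≤ l / 2 := fun a ha =>
    (hr a (hlt a ha)).2.2 _ (Finset.mem_insert_self _ _) (hlt a ha)
  refine ⟨⟨insert (-l / 2) S, r, fun a ha => (hr a (hlt a ha)).2.1, hle, hrle, ?_, ?_, ?_, ?_, ?_⟩⟩
  · intro a ha
    rcases Finset.mem_insert.1 ha with rfl | ha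
    · exact Or.inl rfl
    · exact Or.inr ((hmem a).1 ha)
  · intro a ha
    rcases Finset.mem_insert.1 (hr a (hlt a ha)).1 with h | h
    · exact Or.inl h
    · exact Or.inr ((hmem _).1 h)
  · intro a ha a' ha' haa
    rcases Finset.mem_insert.1 ha' with rfl | h
    · exact absurd (hle a ha) (not_le.2 haa)
    · exact (hr a (hlt a ha)).2.2 a' (Finset.mem_insert_of_mem h) haa
  · intro a ha
    rw [disjoint_left]
    intro x hx hxX
    have hxS : x ∈ S := (hmem x).2 ⟨hxX, (hle a ha).trans_lt hx.1, hx.2.trans_le (hrle a ha)⟩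
    exact absurd ((hr a (hlt a ha)).2.2 x (Finset.mem_insert_of_mem hxS) hx.1) (not_le.2 hx.2)
  · intro x hx hxX
    -- The gap containing `x` starts at the largest left endpoint below `x`. If it ended before `x`,
    -- its right endpoint would be a larger such left endpoint.
    obtain ⟨a, ha, hmax⟩ := ((insert (-l / 2) S).filter (· < x)).exists_max_image id
      ⟨-l / 2, by simp [hx.1]⟩
    rw [Finset.mem_filter] at ha
    refine ⟨a, ha.1, ha.2, ?_⟩
    by_contra h
    push Not at h
    have h1 := hr a (hlt a ha.1)
    rcases Finset.mem_insert.1 h1.1 with h2 | h2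
    · rw [h2] at h
      exact absurd hx.2 (not_lt.2 h)
    · have h3 : r a ≠ x := fun h' => hxX (h' ▸ ((hmem _).1 h2).1)
      exact absurd (hmax (r a) (Finset.mem_filter.2
        ⟨Finset.mem_insert_of_mem h2, lt_of_le_of_ne h h3⟩)) (not_le.2 h1.2.1)

lemma norm_piece_sineFun {l a b : ℝ} (ha : -l / 2 ≤ a) (hab : a < b) (hb : b ≤ l / 2) (m : ℕ) :
    ‖piece l a b (sineFun a b m)‖ = 1 := by
  have h : (inner ℂ (piece l a b (sineFun a b m)) (piece l a b (sineFun a b m)) : ℂ) = 1 := by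
    rw [inner_piece ha hab.le hb, intervalIntegral.integral_of_le hab.le,
      integral_Ioc_eq_integral_Ioo]
    have h1 : ∫ x in Ioo a b, (sineFun a b m x : ℂ) * piece l a b (sineFun a b m) x
        = ∫ x in Ioo a b, ((sineFun a b m x * sineFun a b m x : ℝ) : ℂ) := by
      refine integral_congr_ae ?_
      filter_upwards [ae_mono (Measure.restrict_mono (Ioo_subset_box ha hb) le_rfl)
        (coeFn_piece l a b (sineFun a b m)), ae_restrict_mem measurableSet_Ioo] with x hx hx'
      rw [hx, indicator_of_mem hx']
      push_cast
      rfl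
    rw [h1, ← integral_Ioc_eq_integral_Ioo, ← intervalIntegral.integral_of_le hab.le,
      intervalIntegral.integral_ofReal, integral_sineFun_sq hab]
    simp
  rw [inner_self_eq_norm_sq_to_K] at h
  have h2 : ((‖piece l a b (sineFun a b m)‖ ^ 2 : ℝ) : ℂ) = 1 := by simpa using h
  have h3 : ‖piece l a b (sineFun a b m)‖ ^ 2 = 1 := by exact_mod_cast h2
  nlinarith [norm_nonneg (piece l a b (sineFun a b m))]

namespace Gaps

variable {l : ℝ} {X : Set ℝ} (G : Gaps l X)

/-- The length of the gap with left endpoint `a`. -/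
def len (a : ℝ) : ℝ := G.right a - a

lemma len_pos {a : ℝ} (ha : a ∈ G.lefts) : 0 < G.len a := sub_pos.2 (G.lt_right a ha)

lemma disjoint_Ioo {a a' : ℝ} (ha : a ∈ G.lefts) (ha' : a' ∈ G.lefts) (h : a ≠ a') :
    Disjoint (Ioo a (G.right a)) (Ioo a' (G.right a')) := by
  rw [disjoint_left]
  intro x hx hx'
  rcases lt_or_gt_of_ne h with h | h
  · exact absurd (hx.2.trans_le (G.right_le_left a ha a' ha' h)) (not_lt.2 hx'.1.le)
  · exact absurd (hx'.2.trans_le (G.right_le_left a' ha' a ha h)) (not_lt.2 hx.1.le)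

/-- Index type of the eigenfunctions: a gap and a level in the gap. -/
abbrev Index : Type := {a // a ∈ G.lefts} × ℕ

/-- The energy levels of the Hamiltonian. -/
def energy (i : G.Index) : ℝ := gapEnergy i.2 (G.len i.1)

/-- The eigenfunctions of the Hamiltonian. -/
def vec (i : G.Index) : L2Box l := piece l i.1 (G.right i.1) (sineFun i.1 (G.right i.1) i.2)

lemma eigen_vec (i : G.Index) : HamiltonianApply l X (G.vec i) ((G.energy i : ℂ) • G.vec i) :=
  hamiltonianApply_piece (G.le_left _ i.1.2) (G.lt_right _ i.1.2).le (G.right_le _ i.1.2)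
    (G.left_eq _ i.1.2) (G.right_eq _ i.1.2) (G.disjoint _ i.1.2)
    (hasDerivAt_sineFun _ _ _) (hasDerivAt_sineFunDeriv _ _ _)
    (sineFun_left _ _ _) (sineFun_right _ _ _)

lemma inner_vec (i : G.Index) (u : L2Box l) : (inner ℂ (G.vec i) u : ℂ)
    = ∫ x in (i.1 : ℝ)..(G.right i.1), (sineFun i.1 (G.right i.1) i.2 x : ℂ) * u x :=
  inner_piece (G.le_left _ i.1.2) (G.lt_right _ i.1.2).le (G.right_le _ i.1.2) _ _

lemma Ioo_subset_box {a : ℝ} (ha : a ∈ G.lefts) : Ioo a (G.right a) ⊆ box l :=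
  LuttingerSy.Ioo_subset_box (G.le_left a ha) (G.right_le a ha)

lemma gapEnergy_injective {s : ℝ} (hs : 0 < s) : Function.Injective fun m => gapEnergy m s := by
  intro m m' h
  simp only [gapEnergy] at h
  have h1 : ((m : ℝ) + 1) ^ 2 = ((m' : ℝ) + 1) ^ 2 := by
    field_simp at h
    exact h
  have h2 : (m : ℝ) + 1 = m' + 1 := by
    rwa [sq_eq_sq₀ (by positivity) (by positivity)] at h1
  exact_mod_cast (add_right_cancel h2)

/-- Within one gap the energies are distinct, so orthogonality is that of eigenvectors; for
different gaps the supports are disjoint. -/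
lemma orthonormal_vec : Orthonormal ℂ G.vec := by
  refine ⟨fun i => ?_, fun i j hij => ?_⟩
  · exact norm_piece_sineFun (G.le_left _ i.1.2) (G.lt_right _ i.1.2) (G.right_le _ i.1.2) i.2
  · by_cases h : i.1 = j.1
    · refine (G.eigen_vec i).inner_eq_zero (G.eigen_vec j) fun hE => hij (Prod.ext h ?_)
      rw [energy, energy, h] at hE
      exact gapEnergy_injective (G.len_pos j.1.2) hE
    · change (inner ℂ (G.vec i) (G.vec j) : ℂ) = 0
      rw [inner_vec, intervalIntegral.integral_of_le (G.lt_right _ i.1.2).le,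
        integral_Ioc_eq_integral_Ioo]
      refine integral_eq_zero_of_ae ?_
      filter_upwards [ae_mono (Measure.restrict_mono (G.Ioo_subset_box i.1.2) le_rfl)
        (coeFn_piece l j.1 (G.right j.1) (sineFun j.1 (G.right j.1) j.2)),
        ae_restrict_mem measurableSet_Ioo] with x hx hx'
      rw [vec, hx, indicator_of_notMem, mul_zero]
      · rfl
      · exact disjoint_left.1 (G.disjoint_Ioo i.1.2 j.1.2 fun h' => h (Subtype.ext h')) hx'

lemma ae_mem_gap (hX : (X ∩ box l).Finite) :
    ∀ᵐ x ∂volume.restrict (box l), ∃ a ∈ G.lefts, x ∈ Ioo a (G.right a) := by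
  have h0 : volume (X ∩ box l) = 0 := hX.measure_zero _
  have h1 : ∀ᵐ x ∂(volume : Measure ℝ), x ∉ X ∩ box l := measure_eq_zero_iff_ae_notMem.1 h0
  have h2 : MeasurableSet (box l) := measurableSet_Ioo
  filter_upwards [ae_restrict_of_ae h1, ae_restrict_mem h2] with x hx hxl
  exact G.cover x hxl fun h => hx ⟨h, hxl⟩

lemma span_vec_orthogonal (hX : (X ∩ box l).Finite) :
    (Submodule.span ℂ (Set.range G.vec))ᗮ = ⊥ := by
  rw [Submodule.eq_bot_iff]
  intro u hu
  have hort : ∀ i, (inner ℂ (G.vec i) u : ℂ) = 0 := fun i =>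
    (Submodule.mem_orthogonal _ u).1 hu _ (Submodule.subset_span ⟨i, rfl⟩)
  have hzero : ∀ a ∈ G.lefts, ∀ᵐ x ∂(volume : Measure ℝ), x ∈ Ioo a (G.right a) → u x = 0 := by
    intro a ha
    have hmem : MemLp ((Ioo a (G.right a)).indicator u) 2 volume := by
      rw [memLp_indicator_iff_restrict measurableSet_Ioo]
      exact (Lp.memLp u).mono_measure (Measure.restrict_mono (G.Ioo_subset_box ha) le_rfl)
    have h := eq_zero_of_sine_coeff_eq_zero (G.lt_right a ha) hmem
      (fun x hx => indicator_of_notMem hx _) fun m => ?_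
    · filter_upwards [h] with x hx hxa
      rw [indicator_of_mem hxa] at hx
      exact hx
    · have h1 := hort (⟨a, ha⟩, m)
      rw [inner_vec, intervalIntegral.integral_of_le (G.lt_right _ ha).le,
        integral_Ioc_eq_integral_Ioo] at h1
      simp only [sineFun_apply] at h1
      have h2 : ∫ x in Ioo a (G.right a), ((√(2 / (G.right a - a)) *
          Real.sin ((m + 1) * Real.pi / (G.right a - a) * (x - a)) : ℝ) : ℂ) * u x
          = (√(2 / (G.right a - a)) : ℂ) * ∫ x in Ioo a (G.right a),
            (Real.sin ((m + 1) * Real.pi / (G.right a - a) * (x - a)) : ℂ) * u x := by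
        rw [← integral_const_mul]
        congr 1
        ext x
        push_cast
        ring
      rw [h2] at h1
      have h3 : (√(2 / (G.right a - a)) : ℂ) ≠ 0 := by
        have := G.len_pos ha
        unfold len at this
        have : 0 < √(2 / (G.right a - a)) := by positivity
        exact_mod_cast this.ne'
      have h4 := (mul_eq_zero.1 h1).resolve_left h3
      rw [← integral_indicator measurableSet_Ioo] at h4
      rw [← h4]
      congr 1
      ext x
      by_cases hx : x ∈ Ioo a (G.right a) <;> simp [hx]
  have hall : ∀ᵐ x ∂(volume : Measure ℝ), ∀ a ∈ G.lefts, x ∈ Ioo a (G.right a) → u x = 0 :=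
    (Finset.eventually_all G.lefts).2 hzero
  rw [Lp.eq_zero_iff_ae_eq_zero]
  filter_upwards [G.ae_mem_gap hX, ae_restrict_of_ae hall] with x ⟨a, ha, hxa⟩ hx
  exact hx a ha hxa

/-- The eigenbasis of the Hamiltonian consisting of the sine functions in the gaps. -/
def system (hX : (X ∩ box l).Finite) : EigenSystem l X G.Index where
  vec := HilbertBasis.mkOfOrthogonalEqBot G.orthonormal_vec (G.span_vec_orthogonal hX)
  energy := G.energy
  eigen i := by
    rw [HilbertBasis.coe_mkOfOrthogonalEqBot]
    exact G.eigen_vec i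

lemma system_vec (hX : (X ∩ box l).Finite) (i : G.Index) : (G.system hX).vec i = G.vec i := by
  simp [system]

end Gaps

/-! ### Ordering the eigenvalues -/

/-- Order the indices by energy and break ties by an injection into `ℕ`. Only finitely many indices
precede a given one, and their number is its rank. -/
lemma exists_monotone_enumeration {ι : Type*} [Countable ι] [Infinite ι] (E : ι → ℝ)
    (hE : ∀ e, {i | E i ≤ e}.Finite) : ∃ f : ℕ ≃ ι, Monotone (E ∘ f) := by
  classical
  obtain ⟨c, hc⟩ := exists_injective_nat ι
  set below : ι → Set ι := fun i => {j | E j < E i ∨ (E j = E i ∧ c j < c i)} with hbelow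
  have hfin : ∀ i, (below i).Finite := fun i => (hE (E i)).subset fun j hj => by
    rcases hj with h | h
    · exact h.le
    · exact h.1.le
  set r : ι → ℕ := fun i => (below i).ncard with hr
  have hlt : ∀ i j, j ∈ below i → r j < r i := by
    intro i j hj
    refine Set.ncard_lt_ncard ⟨fun k hk => ?_, fun h => ?_⟩ (hfin i)
    · rcases hj with h | h <;> rcases hk with h' | h'
      · exact Or.inl (h'.trans h)
      · exact Or.inl (h'.1.trans_lt h)
      · exact Or.inl (h'.trans_le h.1.le)
      · exact Or.inr ⟨h'.1.trans h.1, h'.2.trans h.2⟩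
    · have := h hj
      simp [hbelow] at this
  have htri : ∀ i j, i ≠ j → j ∈ below i ∨ i ∈ below j := by
    intro i j hij
    rcases lt_trichotomy (E i) (E j) with h | h | h
    · exact Or.inr (Or.inl h)
    · rcases lt_or_gt_of_ne (hc.ne hij) with h' | h'
      · exact Or.inr (Or.inr ⟨h, h'⟩)
      · exact Or.inl (Or.inr ⟨h.symm, h'⟩)
    · exact Or.inl (Or.inl h)
  have hinj : Function.Injective r := by
    intro i j hij
    by_contra h
    rcases htri i j h with h' | h'
    · exact absurd (hlt i j h') (by omega)
    · exact absurd (hlt j i h') (by omega)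
  have hmono : ∀ i j, r i ≤ r j → E i ≤ E j := by
    intro i j hij
    by_contra h
    push Not at h
    exact absurd (hlt i j (Or.inl h)) (by omega)
  -- Surjectivity of the rank is not needed: an infinite set of ranks can be listed in increasing
  -- order.
  have : Infinite (Set.range r) := (Set.infinite_range_of_injective hinj).to_subtype
  let o := Nat.Subtype.orderIsoOfNat (Set.range r)
  refine ⟨o.toEquiv.trans (Equiv.ofInjective r hinj).symm, fun m n hmn => hmono _ _ ?_⟩
  have h1 : ∀ k, r ((o.toEquiv.trans (Equiv.ofInjective r hinj).symm) k) = (o k : ℕ) := by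
    intro k
    have := Equiv.apply_ofInjective_symm hinj (o k)
    simpa using this
  rw [h1, h1]
  exact o.monotone hmn

/-- No sign of `e` is assumed: for `e < 0` the square root is `0` by convention and both sides are
false. -/
lemma gapEnergy_le_iff {m : ℕ} {s e : ℝ} (hs : 0 < s) :
    gapEnergy m s ≤ e ↔ Real.pi * (m + 1) ≤ √(2 * e) * s := by
  have h1 : gapEnergy m s = (Real.pi * (m + 1) / s) ^ 2 / 2 := by
    rw [gapEnergy]
    field_simp
  rw [h1, div_le_iff₀ two_pos, mul_comm e 2, ← div_le_iff₀ hs]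
  exact (Real.le_sqrt' (by positivity)).symm

namespace Gaps

variable {l : ℝ} {X : Set ℝ} (G : Gaps l X)

lemma lefts_nonempty (hl : 0 < l) (hX : (X ∩ box l).Finite) : G.lefts.Nonempty := by
  obtain ⟨x, hx, hxX⟩ : ∃ x ∈ box l, x ∉ X := by
    by_contra h
    push Not at h
    refine (Set.Ioo_infinite (show -l / 2 < l / 2 by linarith)) (hX.subset fun x hx => ⟨h x hx, hx⟩)
  obtain ⟨a, ha, -⟩ := G.cover x hx hxX
  exact ⟨a, ha⟩

lemma finite_energy_le (e : ℝ) : {i : G.Index | G.energy i ≤ e}.Finite := by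
  have h : ∀ a : {a // a ∈ G.lefts}, {m : ℕ | gapEnergy m (G.len a) ≤ e}.Finite := by
    intro a
    refine (Set.finite_Iic ⌊√(2 * e) * G.len a⌋₊).subset fun m hm => Nat.le_floor ?_
    have h1 := (gapEnergy_le_iff (G.len_pos a.2)).1 hm
    nlinarith [Real.pi_gt_three, (Nat.cast_nonneg m : (0 : ℝ) ≤ m)]
  refine (Set.finite_iUnion fun a => (h a).image (Prod.mk a)).subset ?_
  rintro ⟨a, m⟩ hi
  exact mem_iUnion.2 ⟨a, m, hi, rfl⟩

/-- The eigenvalues of the Hamiltonian listed in increasing order. -/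
lemma nonempty_eigenbasis (G : Gaps l X) (hl : 0 < l) (hX : (X ∩ box l).Finite) :
    Nonempty (Eigenbasis l X) := by
  have : Nonempty {a // a ∈ G.lefts} := (G.lefts_nonempty hl hX).to_subtype
  obtain ⟨f, hf⟩ := exists_monotone_enumeration G.energy G.finite_energy_le
  refine ⟨⟨HilbertBasis.mkOfOrthogonalEqBot (G.orthonormal_vec.comp f f.injective) ?_,
    G.energy ∘ f, hf, fun i => ?_⟩⟩
  · rw [f.surjective.range_comp, G.span_vec_orthogonal hX]
  · rw [HilbertBasis.coe_mkOfOrthogonalEqBot]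
    exact G.eigen_vec (f i)

end Gaps

end

end LuttingerSy

namespace LuttingerSy

noncomputable section

/-! ### The chemical potential -/

lemma bose_pos {β μ E : ℝ} (hβ : 0 < β) (h : μ < E) : 0 < bose β μ E :=
  one_div_pos.2 (sub_pos.2 (Real.one_lt_exp_iff.2 (mul_pos hβ (sub_pos.2 h))))

/-- Lowering the chemical potential by `t` contracts every occupation number by at least `exp (-β
t)`. For the total particle number this gives both strict monotonicity and arbitrarily small values.
-/
lemma bose_sub_le {β μ E t : ℝ} (hβ : 0 < β) (h : μ < E) (ht : 0 ≤ t) :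
    bose β (μ - t) E ≤ Real.exp (-(β * t)) * bose β μ E := by
  have h1 : 0 < Real.exp (β * (E - μ)) - 1 :=
    sub_pos.2 (Real.one_lt_exp_iff.2 (mul_pos hβ (sub_pos.2 h)))
  have h2 : Real.exp (β * (E - (μ - t))) = Real.exp (β * t) * Real.exp (β * (E - μ)) := by
    rw [← Real.exp_add]
    congr 1
    ring
  have h3 : 1 ≤ Real.exp (β * t) := Real.one_le_exp (by positivity)
  rw [bose, bose, h2, Real.exp_neg, ← one_div, one_div_mul_one_div]
  refine one_div_le_one_div_of_le (by positivity) ?_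
  nlinarith

lemma bose_mono {β μ μ' E : ℝ} (hβ : 0 < β) (hμ : μ ≤ μ') (h : μ' < E) :
    bose β μ E ≤ bose β μ' E := by
  have h1 : 0 < Real.exp (β * (E - μ')) - 1 :=
    sub_pos.2 (Real.one_lt_exp_iff.2 (mul_pos hβ (sub_pos.2 h)))
  refine one_div_le_one_div_of_le h1 ?_
  gcongr

lemma bose_anti {β μ E E' : ℝ} (hβ : 0 < β) (h : μ < E) (hE : E ≤ E') :
    bose β μ E' ≤ bose β μ E := by
  have h1 : 0 < Real.exp (β * (E - μ)) - 1 :=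
    sub_pos.2 (Real.one_lt_exp_iff.2 (mul_pos hβ (sub_pos.2 h)))
  refine one_div_le_one_div_of_le h1 ?_
  gcongr

/-- Away from the pole the Bose weight is comparable to the Boltzmann weight, so a finite heat trace
bounds the particle number. -/
lemma bose_le_exp {β μ E₀ E : ℝ} (hβ : 0 < β) (h : μ < E₀) (hE : E₀ ≤ E) :
    bose β μ E ≤ Real.exp (β * μ) / (1 - Real.exp (-(β * (E₀ - μ)))) * Real.exp (-β * E) := by
  have h0 : Real.exp (-(β * (E₀ - μ))) < 1 :=
    Real.exp_lt_one_iff.2 (neg_neg_of_pos (mul_pos hβ (sub_pos.2 h)))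
  have h1 : Real.exp (-(β * (E - μ))) ≤ Real.exp (-(β * (E₀ - μ))) := by gcongr
  have h2 : bose β μ E = Real.exp (-(β * (E - μ))) / (1 - Real.exp (-(β * (E - μ)))) := by
    rw [bose, Real.exp_neg]
    have : 1 < Real.exp (β * (E - μ)) :=
      Real.one_lt_exp_iff.2 (mul_pos hβ (by linarith))
    have h4 : Real.exp (β * (E - μ)) - 1 ≠ 0 := by linarith
    field_simp
  have h3 : Real.exp (-(β * (E - μ))) = Real.exp (β * μ) * Real.exp (-β * E) := by
    rw [← Real.exp_add]
    congr 1
    ring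
  rw [h2, div_mul_eq_mul_div, ← h3]
  exact div_le_div_of_nonneg_left (Real.exp_pos _).le (by linarith) (by linarith)

variable {l : ℝ} {X : Set ℝ}

lemma Gaps.tsum_index (G : Gaps l X) (f : ℝ → ℕ → ℝ≥0∞) :
    ∑' i : G.Index, f i.1 i.2 = ∑ a ∈ G.lefts, ∑' m, f a m := by
  rw [ENNReal.tsum_prod (f := fun (a : {a // a ∈ G.lefts}) m => f a m), tsum_fintype,
    Finset.sum_coe_sort G.lefts fun a => ∑' m, f a m]

/-- The box has finitely many gaps, and in each the energies grow quadratically in `m`, so a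
geometric series dominates. -/
lemma summable_exp_energy (hl : 0 < l) (hX : (X ∩ box l).Finite) (φ : Eigenbasis l X) {β : ℝ}
    (hβ : 0 < β) : Summable fun i => Real.exp (-β * φ.energy i) := by
  obtain ⟨G⟩ := nonempty_gaps hl hX
  have h1 := φ.toSystem.tsum_energy_eq (G.system hX) fun e => ENNReal.ofReal (Real.exp (-β * e))
  have h2 : ∑' i : G.Index, ENNReal.ofReal (Real.exp (-β * G.energy i)) ≠ ⊤ := by
    refine ne_of_eq_of_ne
      (G.tsum_index fun a m => ENNReal.ofReal (Real.exp (-β * gapEnergy m (G.len a)))) ?_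
    refine ENNReal.sum_ne_top.2 fun a ha => ?_
    have hL := G.len_pos ha
    set c := β * (Real.pi ^ 2 / (2 * G.len a ^ 2)) with hc
    have hc0 : 0 < c := by positivity
    have hs : Summable fun m : ℕ => Real.exp (-c) ^ m :=
      summable_geometric_of_lt_one (Real.exp_pos _).le (Real.exp_lt_one_iff.2 (by linarith))
    refine ne_top_of_le_ne_top hs.tsum_ofReal_ne_top (ENNReal.tsum_le_tsum fun m => ?_)
    refine ENNReal.ofReal_le_ofReal ?_
    rw [← Real.exp_nat_mul, Real.exp_le_exp]
    have h3 : β * gapEnergy m (G.len a) = c * (m + 1) ^ 2 := by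
      simp only [gapEnergy, hc]
      field_simp
    have : (m : ℝ) ≤ (m + 1) ^ 2 := by nlinarith [(Nat.cast_nonneg m : (0 : ℝ) ≤ m)]
    nlinarith
  have h3 : ∑' i, ENNReal.ofReal (Real.exp (-β * φ.energy i)) ≠ ⊤ := by
    exact ne_of_eq_of_ne h1 h2
  refine (ENNReal.summable_toReal h3).congr fun i => ?_
  rw [ENNReal.toReal_ofReal (Real.exp_pos _).le]

lemma summable_bose (hl : 0 < l) (hX : (X ∩ box l).Finite) (φ : Eigenbasis l X) {β μ : ℝ}
    (hβ : 0 < β) (hμ : μ < φ.energy 0) : Summable fun i => bose β μ (φ.energy i) :=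
  Summable.of_nonneg_of_le
    (fun i => (bose_pos hβ (hμ.trans_le (φ.energy_mono (Nat.zero_le i)))).le)
    (fun i => bose_le_exp hβ hμ (φ.energy_mono (Nat.zero_le i)))
    ((summable_exp_energy hl hX φ hβ).mul_left _)

lemma tsum_boltzmann_pow {β μ E : ℝ} (h : 0 < β * (E - μ)) :
    ∑' k : ℕ, ENNReal.ofReal (Real.exp (-β * (E - μ))) ^ k
      = ENNReal.ofReal (1 + bose β μ E) := by
  have hb : 0 ≤ bose β μ E :=
    (one_div_pos.2 (sub_pos.2 (Real.one_lt_exp_iff.2 h))).le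
  rw [tsum_eq_zero_add' ENNReal.summable, tsum_boltzmann_pow_succ h, pow_zero,
    ENNReal.ofReal_add zero_le_one hb, ENNReal.ofReal_one]

/-- Finite products of the factors `1 + bose` are bounded by the exponential of the total particle
number. -/
lemma fockTrace_gibbsOp_ne_top (hl : 0 < l) (hX : (X ∩ box l).Finite) (φ : Eigenbasis l X)
    {β μ : ℝ} (hβ : 0 < β) (hμ : μ < φ.energy 0) : fockTrace (gibbsOp φ β μ) ≠ ⊤ := by
  have hlt : ∀ i, μ < φ.energy i := fun i => hμ.trans_le (φ.energy_mono (Nat.zero_le i))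
  have hpos : ∀ i, 0 < bose β μ (φ.energy i) := fun i => bose_pos hβ (hlt i)
  rw [fockTrace_gibbsOp]
  refine configWeight_ne_top_of_bound
    (B := ENNReal.ofReal (Real.exp (∑' i, bose β μ (φ.energy i)))) ENNReal.ofReal_ne_top fun N => ?_
  calc ∏ i ∈ Finset.range N, ∑' k : ℕ, boltzmann φ β μ i ^ k
      = ∏ i ∈ Finset.range N, ENNReal.ofReal (1 + bose β μ (φ.energy i)) :=
        Finset.prod_congr rfl fun i _ => tsum_boltzmann_pow (mul_pos hβ (sub_pos.2 (hlt i)))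
    _ = ENNReal.ofReal (∏ i ∈ Finset.range N, (1 + bose β μ (φ.energy i))) :=
        (ENNReal.ofReal_prod_of_nonneg fun i _ => by linarith [hpos i]).symm
    _ ≤ _ := by
        refine ENNReal.ofReal_le_ofReal ?_
        calc ∏ i ∈ Finset.range N, (1 + bose β μ (φ.energy i))
            ≤ ∏ i ∈ Finset.range N, Real.exp (bose β μ (φ.energy i)) := by
              refine Finset.prod_le_prod (fun i _ => by linarith [hpos i]) fun i _ => ?_
              linarith [Real.add_one_le_exp (bose β μ (φ.energy i))]
          _ = Real.exp (∑ i ∈ Finset.range N, bose β μ (φ.energy i)) := (Real.exp_sum _ _).symm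
          _ ≤ _ := Real.exp_le_exp.2
              ((summable_bose hl hX φ hβ hμ).sum_le_tsum _ fun i _ => (hpos i).le)

lemma isChemicalPotential_iff (hl : 0 < l) (hX : (X ∩ box l).Finite) (φ : Eigenbasis l X)
    {β ρ μ : ℝ} (hβ : 0 < β) (hρ : 0 < ρ) :
    IsChemicalPotential φ β ρ μ ↔ μ < φ.energy 0 ∧ ∑' i, bose β μ (φ.energy i) = ρ * l := by
  have key : μ < φ.energy 0 → ((∑' i, meanNumber φ β μ (φ.vec i)) / ENNReal.ofReal l
      = ENNReal.ofReal ρ ↔ ∑' i, bose β μ (φ.energy i) = ρ * l) := by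
    intro hμ
    have hpos : ∀ i, 0 ≤ bose β μ (φ.energy i) := fun i =>
      (bose_pos hβ (hμ.trans_le (φ.energy_mono (Nat.zero_le i)))).le
    simp_rw [meanNumber_vec φ hβ (fockTrace_gibbsOp_ne_top hl hX φ hβ hμ)]
    rw [← ENNReal.ofReal_tsum_of_nonneg hpos (summable_bose hl hX φ hβ hμ),
      ← ENNReal.ofReal_div_of_pos hl, ENNReal.ofReal_eq_ofReal_iff
      (div_nonneg (tsum_nonneg hpos) hl.le) hρ.le, div_eq_iff hl.ne']
  constructor
  · rintro ⟨h1, h2⟩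
    have hμ := lt_energy_of_fockTrace_ne_top φ hβ h1 0
    exact ⟨hμ, (key hμ).1 h2⟩
  · rintro ⟨hμ, h⟩
    exact ⟨fockTrace_gibbsOp_ne_top hl hX φ hβ hμ, (key hμ).2 h⟩

lemma existsUnique_chemicalPotential (hl : 0 < l) (hX : (X ∩ box l).Finite) (φ : Eigenbasis l X)
    {β ρ : ℝ} (hβ : 0 < β) (hρ : 0 < ρ) : ∃! μ : ℝ, IsChemicalPotential φ β ρ μ := by
  set N : ℝ → ℝ := fun μ => ∑' i, bose β μ (φ.energy i) with hN
  have hr : 0 < ρ * l := mul_pos hρ hl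
  have hlt : ∀ {μ}, μ < φ.energy 0 → ∀ i, μ < φ.energy i :=
    fun hμ i => hμ.trans_le (φ.energy_mono (Nat.zero_le i))
  have hsub : ∀ {μ t}, μ < φ.energy 0 → 0 ≤ t → N (μ - t) ≤ Real.exp (-(β * t)) * N μ := by
    intro μ t hμ ht
    rw [hN]
    simp only
    rw [← tsum_mul_left]
    exact (summable_bose hl hX φ hβ (by linarith)).tsum_le_tsum
      (fun i => bose_sub_le hβ (hlt hμ i) ht) ((summable_bose hl hX φ hβ hμ).mul_left _)
  -- At this `μ₁` the lowest level alone holds exactly `ρ * l` particles.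
  obtain ⟨μ₁, h1, h1'⟩ : ∃ μ₁, μ₁ < φ.energy 0 ∧ ρ * l ≤ N μ₁ := by
    have hlog : 0 < Real.log (1 + 1 / (ρ * l)) := Real.log_pos (by
      have : 0 < 1 / (ρ * l) := by positivity
      linarith)
    refine ⟨φ.energy 0 - Real.log (1 + 1 / (ρ * l)) / β, by
      have : 0 < Real.log (1 + 1 / (ρ * l)) / β := by positivity
      linarith, ?_⟩
    set μ₁ := φ.energy 0 - Real.log (1 + 1 / (ρ * l)) / β with hμ₁
    have hμ : μ₁ < φ.energy 0 := by
      have : 0 < Real.log (1 + 1 / (ρ * l)) / β := by positivity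
      linarith
    have h2 : bose β μ₁ (φ.energy 0) = ρ * l := by
      have : β * (φ.energy 0 - μ₁) = Real.log (1 + 1 / (ρ * l)) := by
        rw [hμ₁]
        field_simp
        ring
      rw [bose, this, Real.exp_log (by positivity)]
      field_simp
      simp
    rw [← h2]
    exact (summable_bose hl hX φ hβ hμ).le_tsum 0 fun i _ => (bose_pos hβ (hlt hμ i)).le
  -- The shift is chosen so that the contraction factor `exp (-β t)` equals `ρ * l / N μ₁`.
  obtain ⟨t, ht, ht'⟩ : ∃ t, 0 ≤ t ∧ N (μ₁ - t) ≤ ρ * l := by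
    refine ⟨Real.log (N μ₁ / (ρ * l)) / β, div_nonneg (Real.log_nonneg ?_) hβ.le, ?_⟩
    · rwa [one_le_div hr]
    · have h0 : 0 < N μ₁ := hr.trans_le h1'
      refine (hsub h1 (div_nonneg (Real.log_nonneg ?_) hβ.le)).trans (le_of_eq ?_)
      · rwa [one_le_div hr]
      · rw [mul_div_cancel₀ _ hβ.ne', Real.exp_neg, Real.exp_log (by positivity)]
        field_simp
  have hcont : ContinuousOn N (Icc (μ₁ - t) μ₁) := by
    refine continuousOn_tsum (u := fun i => bose β μ₁ (φ.energy i)) (fun i => ?_)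
      (summable_bose hl hX φ hβ h1) fun i μ hμ => ?_
    · refine ContinuousOn.div continuousOn_const (by fun_prop) fun μ hμ => ?_
      have : μ < φ.energy i := hμ.2.trans_lt (hlt h1 i)
      exact (sub_pos.2 (Real.one_lt_exp_iff.2 (mul_pos hβ (sub_pos.2 this)))).ne'
    · rw [Real.norm_of_nonneg (bose_pos hβ (hμ.2.trans_lt (hlt h1 i))).le]
      exact bose_mono hβ hμ.2 (hlt h1 i)
  obtain ⟨μ, hμ, hμN⟩ := intermediate_value_Icc (by linarith) hcont ⟨ht', h1'⟩
  have huniq : ∀ {a b}, a < b → b < φ.energy 0 → N b = ρ * l → N a ≠ ρ * l := by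
    intro a b hab hb hNb hNa
    have h := hsub hb (sub_nonneg.2 hab.le)
    rw [sub_sub_cancel, hNa, hNb] at h
    have : Real.exp (-(β * (b - a))) < 1 :=
      Real.exp_lt_one_iff.2 (neg_neg_of_pos (mul_pos hβ (sub_pos.2 hab)))
    nlinarith
  refine ⟨μ, (isChemicalPotential_iff hl hX φ hβ hρ).2 ⟨hμ.2.trans_lt h1, hμN⟩, fun μ' h' => ?_⟩
  obtain ⟨h2, h3⟩ := (isChemicalPotential_iff hl hX φ hβ hρ).1 h'
  rcases lt_trichotomy μ' μ with h | h | h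
  · exact absurd h3 (huniq h (hμ.2.trans_lt h1) hμN)
  · exact h
  · exact absurd hμN (huniq h h2 h3)

end

end LuttingerSy

namespace LuttingerSy

noncomputable section

/-! ### Law of large numbers for empty cells -/

/-- The indicator of the event that `B` contains no impurity. -/
def emptyInd (X B : Set ℝ) : ℝ := ({0} : Set ℕ).indicator 1 (X ∩ B).ncard

lemma emptyInd_nonneg (X B : Set ℝ) : 0 ≤ emptyInd X B :=
  indicator_nonneg (fun _ _ => zero_le_one) _

lemma emptyInd_eq_one {X B : Set ℝ} (h : Disjoint B X) : emptyInd X B = 1 := by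
  have : X ∩ B = ∅ := by rw [inter_comm]; exact h.inter_eq
  simp [emptyInd, this]

/-- Finiteness is essential: `ncard` of an infinite set is `0`, so such a set would count as empty.
-/
lemma emptyInd_eq_zero {X B : Set ℝ} (hf : (X ∩ B).Finite) (h : ¬Disjoint B X) :
    emptyInd X B = 0 := by
  refine indicator_of_notMem (fun h0 => h ?_) _
  rw [mem_singleton_iff, Set.ncard_eq_zero hf] at h0
  rwa [disjoint_iff_inter_eq_empty, inter_comm]

variable {Ω : Type*} [MeasurableSpace Ω] {P : Measure Ω} [IsProbabilityMeasure P] {lam : ℝ≥0}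
  {X : Ω → Set ℝ}

/-- The indicators are identically distributed with mean the Poisson void probability. The strong
law in this form requires only pairwise independence. -/
lemma IsPoissonProcess.ae_tendsto_emptyInd (hX : IsPoissonProcess P lam X) {B : ℕ → Set ℝ}
    (hm : ∀ j, MeasurableSet (B j)) (hb : ∀ j, Bornology.IsBounded (B j))
    (hd : Pairwise (Function.onFun Disjoint B)) {s : ℝ} (hs : 0 ≤ s)
    (hv : ∀ j, volume (B j) = ENNReal.ofReal s) :
    ∀ᵐ ω ∂P, Tendsto (fun n : ℕ => (∑ j ∈ Finset.range n, emptyInd (X ω) (B j)) / n) atTop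
      (𝓝 (Real.exp (-(lam * s)))) := by
  have hf : Measurable (({0} : Set ℕ).indicator (1 : ℕ → ℝ)) := measurable_from_nat
  have hc : ∀ j, Measurable fun ω => (X ω ∩ B j).ncard := fun j =>
    hX.measurable_count _ (hm j) (hb j)
  have hlaw : ∀ j, P.map (fun ω => (X ω ∩ B j).ncard) = poissonMeasure (lam * s.toNNReal) := by
    intro j
    rw [hX.law_count _ (hm j) (hb j), hv j, ENNReal.ofReal, ENNReal.toNNReal_coe]
  have hexp : ∫ ω, emptyInd (X ω) (B 0) ∂P = Real.exp (-(lam * s)) := by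
    have h1 : ∫ ω, emptyInd (X ω) (B 0) ∂P
        = ∫ n, ({0} : Set ℕ).indicator (1 : ℕ → ℝ) n ∂(P.map fun ω => (X ω ∩ B 0).ncard) :=
      (integral_map (hc 0).aemeasurable hf.aestronglyMeasurable).symm
    rw [h1, hlaw, integral_indicator_one (measurableSet_singleton 0), poissonMeasure_real_singleton]
    simp [hs]
  rw [← hexp]
  refine strong_law_ae_real (fun j ω => emptyInd (X ω) (B j)) ?_ ?_ ?_
  · refine Integrable.of_bound (hf.comp (hc 0)).aestronglyMeasurable 1
      (Eventually.of_forall fun ω => ?_)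
    rw [emptyInd]
    by_cases h : (X ω ∩ B 0).ncard ∈ ({0} : Set ℕ)
    · simp [indicator_of_mem h]
    · simp [indicator_of_notMem h]
  · intro i j hij
    -- Two cells at a time are enough, so independence for finite families covers the infinite
    -- sequence.
    have h2 := hX.indep_count 2 ![B i, B j] (by simp [Fin.forall_fin_two, hm])
      (by simp [Fin.forall_fin_two, hb]) (by
        intro a b hab
        fin_cases a <;> fin_cases b
        · exact absurd rfl hab
        · exact hd hij
        · exact hd hij.symm
        · exact absurd rfl hab)
    have h3 := h2.indepFun (show (0 : Fin 2) ≠ 1 by decide)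
    exact h3.comp hf hf
  · intro i
    have h2 : IdentDistrib (fun ω => (X ω ∩ B i).ncard) (fun ω => (X ω ∩ B 0).ncard) P P :=
      ⟨(hc i).aemeasurable, (hc 0).aemeasurable, by rw [hlaw, hlaw]⟩
    exact h2.comp hf

/-- The cell `[k s / r, k s / r + s)`. -/
def cell (s : ℝ) (r : ℕ) (k : ℤ) : Set ℝ := Ico (k * (s / r)) (k * (s / r) + s)

/-- Number of empty cells among the cells with index in `[-n r, n r)`. -/
def emptyCells (X : Set ℝ) (s : ℝ) (r n : ℕ) : ℝ :=
  ∑ k ∈ Finset.Ico (-(n * r : ℤ)) (n * r), emptyInd X (cell s r k)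

/-- The cells have length `s` but spacing `s / r`, so neighbours overlap; cells whose indices differ
by at least `r` are disjoint. Splitting by residue modulo `r`, and into the two half-lines, yields
`2 r` sequences of pairwise disjoint cells. -/
lemma sum_Ico_eq_sum_classes (e : ℤ → ℝ) (r n : ℕ) :
    ∑ k ∈ Finset.Ico (-(n * r : ℤ)) (n * r), e k = ∑ i ∈ Finset.range r,
      ((∑ j ∈ Finset.range n, e (i + j * r)) + ∑ j ∈ Finset.range n, e (i - (j + 1) * r)) := by
  have hblock : ∀ c : ℤ, ∑ k ∈ Finset.Ico c (c + r), e k = ∑ i ∈ Finset.range r, e (i + c) := by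
    intro c
    symm
    refine Finset.sum_bij (fun i _ => (i : ℤ) + c) ?_ ?_ ?_ fun _ _ => rfl
    · intro i hi
      rw [Finset.mem_range] at hi
      rw [Finset.mem_Ico]
      omega
    · intro i _ j _ h
      simpa using h
    · intro k hk
      rw [Finset.mem_Ico] at hk
      exact ⟨(k - c).toNat, Finset.mem_range.2 (by omega), by omega⟩
  induction n with
  | zero => simp
  | succ n ih =>
    have h1 : Finset.Ico (-((n + 1 : ℕ) * r : ℤ)) ((n + 1 : ℕ) * r)
        = (Finset.Ico (-((n + 1 : ℕ) * r : ℤ)) (-((n + 1 : ℕ) * r : ℤ) + r) ∪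
          Finset.Ico (-(n * r : ℤ)) (n * r)) ∪ Finset.Ico (n * r : ℤ) (n * r + r) := by
      have h2 : (-((n + 1 : ℕ) * r : ℤ) + r) = -(n * r : ℤ) := by push_cast; ring
      have h3 : ((n + 1 : ℕ) * r : ℤ) = n * r + r := by push_cast; ring
      have h4 : (0 : ℤ) ≤ n * r := by positivity
      rw [h2, h3, Finset.Ico_union_Ico_eq_Ico (by omega) (by omega),
        Finset.Ico_union_Ico_eq_Ico (by omega) (by omega)]
    have h4 : (0 : ℤ) ≤ n * r := by positivity
    have h3 : ((n + 1 : ℕ) * r : ℤ) = n * r + r := by push_cast; ring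
    rw [h1, Finset.sum_union, Finset.sum_union, ih, hblock, hblock, ← Finset.sum_add_distrib,
      ← Finset.sum_add_distrib]
    · refine Finset.sum_congr rfl fun i _ => ?_
      rw [Finset.sum_range_succ, Finset.sum_range_succ]
      have e1 : (i : ℤ) + -((n + 1 : ℕ) * r : ℤ) = i - (n + 1) * r := by push_cast; ring
      rw [e1]
      ring
    · rw [Finset.disjoint_left]
      intro k hk hk'
      rw [Finset.mem_Ico] at hk hk'
      omega
    · rw [Finset.disjoint_left]
      intro k hk hk'
      rw [Finset.mem_union, Finset.mem_Ico, Finset.mem_Ico] at hk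
      rw [Finset.mem_Ico] at hk'
      omega

lemma IsPoissonProcess.ae_tendsto_emptyCells (hX : IsPoissonProcess P lam X) {s : ℝ} (hs : 0 < s)
    {r : ℕ} (hr : 0 < r) :
    ∀ᵐ ω ∂P, Tendsto (fun n : ℕ => emptyCells (X ω) s r n / n) atTop
      (𝓝 (2 * r * Real.exp (-(lam * s)))) := by
  have hr' : (0 : ℝ) < r := by exact_mod_cast hr
  have hmeas : ∀ k, MeasurableSet (cell s r k) := fun k => measurableSet_Ico
  have hbdd : ∀ k, Bornology.IsBounded (cell s r k) := fun k => Metric.isBounded_Ico _ _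
  have hvol : ∀ k, volume (cell s r k) = ENNReal.ofReal s := fun k => by
    rw [cell, Real.volume_Ico, add_sub_cancel_left]
  have hdisj : ∀ k k' : ℤ, k + r ≤ k' → Disjoint (cell s r k) (cell s r k') := by
    intro k k' h
    rw [disjoint_left]
    intro x hx hx'
    have h1 : (k : ℝ) + r ≤ k' := by exact_mod_cast h
    have h2 : (k : ℝ) * (s / r) + s ≤ k' * (s / r) := by
      have : ((k : ℝ) + r) * (s / r) ≤ k' * (s / r) :=
        mul_le_mul_of_nonneg_right h1 (by positivity)
      have h3 : ((k : ℝ) + r) * (s / r) = k * (s / r) + s := by field_simp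
      linarith
    exact absurd hx.2 (not_lt.2 (h2.trans hx'.1))
  have hmulr : ∀ i j : ℕ, i < j → (i : ℤ) * r + r ≤ j * r := by
    intro i j hij
    have : ((i : ℤ) + 1) ≤ j := by exact_mod_cast hij
    nlinarith
  have h1 : ∀ i : ℕ, ∀ᵐ ω ∂P, Tendsto (fun n : ℕ =>
      (∑ j ∈ Finset.range n, emptyInd (X ω) (cell s r (i + j * r))) / n) atTop
      (𝓝 (Real.exp (-(lam * s)))) := fun i => by
    refine hX.ae_tendsto_emptyInd (fun j => hmeas _) (fun j => hbdd _) ?_ hs.le fun j => hvol _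
    intro j j' hj
    rcases lt_or_gt_of_ne hj with h | h
    · exact hdisj _ _ (by have := hmulr _ _ h; omega)
    · exact (hdisj _ _ (by have := hmulr _ _ h; omega)).symm
  have h2 : ∀ i : ℕ, ∀ᵐ ω ∂P, Tendsto (fun n : ℕ =>
      (∑ j ∈ Finset.range n, emptyInd (X ω) (cell s r (i - (j + 1) * r))) / n) atTop
      (𝓝 (Real.exp (-(lam * s)))) := fun i => by
    refine hX.ae_tendsto_emptyInd (fun j => hmeas _) (fun j => hbdd _) ?_ hs.le fun j => hvol _
    intro j j' hj
    rcases lt_or_gt_of_ne hj with h | h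
    · exact (hdisj _ _ (by have := hmulr _ _ h; linarith)).symm
    · exact hdisj _ _ (by have := hmulr _ _ h; linarith)
  filter_upwards [ae_all_iff.2 h1, ae_all_iff.2 h2] with ω hω1 hω2
  have h3 : Tendsto (fun n : ℕ => ∑ i ∈ Finset.range r,
      ((∑ j ∈ Finset.range n, emptyInd (X ω) (cell s r (i + j * r))) / n +
        (∑ j ∈ Finset.range n, emptyInd (X ω) (cell s r (i - (j + 1) * r))) / (n : ℝ))) atTop
      (𝓝 (∑ i ∈ Finset.range r, (Real.exp (-(lam * s)) + Real.exp (-(lam * s))))) :=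
    tendsto_finsetSum _ fun i _ => (hω1 i).add (hω2 i)
  convert! h3 using 2
  · rw [emptyCells, sum_Ico_eq_sum_classes, Finset.sum_div]
    exact Finset.sum_congr rfl fun i _ => add_div _ _ _
  · rw [Finset.sum_const, Finset.card_range, nsmul_eq_mul]
    ring

end

end LuttingerSy

/-! ### Gap lengths and the number of empty cells -/

namespace LuttingerSy

noncomputable section

namespace Gaps

variable {l : ℝ} {X : Set ℝ} (G : Gaps l X)

/-- The sum of `F` over the lengths of the gaps. -/
def sum (F : ℝ → ℝ) : ℝ := ∑ a ∈ G.lefts, F (G.len a)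

/-- Disjoint intervals contained in `[u, v]` have total length at most `v - u`. -/
lemma sum_of_mem_Ioo {c : ℝ → ℝ} (hc : ∀ a ∈ G.lefts, 0 ≤ c a ∧ c a ≤ G.len a) {s : Finset ℝ}
    (hs : s ⊆ G.lefts) {u v : ℝ} (huv : u ≤ v) (h : ∀ a ∈ s, u ≤ a ∧ a + c a ≤ v) :
    ∑ a ∈ s, c a ≤ v - u := by
  have h1 : volume (⋃ a ∈ s, Ioo a (a + c a)) = ∑ a ∈ s, volume (Ioo a (a + c a)) := by
    refine measure_biUnion_finset (fun a ha a' ha' haa => ?_) fun a _ => measurableSet_Ioo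
    have hsub : ∀ a ∈ s, Ioo a (a + c a) ⊆ Ioo a (G.right a) := fun a ha =>
      Ioo_subset_Ioo_right (by have := (hc a (hs ha)).2; unfold len at this; linarith)
    exact (G.disjoint_Ioo (hs ha) (hs ha') haa).mono (hsub a ha) (hsub a' ha')
  have h2 : volume (⋃ a ∈ s, Ioo a (a + c a)) ≤ volume (Icc u v) :=
    measure_mono (iUnion₂_subset fun a ha => Ioo_subset_Icc_self.trans
      (Icc_subset_Icc (h a ha).1 (h a ha).2))
  rw [h1, Real.volume_Icc] at h2
  simp_rw [Real.volume_Ioo, add_sub_cancel_left] at h2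
  rwa [← ENNReal.ofReal_sum_of_nonneg fun a ha => (hc a (hs ha)).1,
    ENNReal.ofReal_le_ofReal_iff (by linarith)] at h2

lemma sum_len (hl : 0 < l) (hX : (X ∩ box l).Finite) : G.sum (fun s => s) = l := by
  have h1 : volume (⋃ a ∈ G.lefts, Ioo a (G.right a))
      = ∑ a ∈ G.lefts, volume (Ioo a (G.right a)) :=
    measure_biUnion_finset (fun a ha a' ha' haa => G.disjoint_Ioo ha ha' haa)
      fun a _ => measurableSet_Ioo
  have h2 : volume (⋃ a ∈ G.lefts, Ioo a (G.right a)) = volume (box l) := by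
    refine le_antisymm (measure_mono (iUnion₂_subset fun a ha => G.Ioo_subset_box ha)) ?_
    refine measure_mono_ae ?_
    have h3 := G.ae_mem_gap hX
    rw [ae_restrict_iff' (show MeasurableSet (box l) from measurableSet_Ioo)] at h3
    filter_upwards [h3] with x hx hxl
    obtain ⟨a, ha, hxa⟩ := hx hxl
    exact mem_iUnion₂.2 ⟨a, ha, hxa⟩
  rw [h1, box, Real.volume_Ioo] at h2
  simp_rw [Real.volume_Ioo] at h2
  have h4 : ∀ a ∈ G.lefts, 0 ≤ G.right a - a := fun a ha => (G.len_pos ha).le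
  rw [← ENNReal.ofReal_sum_of_nonneg h4,
    ENNReal.ofReal_eq_ofReal_iff (Finset.sum_nonneg h4) (by linarith)] at h2
  unfold sum len
  linarith

lemma card_lt_len_le (hl : 0 < l) (hX : (X ∩ box l).Finite) {s : ℝ} (hs : 0 < s) :
    ((G.lefts.filter fun a => s < G.len a).card : ℝ) ≤ l / s := by
  rw [le_div_iff₀ hs, ← nsmul_eq_mul, ← Finset.sum_const]
  refine le_of_le_of_eq ?_ (G.sum_len hl hX)
  exact (Finset.sum_le_sum fun a ha => (Finset.mem_filter.1 ha).2.le).trans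
    (Finset.sum_le_sum_of_subset_of_nonneg (Finset.filter_subset _ _)
      fun a ha _ => (G.len_pos ha).le)

/-- Indices `k` of the cells `[k h, k h + s)` that fit into the gap with left endpoint `a`. -/
def cellsIn (s h a : ℝ) : Finset ℤ := Finset.Ioc ⌊a / h⌋ ⌊(G.right a - s) / h⌋

lemma mem_cellsIn {s h a : ℝ} (hh : 0 < h) {k : ℤ} :
    k ∈ G.cellsIn s h a ↔ a < k * h ∧ k * h + s ≤ G.right a := by
  rw [cellsIn, Finset.mem_Ioc, Int.floor_lt, Int.le_floor, div_lt_iff₀ hh, le_div_iff₀ hh,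
    le_sub_iff_add_le]

/-- The left endpoints of the cells in a gap are the points of the grid of mesh `h` in a half-open
interval of length `L - s`. Taking floors costs at most one point, and nothing when the gap is too
short. -/
lemma abs_card_cellsIn_sub_le {s h a : ℝ} (hh : 0 < h) :
    |h * (G.cellsIn s h a).card - max (G.len a - s) 0| ≤ if s < G.len a then h else 0 := by
  rw [cellsIn, Int.card_Ioc, len]
  set x := a / h with hx
  set y := (G.right a - s) / h with hy
  have hxy : G.right a - a - s = h * (y - x) := by
    rw [hx, hy]
    field_simp
    ring
  by_cases hs : s < G.right a - a
  · have hyx : 0 < y - x := by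
      by_contra h'
      push Not at h'
      nlinarith
    rw [if_pos hs, max_eq_left (by linarith), hxy]
    have h1 : ⌊x⌋ ≤ ⌊y⌋ := Int.floor_le_floor (by linarith)
    have h2 : ((⌊y⌋ - ⌊x⌋).toNat : ℝ) = ⌊y⌋ - ⌊x⌋ := by
      have : ((⌊y⌋ - ⌊x⌋).toNat : ℤ) = ⌊y⌋ - ⌊x⌋ := Int.toNat_of_nonneg (by omega)
      exact_mod_cast this
    rw [h2, ← mul_sub, abs_mul, abs_of_pos hh]
    have h3 := Int.floor_le x
    have h4 := Int.floor_le y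
    have h5 := Int.lt_floor_add_one x
    have h6 := Int.lt_floor_add_one y
    have : |(⌊y⌋ - ⌊x⌋ : ℝ) - (y - x)| ≤ 1 := by
      rw [abs_le]
      constructor <;> linarith
    nlinarith
  · push Not at hs
    have hyx : y ≤ x := by
      by_contra h'
      push Not at h'
      nlinarith
    have h1 : ⌊y⌋ ≤ ⌊x⌋ := Int.floor_le_floor hyx
    rw [if_neg (by linarith), max_eq_right (by linarith), Int.toNat_of_nonpos (by omega)]
    simp

lemma sum_emptyInd_eq_sum_card (hX : (X ∩ box l).Finite) {s : ℝ} (hs : 0 < s) {r : ℕ}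
    (hr : 0 < r) : ∑ k ∈ Finset.Ioc ⌊(-l / 2) / (s / r)⌋ ⌊(l / 2 - s) / (s / r)⌋,
      emptyInd X (cell s r k) = ∑ a ∈ G.lefts, ((G.cellsIn s (s / r) a).card : ℝ) := by
  classical
  have hh : 0 < s / r := by positivity
  have hsub : ∀ k ∈ Finset.Ioc ⌊(-l / 2) / (s / r)⌋ ⌊(l / 2 - s) / (s / r)⌋,
      cell s r k ⊆ box l := by
    intro k hk x hx
    rw [Finset.mem_Ioc, Int.floor_lt, Int.le_floor, div_lt_iff₀ hh, le_div_iff₀ hh] at hk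
    exact ⟨hk.1.trans_le hx.1, by linarith [hx.2, hk.2]⟩
  have h1 : ∀ k ∈ Finset.Ioc ⌊(-l / 2) / (s / r)⌋ ⌊(l / 2 - s) / (s / r)⌋,
      emptyInd X (cell s r k) = if Disjoint (cell s r k) X then 1 else 0 := by
    intro k hk
    split_ifs with h
    · exact emptyInd_eq_one h
    · exact emptyInd_eq_zero (hX.subset (inter_subset_inter_right _ (hsub k hk))) h
  rw [Finset.sum_congr rfl h1, ← Finset.sum_filter, Finset.sum_const, nsmul_eq_mul, mul_one,
    ← Nat.cast_sum, ← Finset.card_biUnion]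
  · congr 2
    ext k
    simp only [Finset.mem_filter, Finset.mem_biUnion, G.mem_cellsIn hh]
    constructor
    · rintro ⟨hk, hd⟩
      have hbox := hsub k hk
      have hkm : (k : ℝ) * (s / r) ∈ cell s r k := ⟨le_rfl, by linarith⟩
      -- The left end of an empty cell belongs to the half-open cell, so it is no impurity and lies
      -- in some gap. That gap cannot end inside the cell: its right end is an impurity or the wall
      -- `l / 2`.
      obtain ⟨a, ha, hka⟩ := G.cover _ (hbox hkm) (disjoint_left.1 hd hkm)
      refine ⟨a, ha, hka.1, ?_⟩
      by_contra hlt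
      push Not at hlt
      rcases G.right_eq a ha with h | h
      · rw [Finset.mem_Ioc, Int.le_floor, le_div_iff₀ hh] at hk
        linarith [hk.2]
      · exact disjoint_left.1 hd (show G.right a ∈ cell s r k from ⟨hka.2.le, hlt⟩) h.1
    · rintro ⟨a, ha, hk1, hk2⟩
      refine ⟨?_, ?_⟩
      · rw [Finset.mem_Ioc, Int.floor_lt, Int.le_floor, div_lt_iff₀ hh, le_div_iff₀ hh]
        exact ⟨(G.le_left a ha).trans_lt hk1, by linarith [G.right_le a ha]⟩
      · exact (G.disjoint a ha).mono_left
          (show cell s r k ⊆ Ioo a (G.right a) from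
            fun x hx => ⟨hk1.trans_le hx.1, hx.2.trans_le hk2⟩)
  · intro a ha a' ha' haa
    rw [Function.onFun, Finset.disjoint_left]
    intro k hk hk'
    rw [G.mem_cellsIn hh] at hk hk'
    exact disjoint_left.1 (G.disjoint_Ioo ha ha' haa)
      (show (k : ℝ) * (s / r) ∈ Ioo a (G.right a) from ⟨hk.1, by linarith⟩) ⟨hk'.1, by linarith⟩

/-- Each gap longer than `s` contributes an error of at most the mesh `s / r`, and there are at most
`l / s` such gaps. -/
lemma abs_sum_emptyInd_sub_le (hl : 0 < l) (hX : (X ∩ box l).Finite) {s : ℝ} (hs : 0 < s) {r : ℕ}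
    (hr : 0 < r) : |s / r * ∑ k ∈ Finset.Ioc ⌊(-l / 2) / (s / r)⌋ ⌊(l / 2 - s) / (s / r)⌋,
      emptyInd X (cell s r k) - G.sum fun L => max (L - s) 0| ≤ l / r := by
  have hh : 0 < s / r := by positivity
  rw [G.sum_emptyInd_eq_sum_card hX hs hr, sum, Finset.mul_sum, ← Finset.sum_sub_distrib]
  calc _ ≤ ∑ a ∈ G.lefts, |s / r * (G.cellsIn s (s / r) a).card - max (G.len a - s) 0| :=
        Finset.abs_sum_le_sum_abs _ _
    _ ≤ ∑ a ∈ G.lefts, if s < G.len a then s / r else 0 :=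
        Finset.sum_le_sum fun a _ => G.abs_card_cellsIn_sub_le hh
    _ = (G.lefts.filter fun a => s < G.len a).card * (s / r) := by
        rw [← Finset.sum_filter, Finset.sum_const, nsmul_eq_mul]
    _ ≤ l / s * (s / r) := mul_le_mul_of_nonneg_right (G.card_lt_len_le hl hX hs) hh.le
    _ = l / r := by field_simp

end Gaps

/-- The last cells overhang the window by up to `s`, hence `n + 1` in the hypothesis. -/
lemma emptyCells_le_sum {l s : ℝ} {X : Set ℝ} {r n : ℕ} (hs : 0 < s) (hr : 0 < r)
    (hn : 2 * s * (n + 1) ≤ l) : emptyCells X s r n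
      ≤ ∑ k ∈ Finset.Ioc ⌊(-l / 2) / (s / r)⌋ ⌊(l / 2 - s) / (s / r)⌋, emptyInd X (cell s r k) := by
  have hh : 0 < s / r := by positivity
  refine Finset.sum_le_sum_of_subset_of_nonneg (fun k hk => ?_) fun k _ _ => emptyInd_nonneg _ _
  rw [Finset.mem_Ico] at hk
  have h1 : (-(n * r) : ℝ) ≤ k := by exact_mod_cast hk.1
  have h2 : (k : ℝ) < n * r := by exact_mod_cast hk.2
  have h3 : (n * r : ℝ) * (s / r) = n * s := by field_simp
  rw [Finset.mem_Ioc, Int.floor_lt, Int.le_floor, div_lt_iff₀ hh, le_div_iff₀ hh]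
  constructor <;> nlinarith

lemma sum_le_emptyCells {l s : ℝ} {X : Set ℝ} {r n : ℕ} (hs : 0 < s) (hr : 0 < r)
    (hn : l ≤ 2 * s * n) :
    ∑ k ∈ Finset.Ioc ⌊(-l / 2) / (s / r)⌋ ⌊(l / 2 - s) / (s / r)⌋, emptyInd X (cell s r k)
      ≤ emptyCells X s r n := by
  have hh : 0 < s / r := by positivity
  refine Finset.sum_le_sum_of_subset_of_nonneg (fun k hk => ?_) fun k _ _ => emptyInd_nonneg _ _
  rw [Finset.mem_Ioc, Int.floor_lt, Int.le_floor, div_lt_iff₀ hh, le_div_iff₀ hh] at hk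
  have h3 : (n * r : ℝ) * (s / r) = n * s := by field_simp
  rw [Finset.mem_Ico]
  constructor
  · by_contra h
    push Not at h
    have : (k : ℝ) < -(n * r) := by exact_mod_cast h
    nlinarith
  · by_contra h
    push Not at h
    have : (n * r : ℝ) ≤ k := by exact_mod_cast h
    nlinarith

lemma finite_inter_box {X : Set ℝ} (hX : ∀ r : ℝ, (X ∩ Icc (-r) r).Finite) (l : ℝ) :
    (X ∩ box l).Finite :=
  (hX (l / 2)).subset (inter_subset_inter_right _ fun x hx => ⟨by linarith [hx.1], hx.2.le⟩)

lemma tendsto_sum_emptyInd {X : Set ℝ} {s c : ℝ} (hs : 0 < s) {r : ℕ} (hr : 0 < r)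
    (h : Tendsto (fun n : ℕ => emptyCells X s r n / n) atTop (𝓝 (2 * r * c))) :
    Tendsto (fun l : ℝ => (s / r * ∑ k ∈ Finset.Ioc ⌊(-l / 2) / (s / r)⌋ ⌊(l / 2 - s) / (s / r)⌋,
      emptyInd X (cell s r k)) / l) atTop (𝓝 c) := by
  have hh : 0 < s / r := by positivity
  have hfloor : Tendsto (fun l : ℝ => ⌊l / (2 * s)⌋₊) atTop atTop :=
    tendsto_nat_floor_atTop.comp (tendsto_id.atTop_div_const (by positivity))
  have hratio : Tendsto (fun l : ℝ => (⌊l / (2 * s)⌋₊ : ℝ) / l) atTop (𝓝 (1 / (2 * s))) := by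
    have h1 := (tendsto_nat_floor_div_atTop (R := ℝ)).comp
      (tendsto_id.atTop_div_const (show 0 < 2 * s by positivity))
    have h2 := h1.mul_const (1 / (2 * s))
    rw [one_mul] at h2
    refine h2.congr' ?_
    filter_upwards [eventually_gt_atTop 0] with l hl
    simp only [Function.comp, id]
    field_simp
  have hinv : Tendsto (fun l : ℝ => (1 : ℝ) / l) atTop (𝓝 0) := by
    simpa using tendsto_inv_atTop_zero (𝕜 := ℝ)
  -- The window of cells fits into the box for `n = ⌊l / (2 s)⌋ - 1` and covers the indices
  -- occurring in the box for `n = ⌊l / (2 s)⌋ + 1`. A bounded shift `d` does not affect the limit.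
  have key : ∀ d : ℤ, ∀ N : ℝ → ℕ, (∀ᶠ l in atTop, (N l : ℝ) = ⌊l / (2 * s)⌋₊ + d) →
      Tendsto N atTop atTop →
      Tendsto (fun l : ℝ => s / r * emptyCells X s r (N l) / l) atTop (𝓝 c) := by
    intro d N hN hNt
    have h1 : Tendsto (fun l : ℝ => (N l : ℝ) / l) atTop (𝓝 (1 / (2 * s))) := by
      have := hratio.add (hinv.const_mul (d : ℝ))
      rw [mul_zero, add_zero] at this
      refine this.congr' ?_
      filter_upwards [hN] with l hl
      rw [hl]
      ring
    have h2 := ((h.comp hNt).mul h1).const_mul (s / r)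
    have h3 : s / r * (2 * r * c * (1 / (2 * s))) = c := by field_simp
    rw [h3] at h2
    refine h2.congr' ?_
    filter_upwards [hNt.eventually_gt_atTop 0, eventually_gt_atTop 0] with l hl hl0
    have : (0 : ℝ) < N l := by exact_mod_cast hl
    simp only [Function.comp]
    field_simp
  have hlow := key (-1) (fun l => ⌊l / (2 * s)⌋₊ - 1) (by
      filter_upwards [hfloor.eventually_ge_atTop 1] with l hl
      rw [Nat.cast_sub hl]
      push_cast
      ring) ((tendsto_sub_atTop_nat 1).comp hfloor)
  have hup := key 1 (fun l => ⌊l / (2 * s)⌋₊ + 1) (by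
      filter_upwards with l
      push_cast
      ring) ((tendsto_add_atTop_nat 1).comp hfloor)
  refine tendsto_of_tendsto_of_tendsto_of_le_of_le' hlow hup ?_ ?_
  · filter_upwards [eventually_gt_atTop 0, hfloor.eventually_ge_atTop 1] with l hl hl1
    refine div_le_div_of_nonneg_right (mul_le_mul_of_nonneg_left ?_ hh.le) hl.le
    refine emptyCells_le_sum hs hr ?_
    have := Nat.floor_le (show 0 ≤ l / (2 * s) by positivity)
    rw [le_div_iff₀ (by positivity)] at this
    rw [Nat.cast_sub hl1]
    push_cast
    linarith
  · filter_upwards [eventually_gt_atTop 0] with l hl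
    refine div_le_div_of_nonneg_right (mul_le_mul_of_nonneg_left ?_ hh.le) hl.le
    refine sum_le_emptyCells hs hr ?_
    have := Nat.lt_floor_add_one (l / (2 * s))
    rw [div_lt_iff₀ (by positivity)] at this
    push_cast
    linarith

/-- The gaps between the impurities in the boxes `Λ_l`, `l ≥ 1`. -/
abbrev GapsFamily (X : Set ℝ) : Type := ∀ l : Ici (1 : ℝ), Gaps (l : ℝ) X

/-- The law of large numbers for the gaps, tested on the functions `L ↦ (L - s)₊`. -/
def HasGapLaw (lam : ℝ) (X : Set ℝ) : Prop :=
  (∀ r : ℝ, (X ∩ Icc (-r) r).Finite) ∧ ∀ (G : GapsFamily X) (s : ℝ), 0 ≤ s →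
    Tendsto (fun l : Ici (1 : ℝ) => (G l).sum (fun L => max (L - s) 0) / l) atTop
      (𝓝 (Real.exp (-(lam * s))))

lemma tendsto_coe_Ici : Tendsto (fun l : Ici (1 : ℝ) => (l : ℝ)) atTop atTop :=
  tendsto_comp_val_Ici_atTop.2 tendsto_id

lemma Ici_one_pos (l : Ici (1 : ℝ)) : 0 < (l : ℝ) := one_pos.trans_le l.2

/-- Countably many pairs `(s, r)` suffice, so a single null set is excluded. Letting `r` grow
removes the discretization error. Monotonicity in `s` and continuity of the limit then pass from
rational to real `s`. -/
lemma hasGapLaw_of_emptyCells {lam : ℝ} {X : Set ℝ}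
    (hX : ∀ r : ℝ, (X ∩ Icc (-r) r).Finite)
    (h : ∀ (s : ℚ) (r : ℕ), 0 < s → 0 < r → Tendsto (fun n : ℕ => emptyCells X s r n / n) atTop
      (𝓝 (2 * r * Real.exp (-(lam * s))))) : HasGapLaw lam X := by
  refine ⟨hX, fun G => ?_⟩
  have hfin := finite_inter_box hX
  have hrat : ∀ s : ℚ, 0 < s →
      Tendsto (fun l : Ici (1 : ℝ) => (G l).sum (fun L => max (L - s) 0) / l) atTop
        (𝓝 (Real.exp (-(lam * s)))) := by
    intro s hs
    have hs' : (0 : ℝ) < s := by exact_mod_cast hs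
    rw [Metric.tendsto_nhds]
    intro ε hε
    -- The discretization error per unit length is `1 / r < ε / 2`.
    obtain ⟨r, hr⟩ := exists_nat_gt (2 / ε)
    have hr0 : (0 : ℝ) < r := (by positivity : 0 < 2 / ε).trans hr
    have h1 := (tendsto_sum_emptyInd hs' (by exact_mod_cast hr0)
      (h s r hs (by exact_mod_cast hr0))).comp tendsto_coe_Ici
    filter_upwards [Metric.tendsto_nhds.1 h1 (ε / 2) (by positivity)] with l hl
    have h2 := (G l).abs_sum_emptyInd_sub_le (Ici_one_pos l) (hfin l) hs'
      (r := r) (by exact_mod_cast hr0)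
    simp only [Function.comp] at hl
    set Z := s / r * ∑ k ∈ Finset.Ioc ⌊(-(l : ℝ) / 2) / (s / r)⌋ ⌊((l : ℝ) / 2 - s) / (s / r)⌋,
      emptyInd X (cell s r k) with hZ
    set V := (G l).sum fun L => max (L - s) 0 with hV
    have h3 : dist (V / l) (Z / l) ≤ 1 / r := by
      rw [Real.dist_eq, ← sub_div, abs_div, abs_of_pos (Ici_one_pos l), abs_sub_comm,
        div_le_iff₀ (Ici_one_pos l)]
      calc _ ≤ (l : ℝ) / r := h2
        _ = _ := by ring
    have h4 : (1 : ℝ) / r < ε / 2 := by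
      rw [div_lt_iff₀ hε] at hr
      rw [div_lt_div_iff₀ hr0 two_pos]
      linarith
    linarith [dist_triangle (V / l) (Z / l) (Real.exp (-(lam * s)))]
  have hanti : ∀ {s t : ℝ}, s ≤ t → ∀ l : Ici (1 : ℝ),
      (G l).sum (fun L => max (L - t) 0) / l ≤ (G l).sum (fun L => max (L - s) 0) / l := by
    intro s t hst l
    refine div_le_div_of_nonneg_right (Finset.sum_le_sum fun a _ => ?_) (Ici_one_pos l).le
    exact max_le_max (by linarith) le_rfl
  intro s hs
  -- For `s = 0` the sum is the total length of the gaps, which is exactly `l`.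
  rcases hs.eq_or_lt with rfl | hs
  · rw [mul_zero, neg_zero, Real.exp_zero]
    refine tendsto_const_nhds.congr fun l => ?_
    have : (G l).sum (fun L => max (L - 0) 0) = (G l).sum fun L => L :=
      Finset.sum_congr rfl fun a ha => by
        simp only [sub_zero]
        exact max_eq_left ((G l).len_pos ha).le
    rw [this, (G l).sum_len (Ici_one_pos l) (hfin l), div_self (Ici_one_pos l).ne']
  · have hcont : Continuous fun s : ℝ => Real.exp (-(lam * s)) := by fun_prop
    rw [tendsto_order]
    constructor
    · intro a ha
      have h1 : ∀ᶠ t in 𝓝[>] s, a < Real.exp (-(lam * t)) :=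
        (hcont.continuousAt.eventually (lt_mem_nhds ha)).filter_mono nhdsWithin_le_nhds
      obtain ⟨u, hu, hsu⟩ := (mem_nhdsGT_iff_exists_Ioo_subset).1 h1
      obtain ⟨q, hq1, hq2⟩ := exists_rat_btwn (mem_Ioi.1 hu)
      have hq0 : 0 < q := by exact_mod_cast hs.trans hq1
      filter_upwards [(tendsto_order.1 (hrat q hq0)).1 a (hsu ⟨hq1, hq2⟩)] with l hl
      exact hl.trans_le (hanti hq1.le l)
    · intro a ha
      have h1 : ∀ᶠ t in 𝓝[<] s, Real.exp (-(lam * t)) < a :=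
        (hcont.continuousAt.eventually (gt_mem_nhds ha)).filter_mono nhdsWithin_le_nhds
      obtain ⟨u, hu, hsu⟩ := (mem_nhdsLT_iff_exists_Ioo_subset).1 h1
      obtain ⟨q, hq1, hq2⟩ := exists_rat_btwn (max_lt (mem_Iio.1 hu) hs)
      have hq0 : 0 < q := by exact_mod_cast (le_max_right _ _).trans_lt hq1
      filter_upwards [(tendsto_order.1 (hrat q hq0)).2 a
        (hsu ⟨(le_max_left _ _).trans_lt hq1, hq2⟩)] with l hl
      exact (hanti hq2.le l).trans_lt hl

lemma IsPoissonProcess.ae_hasGapLaw {Ω : Type*} [MeasurableSpace Ω] {P : Measure Ω}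
    [IsProbabilityMeasure P] {lam : ℝ≥0} {X : Ω → Set ℝ} (hX : IsPoissonProcess P lam X) :
    ∀ᵐ ω ∂P, HasGapLaw lam (X ω) := by
  have h1 : ∀ (s : ℚ) (r : ℕ), ∀ᵐ ω ∂P, 0 < s → 0 < r →
      Tendsto (fun n : ℕ => emptyCells (X ω) s r n / n) atTop
        (𝓝 (2 * r * Real.exp (-(lam * s)))) := by
    intro s r
    by_cases hs : 0 < s
    · by_cases hr : 0 < r
      · filter_upwards [hX.ae_tendsto_emptyCells (s := s) (by exact_mod_cast hs) hr] with ω h _ _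
        exact h
      · exact Eventually.of_forall fun _ _ h => absurd h hr
    · exact Eventually.of_forall fun _ h => absurd h hs
  filter_upwards [ae_all_iff.2 fun s => ae_all_iff.2 (h1 s)] with ω h
  exact hasGapLaw_of_emptyCells (hX.locallyFinite ω) h

end

end LuttingerSy

namespace LuttingerSy

noncomputable section

/-! ### Averages over the gaps -/

/-- The limiting density of gaps, as a measure on the gap lengths: `λ² exp (-λ s) ds`. -/
def gapMeasure (lam : ℝ) : Measure ℝ :=
  (volume.restrict (Ioi 0)).withDensity fun s => ENNReal.ofReal (lam ^ 2 * Real.exp (-(lam * s)))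

lemma ae_gapMeasure_pos (lam : ℝ) : ∀ᵐ s ∂gapMeasure lam, 0 < s :=
  (withDensity_absolutelyContinuous _ _).ae_le (ae_restrict_mem measurableSet_Ioi)

lemma measurable_gapDensity (lam : ℝ) :
    Measurable fun s : ℝ => ENNReal.ofReal (lam ^ 2 * Real.exp (-(lam * s))) := by fun_prop

lemma integrable_gapMeasure_iff (lam : ℝ) (F : ℝ → ℝ) : Integrable F (gapMeasure lam) ↔
    IntegrableOn (fun s => lam ^ 2 * Real.exp (-(lam * s)) * F s) (Ioi 0) := by
  rw [gapMeasure, integrable_withDensity_iff_integrable_smul' (measurable_gapDensity lam)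
    (Eventually.of_forall fun _ => ENNReal.ofReal_lt_top), IntegrableOn]
  refine integrable_congr (Eventually.of_forall fun s => ?_)
  simp only
  rw [ENNReal.toReal_ofReal (by positivity), smul_eq_mul]

lemma integral_gapMeasure (lam : ℝ) (F : ℝ → ℝ) : ∫ s, F s ∂gapMeasure lam
    = ∫ s in Ioi 0, lam ^ 2 * Real.exp (-(lam * s)) * F s := by
  rw [gapMeasure, integral_withDensity_eq_integral_toReal_smul (measurable_gapDensity lam)
    (Eventually.of_forall fun _ => ENNReal.ofReal_lt_top)]
  refine integral_congr_ae (Eventually.of_forall fun s => ?_)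
  simp only
  rw [ENNReal.toReal_ofReal (by positivity), smul_eq_mul]

lemma tendsto_pow_mul_exp_neg {lam : ℝ} (hlam : 0 < lam) (n : ℕ) :
    Tendsto (fun s : ℝ => s ^ n * Real.exp (-(lam * s))) atTop (𝓝 0) := by
  have h := (Real.tendsto_pow_mul_exp_neg_atTop_nhds_zero n).comp
    (tendsto_id.const_mul_atTop hlam)
  have h2 := h.const_mul ((1 / lam) ^ n)
  rw [mul_zero] at h2
  refine h2.congr fun s => ?_
  have h3 : (1 / lam) ^ n * lam ^ n = 1 := by
    rw [← mul_pow, one_div_mul_cancel hlam.ne', one_pow]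
  simp only [Function.comp, id, mul_pow]
  linear_combination (s ^ n * Real.exp (-(lam * s))) * h3

/-- The second moment of the gap length is what makes the critical density finite. -/
lemma integrable_sq_gapMeasure {lam : ℝ} (hlam : 0 < lam) :
    Integrable (fun s => s ^ 2) (gapMeasure lam) := by
  rw [integrable_gapMeasure_iff]
  refine integrableOn_Ioi_deriv_of_nonneg' (l := 0)
    (g := fun s => -((lam * s ^ 2 + 2 * s + 2 / lam) * Real.exp (-(lam * s))))
    (fun s _ => ?_) (fun s _ => by positivity) ?_
  · have h1 : HasDerivAt (fun s : ℝ => lam * s ^ 2 + 2 * s + 2 / lam) (lam * (2 * s) + 2) s := by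
      simpa using (((hasDerivAt_pow 2 s).const_mul lam).add
        ((hasDerivAt_id s).const_mul 2)).add_const (2 / lam)
    have h2 : HasDerivAt (fun s : ℝ => Real.exp (-(lam * s))) (Real.exp (-(lam * s)) * -lam) s := by
      simpa using (((hasDerivAt_id s).const_mul lam).neg).exp
    convert! (h1.mul h2).neg using 1
    field_simp
    ring
  · have h0 := tendsto_pow_mul_exp_neg hlam 0
    have h1 := tendsto_pow_mul_exp_neg hlam 1
    have h2 := tendsto_pow_mul_exp_neg hlam 2
    have := (((h2.const_mul lam).add (h1.const_mul 2)).add (h0.const_mul (2 / lam))).neg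
    simp only [mul_zero, add_zero, neg_zero] at this
    refine this.congr fun s => ?_
    ring

lemma hasDerivAt_hinge (lam t s : ℝ) :
    HasDerivAt (fun s => -((lam * (s - t) + 1) * Real.exp (-(lam * s))))
      (lam ^ 2 * Real.exp (-(lam * s)) * (s - t)) s := by
  have h1 : HasDerivAt (fun s : ℝ => lam * (s - t) + 1) lam s := by
    simpa using (((hasDerivAt_id s).sub_const t).const_mul lam).add_const 1
  have h2 : HasDerivAt (fun s : ℝ => Real.exp (-(lam * s))) (Real.exp (-(lam * s)) * -lam) s := by
    simpa using (((hasDerivAt_id s).const_mul lam).neg).exp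
  convert! (h1.mul h2).neg using 1
  ring

/-- This identifies the limit measure: the second derivative in `t` of the limit `exp (-λ t)` is the
density `λ² exp (-λ t)`. -/
lemma hinge_gapMeasure {lam : ℝ} (hlam : 0 < lam) {t : ℝ} (ht : 0 ≤ t) :
    Integrable (fun s => max (s - t) 0) (gapMeasure lam) ∧
      ∫ s, max (s - t) 0 ∂gapMeasure lam = Real.exp (-(lam * t)) := by
  have hlim : Tendsto (fun s => -((lam * (s - t) + 1) * Real.exp (-(lam * s)))) atTop (𝓝 0) := by
    have h0 := tendsto_pow_mul_exp_neg hlam 0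
    have h1 := tendsto_pow_mul_exp_neg hlam 1
    have := ((h1.const_mul lam).add (h0.const_mul (1 - lam * t))).neg
    simp only [mul_zero, add_zero, neg_zero] at this
    refine this.congr fun s => ?_
    ring
  have hnn : ∀ s ∈ Ioi t, 0 ≤ lam ^ 2 * Real.exp (-(lam * s)) * (s - t) := fun s hs =>
    mul_nonneg (by positivity) (sub_nonneg.2 (mem_Ioi.1 hs).le)
  have hint := integrableOn_Ioi_deriv_of_nonneg' (fun s _ => hasDerivAt_hinge lam t s) hnn hlim
  have hval := integral_Ioi_of_hasDerivAt_of_nonneg' (fun s _ => hasDerivAt_hinge lam t s) hnn hlim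
  have heq : ∀ s, lam ^ 2 * Real.exp (-(lam * s)) * max (s - t) 0
      = (Ioi t).indicator (fun s => lam ^ 2 * Real.exp (-(lam * s)) * (s - t)) s := by
    intro s
    by_cases hs : s ∈ Ioi t
    · rw [indicator_of_mem hs, max_eq_left (sub_nonneg.2 (mem_Ioi.1 hs).le)]
    · rw [indicator_of_notMem hs, max_eq_right (sub_nonpos.2 (not_lt.1 hs)), mul_zero]
  constructor
  · rw [integrable_gapMeasure_iff]
    simp_rw [heq]
    exact (hint.integrable_indicator measurableSet_Ioi).integrableOn
  · rw [integral_gapMeasure]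
    simp_rw [heq]
    rw [setIntegral_indicator measurableSet_Ioi, inter_eq_right.2 (Ioi_subset_Ioi ht), hval]
    simp

/-- The averages of `F` over the gaps in the boxes converge to the integral of `F`. -/
def IsGapLimit (lam : ℝ) (X : Set ℝ) (F : ℝ → ℝ) : Prop :=
  Integrable F (gapMeasure lam) ∧ ∀ G : GapsFamily X,
    Tendsto (fun l : Ici (1 : ℝ) => (G l).sum F / l) atTop (𝓝 (∫ s, F s ∂gapMeasure lam))

variable {lam : ℝ} {X : Set ℝ}

lemma IsGapLimit.add {F F' : ℝ → ℝ} (h : IsGapLimit lam X F) (h' : IsGapLimit lam X F') :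
    IsGapLimit lam X fun s => F s + F' s := by
  refine ⟨h.1.add h'.1, fun G => ?_⟩
  rw [integral_add h.1 h'.1]
  refine ((h.2 G).add (h'.2 G)).congr fun l => ?_
  simp only [Gaps.sum, Finset.sum_add_distrib, add_div]

lemma IsGapLimit.const_mul {F : ℝ → ℝ} (h : IsGapLimit lam X F) (c : ℝ) :
    IsGapLimit lam X fun s => c * F s := by
  refine ⟨h.1.const_mul c, fun G => ?_⟩
  rw [integral_const_mul]
  refine ((h.2 G).const_mul c).congr fun l => ?_
  simp only [Gaps.sum, ← Finset.mul_sum, mul_div_assoc]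

lemma IsGapLimit.sub {F F' : ℝ → ℝ} (h : IsGapLimit lam X F) (h' : IsGapLimit lam X F') :
    IsGapLimit lam X fun s => F s - F' s := by
  have := h.add (h'.const_mul (-1))
  simpa [sub_eq_add_neg] using this

lemma isGapLimit_zero : IsGapLimit lam X fun _ => 0 :=
  ⟨integrable_zero _ _ _, fun G => by simp [Gaps.sum]⟩

lemma isGapLimit_sum {ι : Type*} (s : Finset ι) {F : ι → ℝ → ℝ}
    (h : ∀ i ∈ s, IsGapLimit lam X (F i)) : IsGapLimit lam X fun t => ∑ i ∈ s, F i t := by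
  classical
  induction s using Finset.induction_on with
  | empty => simpa using isGapLimit_zero
  | insert i s hi ih =>
    simp_rw [Finset.sum_insert hi]
    exact (h i (Finset.mem_insert_self _ _)).add
      (ih fun j hj => h j (Finset.mem_insert_of_mem hj))

/-- Since `H` has a gap limit too, the bound `|F - F'| ≤ H` controls the error simultaneously in the
finite averages and in the integral. -/
lemma isGapLimit_of_approx {F : ℝ → ℝ} (hF : AEStronglyMeasurable F (gapMeasure lam))
    (h : ∀ ε > 0, ∃ F' H : ℝ → ℝ, IsGapLimit lam X F' ∧ IsGapLimit lam X H ∧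
      (∀ s, 0 < s → |F s - F' s| ≤ H s) ∧ ∫ s, H s ∂gapMeasure lam ≤ ε) :
    IsGapLimit lam X F := by
  have hint : Integrable F (gapMeasure lam) := by
    obtain ⟨F', H, h1, h2, h3, -⟩ := h 1 one_pos
    refine (h1.1.norm.add h2.1).mono' hF ?_
    filter_upwards [ae_gapMeasure_pos lam] with s hs
    have := h3 s hs
    simp only [Pi.add_apply, Real.norm_eq_abs]
    calc |F s| = |F' s + (F s - F' s)| := by ring_nf
      _ ≤ |F' s| + |F s - F' s| := abs_add_le _ _
      _ ≤ _ := by linarith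
  refine ⟨hint, fun G => ?_⟩
  rw [Metric.tendsto_nhds]
  intro ε hε
  obtain ⟨F', H, h1, h2, h3, h4⟩ := h (ε / 5) (by positivity)
  have h5 : |∫ s, F s ∂gapMeasure lam - ∫ s, F' s ∂gapMeasure lam| ≤ ε / 5 := by
    rw [← integral_sub hint h1.1]
    refine (abs_integral_le_integral_abs).trans (le_trans ?_ h4)
    refine integral_mono_ae (hint.sub h1.1).abs h2.1 ?_
    filter_upwards [ae_gapMeasure_pos lam] with s hs using h3 s hs
  filter_upwards [Metric.tendsto_nhds.1 (h1.2 G) (ε / 5) (by positivity),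
    Metric.tendsto_nhds.1 (h2.2 G) (ε / 5) (by positivity)] with l hl1 hl2
  rw [Real.dist_eq, abs_lt] at hl1 hl2
  have h6 : |(G l).sum F / l - (G l).sum F' / l| ≤ (G l).sum H / l := by
    rw [← sub_div, abs_div, abs_of_pos (Ici_one_pos l)]
    refine div_le_div_of_nonneg_right ?_ (Ici_one_pos l).le
    rw [Gaps.sum, Gaps.sum, ← Finset.sum_sub_distrib]
    exact (Finset.abs_sum_le_sum_abs _ _).trans
      (Finset.sum_le_sum fun a ha => h3 _ ((G l).len_pos ha))
  rw [Real.dist_eq, abs_lt]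
  rw [abs_le] at h5 h6
  constructor <;> linarith

lemma HasGapLaw.hinge (hlam : 0 < lam) (h : HasGapLaw lam X) {s : ℝ} (hs : 0 ≤ s) :
    IsGapLimit lam X fun L => max (L - s) 0 := by
  refine ⟨(hinge_gapMeasure hlam hs).1, fun G => ?_⟩
  rw [(hinge_gapMeasure hlam hs).2]
  exact h.2 G s hs

lemma HasGapLaw.id (hlam : 0 < lam) (h : HasGapLaw lam X) : IsGapLimit lam X fun L => L := by
  refine isGapLimit_of_approx aestronglyMeasurable_id fun ε hε =>
    ⟨_, _, h.hinge hlam le_rfl, isGapLimit_zero, fun s hs => ?_, by simpa using hε.le⟩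
  rw [sub_zero, max_eq_left hs.le, sub_self, abs_zero]

lemma integral_id_gapMeasure (hlam : 0 < lam) : ∫ s, s ∂gapMeasure lam = 1 := by
  have h := (hinge_gapMeasure hlam le_rfl).2
  rw [mul_zero, neg_zero, Real.exp_zero] at h
  rw [← h]
  refine integral_congr_ae ?_
  filter_upwards [ae_gapMeasure_pos lam] with s hs
  rw [sub_zero, max_eq_left hs.le]

/-- A difference quotient of two hinges approximates the jump. The error is dominated by a second
difference quotient, a tent of height `1` on `[s - d, s + d]`. -/
lemma HasGapLaw.indicator_Ici (hlam : 0 < lam) (h : HasGapLaw lam X) {s : ℝ} (hs : 0 < s) :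
    IsGapLimit lam X ((Ici s).indicator 1) := by
  refine isGapLimit_of_approx
    ((measurable_one.indicator measurableSet_Ici).aestronglyMeasurable) fun ε hε => ?_
  obtain ⟨d, hd, hds, hdε⟩ : ∃ d, 0 < d ∧ d ≤ s ∧
      d⁻¹ * (Real.exp (-(lam * (s - d))) + Real.exp (-(lam * (s + d)))
        - 2 * Real.exp (-(lam * s))) ≤ ε := by
    -- The integral of the tent is a difference quotient at `0` of a function even in `d`, so it
    -- tends to `0`.
    have hder : HasDerivAt (fun d => Real.exp (-(lam * (s - d))) + Real.exp (-(lam * (s + d)))) 0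
        0 := by
      have h1 : HasDerivAt (fun d : ℝ => -(lam * (s - d))) lam 0 := by
        simpa using (((hasDerivAt_id (0 : ℝ)).const_sub s).const_mul lam).fun_neg
      have h2 : HasDerivAt (fun d : ℝ => -(lam * (s + d))) (-lam) 0 := by
        simpa using (((hasDerivAt_id (0 : ℝ)).const_add s).const_mul lam).fun_neg
      convert! h1.exp.add h2.exp using 1
      simp
    have ht := (hasDerivAt_iff_tendsto_slope_zero.1 hder).mono_left
      (nhdsWithin_mono (0 : ℝ) (fun x hx => ne_of_gt hx : Ioi (0 : ℝ) ⊆ {0}ᶜ))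
    have hev := (ht.eventually (ge_mem_nhds hε)).and
      (Ioc_mem_nhdsGT hs : ∀ᶠ d in 𝓝[>] (0 : ℝ), d ∈ Ioc 0 s)
    obtain ⟨d, hd1, hd2⟩ := hev.exists
    refine ⟨d, hd2.1, hd2.2, ?_⟩
    simp only [smul_eq_mul, zero_add, sub_zero, add_zero] at hd1
    convert! hd1 using 3
    ring
  have hp := h.hinge hlam (show 0 ≤ s - d by linarith)
  have hq := h.hinge hlam hs.le
  have hr := h.hinge hlam (show 0 ≤ s + d by linarith)
  have hH := ((hp.add hr).sub (hq.const_mul 2)).const_mul d⁻¹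
  refine ⟨_, _, (hq.sub hr).const_mul d⁻¹, hH, fun L _ => ?_, ?_⟩
  · rw [← mul_le_mul_iff_of_pos_left hd, ← abs_of_pos hd, ← abs_mul, abs_of_pos hd, mul_sub,
      ← mul_assoc, ← mul_assoc, mul_inv_cancel₀ hd.ne', one_mul, one_mul]
    by_cases hL : L ∈ Ici s
    · rw [indicator_of_mem hL, Pi.one_apply]
      rw [mem_Ici] at hL
      rcases max_cases (L - (s + d)) 0 with h1 | h1 <;> rcases max_cases (L - s) 0 with h2 | h2 <;>
        rcases max_cases (L - (s - d)) 0 with h3 | h3 <;> rw [abs_le] <;> constructor <;> linarith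
    · rw [indicator_of_notMem hL]
      rw [mem_Ici, not_le] at hL
      rcases max_cases (L - (s + d)) 0 with h1 | h1 <;> rcases max_cases (L - s) 0 with h2 | h2 <;>
        rcases max_cases (L - (s - d)) 0 with h3 | h3 <;> rw [abs_le] <;> constructor <;> linarith
  · rw [integral_const_mul, integral_sub (hp.add hr).1 (hq.const_mul 2).1,
      integral_add hp.1 hr.1, integral_const_mul, (hinge_gapMeasure hlam (by linarith)).2,
      (hinge_gapMeasure hlam hs.le).2, (hinge_gapMeasure hlam (by linarith)).2]
    exact hdε

lemma HasGapLaw.indicator_Ico (hlam : 0 < lam) (h : HasGapLaw lam X) {s t : ℝ} (hs : 0 < s)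
    (hst : s ≤ t) : IsGapLimit lam X ((Ico s t).indicator 1) := by
  have := (h.indicator_Ici hlam hs).sub (h.indicator_Ici hlam (hs.trans_le hst))
  convert! this using 1
  ext L
  by_cases h1 : s ≤ L <;> by_cases h2 : t ≤ L <;> simp [indicator, h1, h2]
  linarith

lemma sum_indicator_Ici_eq_min (x : ℝ) (M : ℕ) :
    ∑ m ∈ Finset.range M, (Ici ((m : ℝ) + 1)).indicator (1 : ℝ → ℝ) x = (min ⌊x⌋₊ M : ℕ) := by
  have h : ∀ m : ℕ, (Ici ((m : ℝ) + 1)).indicator (1 : ℝ → ℝ) x = if m < ⌊x⌋₊ then 1 else 0 := by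
    intro m
    have : x ∈ Ici ((m : ℝ) + 1) ↔ m < ⌊x⌋₊ := by
      rw [mem_Ici, ← Nat.succ_le_iff, Nat.le_floor_iff' (Nat.succ_ne_zero m)]
      push_cast
      rfl
    simp only [indicator, this, Pi.one_apply]
  simp_rw [h]
  rw [← Finset.sum_filter, Finset.sum_const, nsmul_eq_mul, mul_one]
  congr 1
  rw [show (Finset.range M).filter (fun m => m < ⌊x⌋₊) = Finset.range (min ⌊x⌋₊ M) by
    ext m; simp; tauto, Finset.card_range]

/-- The floor is a sum of indicators of half-lines. Truncating after `M` terms leaves a remainder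
bounded by a hinge of small integral. -/
lemma HasGapLaw.floor (hlam : 0 < lam) (h : HasGapLaw lam X) {c : ℝ} (hc : 0 < c) :
    IsGapLimit lam X fun L => (⌊L / c⌋₊ : ℝ) := by
  refine isGapLimit_of_approx (by
    have : Measurable fun L : ℝ => (⌊L / c⌋₊ : ℝ) :=
      (measurable_from_nat (f := fun n : ℕ => (n : ℝ))).comp
        (Nat.measurable_floor.comp (measurable_id.div_const c))
    exact this.aestronglyMeasurable) fun ε hε => ?_
  obtain ⟨M, hM⟩ : ∃ M : ℕ, c⁻¹ * Real.exp (-(lam * (M * c))) ≤ ε := by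
    have h1 : Tendsto (fun M : ℕ => lam * ((M : ℝ) * c)) atTop atTop :=
      (tendsto_natCast_atTop_atTop.atTop_mul_const hc).const_mul_atTop hlam
    have h2 := (Real.tendsto_exp_neg_atTop_nhds_zero.comp h1).const_mul c⁻¹
    rw [mul_zero] at h2
    obtain ⟨M, hM⟩ := (h2.eventually (ge_mem_nhds hε)).exists
    exact ⟨M, hM⟩
  refine ⟨_, _, isGapLimit_sum (Finset.range M) fun m _ =>
    h.indicator_Ici hlam (show 0 < ((m : ℝ) + 1) * c by positivity),
    (h.hinge hlam (show 0 ≤ (M : ℝ) * c by positivity)).const_mul c⁻¹, fun L hL => ?_, ?_⟩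
  · have h1 : ∑ m ∈ Finset.range M, (Ici (((m : ℝ) + 1) * c)).indicator (1 : ℝ → ℝ) L
        = (min ⌊L / c⌋₊ M : ℕ) := by
      rw [← sum_indicator_Ici_eq_min]
      refine Finset.sum_congr rfl fun m _ => ?_
      simp only [indicator, mem_Ici, le_div_iff₀ hc, Pi.one_apply]
    rw [h1]
    have h2 : c⁻¹ * max (L - M * c) 0 = max (L / c - M) 0 := by
      rw [mul_max_of_nonneg _ _ (inv_nonneg.2 hc.le), mul_zero]
      congr 1
      field_simp
    rw [h2]
    have h3 := Nat.floor_le (show 0 ≤ L / c by positivity)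
    rcases le_total ⌊L / c⌋₊ M with h4 | h4
    · rw [min_eq_left h4, sub_self, abs_zero]
      exact le_max_right _ _
    · rw [min_eq_right h4, abs_of_nonneg (sub_nonneg.2 (by exact_mod_cast h4))]
      exact le_max_of_le_left (by linarith)
  · rw [integral_const_mul, (hinge_gapMeasure hlam (by positivity)).2]
    exact hM

/-- On `[c, A)` the function is approximated by step functions. Beyond `A` the bound `C L ≤ 2 C (L -
A / 2)₊` places the tail under a hinge of small integral. -/
lemma HasGapLaw.of_continuousOn (hlam : 0 < lam) (h : HasGapLaw lam X) {F : ℝ → ℝ} {c C : ℝ}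
    (hc : 0 < c) (hF : ContinuousOn F (Ioi 0)) (hF0 : ∀ s, 0 < s → s < c → F s = 0)
    (hFC : ∀ s, 0 < s → |F s| ≤ C * s) : IsGapLimit lam X F := by
  refine isGapLimit_of_approx ((hF.aestronglyMeasurable measurableSet_Ioi).mono_ac
    (withDensity_absolutelyContinuous _ _)) fun ε hε => ?_
  have hC : 0 ≤ C := by simpa using (abs_nonneg _).trans (hFC 1 one_pos)
  obtain ⟨A, hAc, hA⟩ : ∃ A, c < A ∧ 2 * C * Real.exp (-(lam * (A / 2))) ≤ ε / 2 := by
    have h1 : Tendsto (fun A : ℝ => lam * (A / 2)) atTop atTop :=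
      (tendsto_id.atTop_div_const two_pos).const_mul_atTop hlam
    have h2 := (Real.tendsto_exp_neg_atTop_nhds_zero.comp h1).const_mul (2 * C)
    rw [mul_zero] at h2
    obtain ⟨A, hA1, hA2⟩ := ((h2.eventually (ge_mem_nhds (half_pos hε))).and
      (eventually_gt_atTop c)).exists
    exact ⟨A, hA2, hA1⟩
  have hunif := isCompact_Icc.uniformContinuousOn_of_continuous
    (hF.mono fun x (hx : x ∈ Icc c A) => hc.trans_le hx.1)
  rw [Metric.uniformContinuousOn_iff] at hunif
  -- A uniform error `c ε / 2` is at most `(ε / 2) L` for `L ≥ c`, and the mean of `L` is `1`.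
  obtain ⟨δ, hδ, hunif⟩ := hunif (c * (ε / 2)) (by positivity)
  obtain ⟨n, hn⟩ := exists_nat_gt ((A - c) / δ)
  have hAc' : 0 < A - c := by linarith
  have hn0 : (0 : ℝ) < n := (by positivity : 0 < (A - c) / δ).trans hn
  set d := (A - c) / n with hd
  have hd0 : 0 < d := by positivity
  have hdδ : d < δ := by
    rw [hd, div_lt_iff₀ hn0]
    rw [div_lt_iff₀ hδ] at hn
    linarith
  have hnd : c + n * d = A := by
    rw [hd]
    field_simp
    ring
  refine ⟨_, _, isGapLimit_sum (Finset.range n) fun i _ =>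
    (h.indicator_Ico hlam (show 0 < c + i * d by positivity)
      (show c + i * d ≤ c + (i + 1) * d by nlinarith)).const_mul (F (c + i * d)),
    ((h.id hlam).const_mul (ε / 2)).add ((h.hinge hlam
      (show 0 ≤ A / 2 by linarith)).const_mul (2 * C)), fun L hL => ?_, ?_⟩
  · by_cases h1 : L < c
    · rw [hF0 L hL h1, Finset.sum_eq_zero]
      · rw [sub_self, abs_zero]
        have := le_max_right (L - A / 2) 0
        positivity
      · intro i _
        rw [indicator_of_notMem, mul_zero]
        rintro ⟨h2, -⟩
        nlinarith [(Nat.cast_nonneg i : (0 : ℝ) ≤ i)]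
    push Not at h1
    by_cases h2 : A ≤ L
    · rw [Finset.sum_eq_zero, sub_zero]
      · refine (hFC L hL).trans ?_
        have h3 := le_max_left (L - A / 2) 0
        have h4 : C * L ≤ 2 * C * max (L - A / 2) 0 := by nlinarith
        have : 0 ≤ ε / 2 * L := by positivity
        linarith
      · intro i hi
        rw [Finset.mem_range] at hi
        rw [indicator_of_notMem, mul_zero]
        rintro ⟨-, h3⟩
        have : (i : ℝ) + 1 ≤ n := by exact_mod_cast hi
        nlinarith
    push Not at h2
    set i := ⌊(L - c) / d⌋₊ with hi
    have h3 : (i : ℝ) * d ≤ L - c := by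
      rw [← le_div_iff₀ hd0]
      exact Nat.floor_le (div_nonneg (by linarith) hd0.le)
    have h4 : L - c < (i + 1) * d := by
      rw [← div_lt_iff₀ hd0]
      exact Nat.lt_floor_add_one _
    have hin : i < n := by
      by_contra h5
      push Not at h5
      have : (n : ℝ) ≤ i := by exact_mod_cast h5
      nlinarith
    rw [Finset.sum_eq_single i]
    · rw [indicator_of_mem (show L ∈ Ico (c + i * d) (c + (i + 1) * d) from
        ⟨by linarith, by linarith⟩), Pi.one_apply, mul_one]
      have h6 := hunif L ⟨h1, h2.le⟩ (c + i * d) ⟨by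
        have : 0 ≤ (i : ℝ) * d := by positivity
        linarith, by linarith⟩ (by
        rw [Real.dist_eq, abs_lt]
        constructor <;> nlinarith)
      rw [Real.dist_eq] at h6
      have h7 := le_max_right (L - A / 2) 0
      have h8 : 0 ≤ 2 * C * max (L - A / 2) 0 := by positivity
      nlinarith
    · intro j _ hji
      rw [indicator_of_notMem, mul_zero]
      rintro ⟨h5, h6⟩
      apply hji
      have h7 : (j : ℝ) < i + 1 := by
        have : (j : ℝ) * d < (i + 1) * d := by linarith
        exact lt_of_mul_lt_mul_right this hd0.le
      have h8 : (i : ℝ) < j + 1 := by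
        have : (i : ℝ) * d < (j + 1) * d := by linarith
        exact lt_of_mul_lt_mul_right this hd0.le
      have h9 : j < i + 1 := by exact_mod_cast h7
      have h10 : i < j + 1 := by exact_mod_cast h8
      omega
    · intro h5
      exact absurd (Finset.mem_range.2 hin) h5
  · have h1 := (h.id hlam).const_mul (ε / 2)
    have h2 := (h.hinge hlam (show 0 ≤ A / 2 by linarith)).const_mul (2 * C)
    rw [integral_add h1.1 h2.1, integral_const_mul, integral_const_mul,
      integral_id_gapMeasure hlam, (hinge_gapMeasure hlam (by linarith)).2]
    linarith

end

end LuttingerSy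

namespace LuttingerSy

noncomputable section

/-! ### Momentum distribution of the eigenfunctions -/

/-- The Fourier transform of the function `t ↦ sin ((m + 1) π t)` on the unit interval. -/
def sineFourier (m : ℕ) (x : ℝ) : ℂ :=
  ∫ t in (0 : ℝ)..1, (Real.sin ((m + 1) * Real.pi * t) : ℂ) * Complex.exp (Complex.I * (x * t : ℝ))

lemma intervalIntegrable_sineFourier (m : ℕ) (x : ℝ) : IntervalIntegrable (fun t : ℝ =>
    (Real.sin ((m + 1) * Real.pi * t) : ℂ) * Complex.exp (Complex.I * (x * t : ℝ)))
    volume 0 1 := by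
  refine Continuous.intervalIntegrable ?_ _ _
  fun_prop

lemma norm_sineFourier_le (m : ℕ) (x : ℝ) : ‖sineFourier m x‖ ≤ 1 := by
  have h := intervalIntegral.norm_integral_le_of_norm_le_const (a := (0 : ℝ)) (b := 1) (C := 1)
    (f := fun t : ℝ => (Real.sin ((m + 1) * Real.pi * t) : ℂ) *
      Complex.exp (Complex.I * (x * t : ℝ))) fun t _ => by
      rw [norm_mul, Complex.norm_exp_I_mul_ofReal, mul_one, Complex.norm_real]
      exact Real.abs_sin_le_one _
  simpa [sineFourier] using h

lemma norm_sineFourier_sub_le (m : ℕ) (x y : ℝ) :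
    ‖sineFourier m x - sineFourier m y‖ ≤ |x - y| := by
  rw [sineFourier, sineFourier, ← intervalIntegral.integral_sub
    (intervalIntegrable_sineFourier m x) (intervalIntegrable_sineFourier m y)]
  have h := intervalIntegral.norm_integral_le_of_norm_le_const (a := (0 : ℝ)) (b := 1)
    (C := |x - y|)
    (f := fun t : ℝ => (Real.sin ((m + 1) * Real.pi * t) : ℂ) *
      Complex.exp (Complex.I * (x * t : ℝ)) - (Real.sin ((m + 1) * Real.pi * t) : ℂ) *
      Complex.exp (Complex.I * (y * t : ℝ))) fun t ht => by
      rw [uIoc_of_le zero_le_one] at ht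
      have h1 : Complex.exp (Complex.I * (x * t : ℝ)) = Complex.exp (Complex.I * (y * t : ℝ)) *
          Complex.exp (Complex.I * ((x - y) * t : ℝ)) := by
        rw [← Complex.exp_add]
        congr 1
        push_cast
        ring
      rw [h1, ← mul_sub, ← mul_sub_one, norm_mul, norm_mul, Complex.norm_exp_I_mul_ofReal, one_mul,
        Complex.norm_real]
      calc _ ≤ 1 * |(x - y) * t| := mul_le_mul (Real.abs_sin_le_one _)
            Real.norm_exp_I_mul_ofReal_sub_one_le (norm_nonneg _) zero_le_one
        _ ≤ |x - y| := by
            rw [one_mul, abs_mul, abs_of_pos ht.1]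
            exact mul_le_of_le_one_right (abs_nonneg _) ht.2
  simpa using h

lemma continuous_sineFourier (m : ℕ) : Continuous (sineFourier m) :=
  (LipschitzWith.of_dist_le_mul (K := 1) fun x y => by
    rw [NNReal.coe_one, one_mul, Complex.dist_eq, Real.dist_eq]
    exact norm_sineFourier_sub_le m x y).continuous

/-- The probability that a particle in the level `m` of an interval of length `s` has momentum at
most `κ`. -/
def momentumProb (κ : ℝ) (m : ℕ) (s : ℝ) : ℝ :=
  2 / Real.pi * ∫ q in (0 : ℝ)..(κ * s), ‖sineFourier m q‖ ^ 2

lemma continuous_norm_sq_sineFourier (m : ℕ) : Continuous fun q => ‖sineFourier m q‖ ^ 2 :=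
  (continuous_sineFourier m).norm.pow 2

lemma continuous_momentumProb (κ : ℝ) (m : ℕ) : Continuous (momentumProb κ m) := by
  have h : Continuous fun x : ℝ => ∫ q in (0 : ℝ)..x, ‖sineFourier m q‖ ^ 2 :=
    intervalIntegral.continuous_primitive
      (fun a b => (continuous_norm_sq_sineFourier m).intervalIntegrable a b) 0
  exact continuous_const.mul (h.comp (continuous_const.mul continuous_id))

lemma momentumProb_nonneg {κ s : ℝ} (hκ : 0 ≤ κ) (hs : 0 ≤ s) (m : ℕ) :
    0 ≤ momentumProb κ m s :=
  mul_nonneg (by positivity) (intervalIntegral.integral_nonneg (by positivity)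
    fun _ _ => by positivity)

lemma norm_sq_sineFourier_le (m : ℕ) (x : ℝ) : ‖sineFourier m x‖ ^ 2 ≤ 1 :=
  pow_le_one₀ (norm_nonneg _) (norm_sineFourier_le m x)

lemma momentumProb_le {κ s : ℝ} (hκ : 0 ≤ κ) (hs : 0 ≤ s) (m : ℕ) :
    momentumProb κ m s ≤ 2 / Real.pi * (κ * s) := by
  refine mul_le_mul_of_nonneg_left ?_ (by positivity)
  have := intervalIntegral.integral_mono_on (μ := volume) (a := 0) (b := κ * s) (by positivity)
    ((continuous_norm_sq_sineFourier m).intervalIntegrable _ _)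
    (intervalIntegrable_const (c := (1 : ℝ))) fun x _ => norm_sq_sineFourier_le m x
  simpa using this

/-- The overlap of the level `m` of an interval of length `s`, whose left endpoint has distance `b`
from the left end of the box, with the kinetic-energy eigenfunction `k`. -/
def overlap (l b s : ℝ) (m k : ℕ) : ℝ :=
  2 * √(s / l) * (Complex.exp (Complex.I * ((k + 1) * Real.pi / l * b : ℝ)) *
    sineFourier m ((k + 1) * Real.pi / l * s)).im

/-- Box eigenfunctions have height of order `1 / √l`, so a short gap captures little of any of them.
This estimate excludes macroscopic occupation. -/
lemma overlap_sq_le {l s : ℝ} (hl : 0 < l) (hs : 0 ≤ s) (b : ℝ) (m k : ℕ) :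
    overlap l b s m k ^ 2 ≤ 4 * s / l := by
  rw [overlap, mul_pow, mul_pow, Real.sq_sqrt (by positivity)]
  set w := Complex.exp (Complex.I * ((k + 1) * Real.pi / l * b : ℝ)) *
    sineFourier m ((k + 1) * Real.pi / l * s) with hw
  have h1 : ‖w‖ ≤ 1 := by
    rw [hw, norm_mul, Complex.norm_exp_I_mul_ofReal, one_mul]
    exact norm_sineFourier_le _ _
  have h2 : w.im ^ 2 ≤ 1 := by
    rw [sq_le_one_iff_abs_le_one]
    exact (Complex.abs_im_le_norm w).trans h1
  have h3 : 0 ≤ 2 ^ 2 * (s / l) := by positivity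
  calc _ ≤ 2 ^ 2 * (s / l) * 1 := mul_le_mul_of_nonneg_left h2 h3
    _ = _ := by ring

/-- The kinetic-energy eigenfunctions of the box. -/
def boxVec (l : ℝ) (k : ℕ) : L2Box l := piece l (-l / 2) (l / 2) (sineFun (-l / 2) (l / 2) k)

/-- The gap is rescaled to the unit interval, and the box sine is the imaginary part of an
exponential. The position of the gap then enters only through a phase. -/
lemma inner_piece_boxVec {l a b : ℝ} (ha : -l / 2 ≤ a) (hab : a < b) (hb : b ≤ l / 2) (m k : ℕ) :
    (inner ℂ (piece l a b (sineFun a b m)) (boxVec l k) : ℂ)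
      = (overlap l (a + l / 2) (b - a) m k : ℂ) := by
  have hl : 0 < l := by linarith
  have hs : 0 < b - a := sub_pos.2 hab
  have h1 : ∫ x in a..b, (sineFun a b m x : ℂ) * boxVec l k x
      = ((∫ x in a..b, sineFun a b m x * sineFun (-l / 2) (l / 2) k x : ℝ) : ℂ) := by
    rw [← intervalIntegral.integral_ofReal, intervalIntegral.integral_of_le hab.le,
      intervalIntegral.integral_of_le hab.le, integral_Ioc_eq_integral_Ioo,
      integral_Ioc_eq_integral_Ioo]
    refine integral_congr_ae ?_
    filter_upwards [ae_mono (Measure.restrict_mono (Ioo_subset_box ha hb) le_rfl)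
      (coeFn_piece l (-l / 2) (l / 2) (sineFun (-l / 2) (l / 2) k)),
      ae_restrict_mem measurableSet_Ioo] with x hx hx'
    rw [boxVec, hx, indicator_of_mem (show x ∈ Ioo (-l / 2) (l / 2) from Ioo_subset_box ha hb hx')]
    push_cast
    rfl
  rw [inner_piece ha hab.le hb, h1]
  congr 1
  have h2 : ∫ x in a..b, sineFun a b m x * sineFun (-l / 2) (l / 2) k x
      = (b - a) * ∫ t in (0 : ℝ)..1, sineFun a b m (a + (b - a) * t) *
        sineFun (-l / 2) (l / 2) k (a + (b - a) * t) := by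
    have := intervalIntegral.smul_integral_comp_add_mul (a := (0 : ℝ)) (b := 1)
      (fun x => sineFun a b m x * sineFun (-l / 2) (l / 2) k x) (b - a) a
    simp only [smul_eq_mul, mul_zero, add_zero, mul_one, add_sub_cancel] at this
    exact this.symm
  have h3 : ∀ t, sineFun a b m (a + (b - a) * t) * sineFun (-l / 2) (l / 2) k (a + (b - a) * t)
      = √(2 / (b - a)) * √(2 / l) * (Real.sin ((m + 1) * Real.pi * t) *
        Real.sin ((k + 1) * Real.pi / l * (a + l / 2) + (k + 1) * Real.pi / l * (b - a) * t)) := by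
    intro t
    rw [sineFun_apply, sineFun_apply]
    have e1 : (m + 1) * Real.pi / (b - a) * (a + (b - a) * t - a) = (m + 1) * Real.pi * t := by
      field_simp
      ring
    have e2 : l / 2 - -l / 2 = l := by ring
    have e3 : (k + 1) * Real.pi / l * (a + (b - a) * t - -l / 2)
        = (k + 1) * Real.pi / l * (a + l / 2) + (k + 1) * Real.pi / l * (b - a) * t := by ring
    rw [e1, e2, e3]
    ring
  simp_rw [h2, h3]
  rw [intervalIntegral.integral_const_mul, overlap, sineFourier]
  have h4 := Complex.imCLM.intervalIntegral_comp_comm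
    ((intervalIntegrable_sineFourier m ((k + 1) * Real.pi / l * (b - a))).const_mul
      (Complex.exp (Complex.I * ((k + 1) * Real.pi / l * (a + l / 2) : ℝ))))
  simp only [Complex.imCLM_apply] at h4
  rw [intervalIntegral.integral_const_mul] at h4
  rw [← h4]
  have h5 : ∀ t : ℝ, (Complex.exp (Complex.I * ((k + 1) * Real.pi / l * (a + l / 2) : ℝ)) *
      ((Real.sin ((m + 1) * Real.pi * t) : ℂ) *
        Complex.exp (Complex.I * ((k + 1) * Real.pi / l * (b - a) * t : ℝ)))).im
      = Real.sin ((m + 1) * Real.pi * t) *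
        Real.sin ((k + 1) * Real.pi / l * (a + l / 2) + (k + 1) * Real.pi / l * (b - a) * t) := by
    intro t
    rw [mul_left_comm, ← Complex.exp_add, ← mul_add, ← Complex.ofReal_add, Complex.im_ofReal_mul,
      mul_comm Complex.I, Complex.exp_ofReal_mul_I_im]
  simp_rw [h5]
  rw [← mul_assoc]
  congr 1
  have h6 : √(2 / (b - a)) * √(2 / l) = 2 * √((b - a) / l) / (b - a) := by
    rw [← Real.sqrt_mul (by positivity), eq_div_iff hs.ne']
    have : 2 / (b - a) * (2 / l) = (2 / (b - a)) ^ 2 * ((b - a) / l) := by field_simp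
    rw [this, Real.sqrt_mul (by positivity), Real.sqrt_sq (by positivity)]
    field_simp
  rw [h6]
  field_simp

/-- The gap of a box without impurities. -/
def boxGaps {l : ℝ} (hl : 0 < l) : Gaps l ∅ where
  lefts := {-l / 2}
  right _ := l / 2
  lt_right a ha := by rw [Finset.mem_singleton] at ha; linarith
  le_left a ha := (Finset.mem_singleton.1 ha).ge
  right_le _ _ := le_rfl
  left_eq a ha := Or.inl (Finset.mem_singleton.1 ha)
  right_eq _ _ := Or.inl rfl
  right_le_left a ha a' ha' h := by
    rw [Finset.mem_singleton] at ha ha'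
    linarith
  disjoint _ _ := disjoint_empty _
  cover x hx _ := ⟨_, Finset.mem_singleton_self _, hx⟩

/-- The kinetic-energy eigenbasis of the box. -/
def boxSystem {l : ℝ} (hl : 0 < l) : EigenSystem l ∅ (boxGaps hl).Index :=
  (boxGaps hl).system (by simp)

lemma tsum_boxSystem {l : ℝ} (hl : 0 < l) (g : ℝ → ℝ≥0∞) (u : L2Box l) :
    ∑' i, g ((boxSystem hl).energy i) * 
        ENNReal.ofReal (‖(inner ℂ ((boxSystem hl).vec i) u : ℂ)‖ ^ 2)
      = ∑' k, g (gapEnergy k l) * ENNReal.ofReal (‖(inner ℂ (boxVec l k) u : ℂ)‖ ^ 2) := by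
  have h := (boxGaps hl).tsum_index fun a k => g (gapEnergy k ((boxGaps hl).len a)) *
    ENNReal.ofReal (‖(inner ℂ (piece l a ((boxGaps hl).right a)
      (sineFun a ((boxGaps hl).right a) k)) u : ℂ)‖ ^ 2)
  have h3 : (boxGaps hl).len (-l / 2) = l := by
    change l / 2 - -l / 2 = l
    ring
  have h4 := h.trans (Finset.sum_singleton _ _)
  rw [h3] at h4
  refine Eq.trans (tsum_congr fun i => ?_) h4
  rw [boxSystem, Gaps.system_vec]
  rfl

lemma sum_overlap_sq_le_one {l a b : ℝ} (ha : -l / 2 ≤ a) (hab : a < b) (hb : b ≤ l / 2)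
    (m K : ℕ) : ∑ k ∈ Finset.range K, overlap l (a + l / 2) (b - a) m k ^ 2 ≤ 1 := by
  have hl : 0 < l := by linarith
  have h1 := tsum_sq_inner (boxSystem hl).vec (piece l a b (sineFun a b m))
  have h2 := tsum_boxSystem hl 1 (piece l a b (sineFun a b m))
  simp only [Pi.one_apply, one_mul] at h2
  rw [h2, norm_piece_sineFun ha hab hb, one_pow, ENNReal.ofReal_one] at h1
  have h3 := ENNReal.sum_le_tsum (f := fun k => ENNReal.ofReal
    (‖(inner ℂ (boxVec l k) (piece l a b (sineFun a b m)) : ℂ)‖ ^ 2)) (Finset.range K)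
  rw [h1, ← ENNReal.ofReal_sum_of_nonneg fun _ _ => by positivity, ← ENNReal.ofReal_one,
    ENNReal.ofReal_le_ofReal_iff zero_le_one] at h3
  refine le_of_eq_of_le (Finset.sum_congr rfl fun k _ => ?_) h3
  rw [norm_inner_symm, inner_piece_boxVec ha hab hb, Complex.norm_real, Real.norm_eq_abs, sq_abs]

/-! ### Riemann sums and oscillating sums of overlaps -/

lemma abs_riemann_sum_sub_le {f : ℝ → ℝ} {C δ : ℝ} (hf : ∀ x y, |f x - f y| ≤ C * |x - y|)
    (hfc : Continuous f) (hC : 0 ≤ C) (hδ : 0 ≤ δ) (K : ℕ) :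
    |δ * ∑ k ∈ Finset.range K, f ((k + 1) * δ) - ∫ x in (0 : ℝ)..(K * δ), f x|
      ≤ K * (C * δ ^ 2) := by
  induction K with
  | zero => simp
  | succ K ih =>
    have hi := intervalIntegral.integral_add_adjacent_intervals
      (hfc.intervalIntegrable (μ := volume) 0 (K * δ))
      (hfc.intervalIntegrable (K * δ) ((K + 1 : ℕ) * δ))
    have hcell : |δ * f ((K + 1) * δ) - ∫ x in (K * δ)..((K + 1 : ℕ) * δ), f x| ≤ C * δ ^ 2 := by
      have h1 : δ * f ((K + 1) * δ) = ∫ _ in (K * δ)..((K + 1 : ℕ) * δ), f ((K + 1) * δ) := by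
        rw [intervalIntegral.integral_const, smul_eq_mul]
        push_cast
        ring
      rw [h1, ← intervalIntegral.integral_sub intervalIntegrable_const
        (hfc.intervalIntegrable _ _), ← Real.norm_eq_abs]
      have hle : K * δ ≤ (K + 1 : ℕ) * δ := by
        push_cast
        nlinarith
      refine (intervalIntegral.norm_integral_le_of_norm_le_const (C := C * δ)
        fun x hx => ?_).trans ?_
      · rw [uIoc_of_le hle] at hx
        push_cast at hx
        rw [Real.norm_eq_abs]
        refine (hf _ _).trans (mul_le_mul_of_nonneg_left ?_ hC)
        rw [abs_le]
        constructor <;> linarith [hx.1, hx.2]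
      · have : |((K + 1 : ℕ) : ℝ) * δ - K * δ| = δ := by
          rw [← sub_mul]
          push_cast
          rw [add_sub_cancel_left, one_mul, abs_of_nonneg hδ]
        rw [this]
        exact le_of_eq (by ring)
    rw [← hi, Finset.sum_range_succ, mul_add]
    push_cast at hcell ⊢
    rw [abs_le] at ih hcell ⊢
    constructor <;> linarith [ih.1, ih.2, hcell.1, hcell.2]

lemma sub_one_mul_sum_eq (A : ℕ → ℂ) (z : ℂ) (K : ℕ) :
    (z - 1) * ∑ k ∈ Finset.range K, A k * z ^ (k + 1)
      = A K * z ^ (K + 1) - A 0 * z - ∑ k ∈ Finset.range K, (A (k + 1) - A k) * z ^ (k + 2) := by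
  induction K with
  | zero => simp
  | succ K ih =>
    rw [Finset.sum_range_succ, Finset.sum_range_succ, mul_add, ih]
    ring

/-- Summation by parts: slowly varying coefficients against powers of a phase `z` away from `1`
produce cancellation. -/
lemma norm_sum_mul_pow_le {A : ℕ → ℂ} {z : ℂ} {η : ℝ} (hz : ‖z‖ = 1) (hA : ∀ k, ‖A k‖ ≤ 1)
    (hη : ∀ k, ‖A (k + 1) - A k‖ ≤ η) (K : ℕ) :
    ‖z - 1‖ * ‖∑ k ∈ Finset.range K, A k * z ^ (k + 1)‖ ≤ 2 + K * η := by
  rw [← norm_mul, sub_one_mul_sum_eq]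
  have h1 : ‖A K * z ^ (K + 1)‖ ≤ 1 := by
    rw [norm_mul, norm_pow, hz, one_pow, mul_one]
    exact hA K
  have h2 : ‖A 0 * z‖ ≤ 1 := by
    rw [norm_mul, hz, mul_one]
    exact hA 0
  have h3 : ‖∑ k ∈ Finset.range K, (A (k + 1) - A k) * z ^ (k + 2)‖ ≤ K * η := by
    refine (norm_sum_le_of_le _ fun k _ => ?_).trans_eq
      (by rw [Finset.sum_const, Finset.card_range, nsmul_eq_mul])
    rw [norm_mul, norm_pow, hz, one_pow, mul_one]
    exact hη k
  calc _ ≤ ‖A K * z ^ (K + 1)‖ + ‖A 0 * z‖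
        + ‖∑ k ∈ Finset.range K, (A (k + 1) - A k) * z ^ (k + 2)‖ :=
        (norm_sub_le _ _).trans (add_le_add_left (norm_sub_le _ _) _)
    _ ≤ _ := by linarith

/-- Jordan's inequality for the sine. The phase of a gap at distance `d` from the ends of the box is
quantitatively away from `1`. -/
lemma le_norm_exp_sub_one {l b d : ℝ} (hl : 0 < l) (hd : 0 ≤ d) (hdb : d ≤ b) (hbd : b ≤ l - d) :
    4 * d / l ≤ ‖Complex.exp (Complex.I * (2 * Real.pi * b / l : ℝ)) - 1‖ := by
  rw [Complex.norm_exp_I_mul_ofReal_sub_one, norm_mul, Real.norm_eq_abs, Real.norm_eq_abs,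
    abs_of_pos two_pos]
  have h1 : 2 * Real.pi * b / l / 2 = Real.pi * (b / l) := by ring
  have hpi := Real.pi_pos
  have h3 : ∀ c, d ≤ c → c ≤ l / 2 → 2 * d / l ≤ Real.sin (Real.pi * (c / l)) := by
    intro c hc hcl
    have h5 : c / l ≤ 1 / 2 := by
      rw [div_le_div_iff₀ hl two_pos]
      linarith
    have h4 := Real.mul_le_sin (x := Real.pi * (c / l))
      (mul_nonneg hpi.le (div_nonneg (hd.trans hc) hl.le)) (by nlinarith)
    refine le_trans ?_ h4
    have : 2 / Real.pi * (Real.pi * (c / l)) = 2 * c / l := by field_simp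
    rw [this]
    gcongr
  have h2 : 2 * d / l ≤ Real.sin (Real.pi * (b / l)) := by
    rcases le_total b (l / 2) with h | h
    · exact h3 b hdb h
    · have := h3 (l - b) (by linarith) (by linarith)
      have e : Real.pi * ((l - b) / l) = Real.pi - Real.pi * (b / l) := by field_simp
      rwa [e, Real.sin_pi_sub] at this
  rw [h1]
  calc 4 * d / l = 2 * (2 * d / l) := by ring
    _ ≤ _ := mul_le_mul_of_nonneg_left (h2.trans (le_abs_self _)) two_pos.le

/-- From `2 (Im w)² = |w|² - Re w²`. The first term is independent of the position of the gap and
gives a Riemann sum; the second oscillates in `k`. -/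
lemma overlap_sq_eq {l s : ℝ} (hl : 0 < l) (hs : 0 ≤ s) (b : ℝ) (m k : ℕ) :
    overlap l b s m k ^ 2 = 2 * s / l * (‖sineFourier m ((k + 1) * (Real.pi * s / l))‖ ^ 2
      - (sineFourier m ((k + 1) * (Real.pi * s / l)) ^ 2 *
        Complex.exp (Complex.I * (2 * Real.pi * b / l : ℝ)) ^ (k + 1)).re) := by
  have e1 : (k + 1) * Real.pi / l * s = (k + 1) * (Real.pi * s / l) := by ring
  have e2 : Complex.exp (Complex.I * (2 * Real.pi * b / l : ℝ)) ^ (k + 1)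
      = Complex.exp (Complex.I * ((k + 1) * Real.pi / l * b : ℝ)) ^ 2 := by
    rw [← Complex.exp_nat_mul, ← Complex.exp_nat_mul]
    congr 1
    push_cast
    ring
  rw [overlap, mul_pow, mul_pow, Real.sq_sqrt (by positivity), e1, e2]
  set e := sineFourier m ((k + 1) * (Real.pi * s / l))
  set x := Complex.exp (Complex.I * ((k + 1) * Real.pi / l * b : ℝ)) with hx
  have h1 : ‖e‖ ^ 2 = ‖x * e‖ ^ 2 := by
    rw [norm_mul, hx, Complex.norm_exp_I_mul_ofReal, one_mul]
  have h2 : e ^ 2 * x ^ 2 = (x * e) ^ 2 := by ring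
  rw [h1, h2]
  set w := x * e
  have h3 : ‖w‖ ^ 2 = w.re ^ 2 + w.im ^ 2 := by
    rw [← Complex.normSq_eq_norm_sq, Complex.normSq_apply]
    ring
  have h4 : (w ^ 2).re = w.re ^ 2 - w.im ^ 2 := by
    rw [pow_two, Complex.mul_re]
    ring
  rw [h3, h4]
  ring

/-- The overlaps with the kinetic-energy eigenfunctions of momentum at most `κ`, in a large box. -/
lemma abs_sum_overlap_sq_sub_le {l s b d κ : ℝ} (hl : 0 < l) (hs : 0 < s) (hd : 0 < d)
    (hdb : d ≤ b) (hbd : b ≤ l - d) (hκ : 0 ≤ κ) (m : ℕ) :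
    |∑ k ∈ Finset.range ⌊κ * l / Real.pi⌋₊, overlap l b s m k ^ 2 - momentumProb κ m s|
      ≤ (4 * κ * s ^ 2 + 2 * s) / l + s * (1 + κ * s) / d := by
  have hpi := Real.pi_pos
  set K := ⌊κ * l / Real.pi⌋₊ with hK
  -- The box wave numbers are `(k + 1) π / l`; measured in units of the inverse gap length they form
  -- a grid of mesh `δ`.
  set δ := Real.pi * s / l with hδ
  have hδ0 : 0 < δ := by positivity
  have hK1 : K * δ ≤ κ * s := by
    have := Nat.floor_le (show 0 ≤ κ * l / Real.pi by positivity)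
    calc K * δ ≤ κ * l / Real.pi * δ := mul_le_mul_of_nonneg_right this hδ0.le
      _ = κ * s := by rw [hδ]; field_simp
  have hK2 : κ * s ≤ K * δ + δ := by
    have := (Nat.lt_floor_add_one (κ * l / Real.pi)).le
    calc κ * s = κ * l / Real.pi * δ := by rw [hδ]; field_simp
      _ ≤ (K + 1) * δ := mul_le_mul_of_nonneg_right this hδ0.le
      _ = _ := by ring
  set f : ℝ → ℝ := fun q => ‖sineFourier m q‖ ^ 2 with hf
  have hfc : Continuous f := continuous_norm_sq_sineFourier m
  have hsq : ∀ x y, ‖sineFourier m x ^ 2 - sineFourier m y ^ 2‖ ≤ 2 * |x - y| := by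
    intro x y
    have h1 : sineFourier m x ^ 2 - sineFourier m y ^ 2
        = (sineFourier m x + sineFourier m y) * (sineFourier m x - sineFourier m y) := by ring
    rw [h1, norm_mul]
    refine mul_le_mul ((norm_add_le _ _).trans ?_) (norm_sineFourier_sub_le m x y)
      (norm_nonneg _) two_pos.le
    linarith [norm_sineFourier_le m x, norm_sineFourier_le m y]
  have hflip : ∀ x y, |f x - f y| ≤ 2 * |x - y| := by
    intro x y
    have h1 : f x - f y = ‖sineFourier m x ^ 2‖ - ‖sineFourier m y ^ 2‖ := by
      rw [norm_pow, norm_pow]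
    rw [h1]
    exact (abs_norm_sub_norm_le _ _).trans (hsq x y)
  have hR := abs_riemann_sum_sub_le hflip hfc two_pos.le hδ0.le K
  have htail : |(∫ x in (0 : ℝ)..(κ * s), f x) - ∫ x in (0 : ℝ)..(K * δ), f x| ≤ δ := by
    have hsub := intervalIntegral.integral_interval_sub_left
      (hfc.intervalIntegrable (μ := volume) 0 (κ * s)) (hfc.intervalIntegrable 0 (K * δ))
    rw [hsub, ← Real.norm_eq_abs]
    refine (intervalIntegral.norm_integral_le_of_norm_le_const (C := 1) fun x _ => ?_).trans ?_
    · rw [Real.norm_of_nonneg (by positivity)]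
      exact norm_sq_sineFourier_le m x
    · rw [one_mul, abs_of_nonneg (by linarith)]
      linarith
  set z := Complex.exp (Complex.I * (2 * Real.pi * b / l : ℝ)) with hz
  set S := ∑ k ∈ Finset.range K, sineFourier m ((k + 1) * δ) ^ 2 * z ^ (k + 1) with hS
  have hsum : ∑ k ∈ Finset.range K, overlap l b s m k ^ 2
      = 2 / Real.pi * (δ * ∑ k ∈ Finset.range K, f ((k + 1) * δ)) - 2 * s / l * S.re := by
    have h1 : ∀ k, overlap l b s m k ^ 2
        = 2 * s / l * (f ((k + 1) * δ) - (sineFourier m ((k + 1) * δ) ^ 2 * z ^ (k + 1)).re) :=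
      fun k => overlap_sq_eq hl hs.le b m k
    have h2 : 2 / Real.pi * δ = 2 * s / l := by
      rw [hδ]
      field_simp
    simp_rw [h1]
    rw [← Finset.mul_sum, Finset.sum_sub_distrib, hS, Complex.re_sum, ← mul_assoc, h2, mul_sub]
  -- Consecutive coefficients differ by at most `2 δ`, so the oscillating sum is of order `l / d`;
  -- its prefactor `2 s / l` then makes it of order `1 / d`.
  have hosc : ‖S‖ ≤ (1 + κ * s) * l / (2 * d) := by
    have h1 := norm_sum_mul_pow_le (A := fun k => sineFourier m ((k + 1) * δ) ^ 2) (z := z)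
      (η := 2 * δ) (Complex.norm_exp_I_mul_ofReal _)
      (fun k => by rw [norm_pow]; exact norm_sq_sineFourier_le m _) (fun k => by
        refine (hsq _ _).trans (le_of_eq ?_)
        have : ((k + 1 : ℕ) + 1 : ℝ) * δ - (k + 1) * δ = δ := by push_cast; ring
        rw [this, abs_of_pos hδ0]) K
    have h2 := le_norm_exp_sub_one hl hd.le hdb hbd
    have h3 : 4 * d / l * ‖S‖ ≤ 2 + 2 * (κ * s) := by
      refine (mul_le_mul_of_nonneg_right h2 (norm_nonneg S)).trans (h1.trans ?_)
      linarith
    rw [le_div_iff₀ (by positivity)]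
    have h4 : 4 * d / l * ‖S‖ * l = 4 * d * ‖S‖ := by field_simp
    have h5 := mul_le_mul_of_nonneg_right h3 hl.le
    rw [h4] at h5
    linarith
  have hosc2 : |2 * s / l * S.re| ≤ s * (1 + κ * s) / d := by
    rw [abs_mul, abs_of_pos (by positivity)]
    calc _ ≤ 2 * s / l * ((1 + κ * s) * l / (2 * d)) :=
          mul_le_mul_of_nonneg_left ((Complex.abs_re_le_norm S).trans hosc) (by positivity)
      _ = _ := by field_simp
  have hmain : |2 / Real.pi * (δ * ∑ k ∈ Finset.range K, f ((k + 1) * δ)) - momentumProb κ m s|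
      ≤ (4 * κ * s ^ 2 + 2 * s) / l := by
    rw [momentumProb, ← mul_sub, abs_mul, abs_of_pos (by positivity)]
    have h1 : |δ * ∑ k ∈ Finset.range K, f ((k + 1) * δ) - ∫ x in (0 : ℝ)..(κ * s), f x|
        ≤ κ * s * (2 * δ) + δ := by
      have h2 : (K : ℝ) * (2 * δ ^ 2) ≤ κ * s * (2 * δ) := by nlinarith
      rw [abs_le] at hR htail ⊢
      constructor <;> linarith [hR.1, hR.2, htail.1, htail.2]
    calc _ ≤ 2 / Real.pi * (κ * s * (2 * δ) + δ) := mul_le_mul_of_nonneg_left h1 (by positivity)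
      _ = _ := by
        rw [hδ]
        field_simp
        ring
  rw [hsum]
  rw [abs_le] at hmain hosc2 ⊢
  constructor <;> linarith [hmain.1, hmain.2, hosc2.1, hosc2.2]

/-- Parseval in a box of length `l` with the gap starting at the centre, in the limit `l → ∞`. -/
lemma momentumProb_le_one {κ s : ℝ} (hκ : 0 ≤ κ) (hs : 0 < s) (m : ℕ) :
    momentumProb κ m s ≤ 1 := by
  have hlim : Tendsto (fun l : ℝ => 1 + ((4 * κ * s ^ 2 + 2 * s) / l + s * (1 + κ * s) / (l / 2)))
      atTop (𝓝 (1 + (0 + 0))) := by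
    refine tendsto_const_nhds.add (Tendsto.add ?_ ?_)
    · exact tendsto_const_nhds.div_atTop tendsto_id
    · exact tendsto_const_nhds.div_atTop (tendsto_id.atTop_div_const two_pos)
  rw [add_zero, add_zero] at hlim
  refine ge_of_tendsto hlim ?_
  filter_upwards [eventually_gt_atTop (2 * s)] with l hl
  have hl0 : 0 < l := by linarith
  have h1 := abs_sum_overlap_sq_sub_le (b := l / 2) (d := l / 2) hl0 hs (by linarith) le_rfl
    (by linarith) hκ m
  have h2 := sum_overlap_sq_le_one (l := l) (a := 0) (b := s) (by linarith) hs (by linarith) m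
    ⌊κ * l / Real.pi⌋₊
  rw [zero_add, sub_zero] at h2
  rw [abs_le] at h1
  linarith [h1.1]

end

end LuttingerSy

namespace LuttingerSy

noncomputable section

/-! ### The integrated density of states and the critical density -/

/-- The limiting density of pairs of a gap and a level in this gap. -/
def levelMeasure (lam : ℝ) : Measure (ℝ × ℕ) := (gapMeasure lam).prod Measure.count

/-- The energy of a level. -/
def levelEnergy (p : ℝ × ℕ) : ℝ := gapEnergy p.2 p.1

lemma measurable_gapEnergy (m : ℕ) : Measurable (gapEnergy m) := by
  unfold gapEnergy
  fun_prop

lemma measurable_levelEnergy : Measurable levelEnergy :=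
  measurable_from_prod_countable_left measurable_gapEnergy

lemma gapEnergy_pos {s : ℝ} (hs : 0 < s) (m : ℕ) : 0 < gapEnergy m s := by
  unfold gapEnergy
  positivity

lemma ae_levelMeasure_pos (lam : ℝ) : ∀ᵐ p ∂levelMeasure lam, 0 < p.1 :=
  Measure.quasiMeasurePreserving_fst.ae (ae_gapMeasure_pos lam)

lemma lintegral_levelMeasure (lam : ℝ) {f : ℝ × ℕ → ℝ≥0∞} (hf : Measurable f) :
    ∫⁻ p, f p ∂levelMeasure lam = ∫⁻ s, ∑' m, f (s, m) ∂gapMeasure lam := by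
  rw [levelMeasure, lintegral_prod f hf.aemeasurable]
  simp_rw [lintegral_count]

/-- The integrated density of states, as a measure on the energy axis. -/
def idsMeasure (lam : ℝ) : Measure ℝ := (levelMeasure lam).map levelEnergy

lemma tsum_indicator_gapEnergy {s : ℝ} (hs : 0 < s) (e : ℝ) :
    ∑' m, (Iic e).indicator (1 : ℝ → ℝ≥0∞) (gapEnergy m s)
      = (⌊√(2 * e) * s / Real.pi⌋₊ : ℝ≥0∞) := by
  have h : ∀ m : ℕ, gapEnergy m s ∈ Iic e ↔ m < ⌊√(2 * e) * s / Real.pi⌋₊ := by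
    intro m
    rw [mem_Iic, gapEnergy_le_iff hs, ← Nat.succ_le_iff, Nat.le_floor_iff' (Nat.succ_ne_zero m),
      le_div_iff₀ Real.pi_pos, mul_comm Real.pi]
    push_cast
    rfl
  rw [tsum_eq_sum (s := Finset.range ⌊√(2 * e) * s / Real.pi⌋₊) fun m hm =>
    indicator_of_notMem (by rwa [h, ← Finset.mem_range]) _]
  rw [Finset.sum_congr rfl fun m hm =>
    indicator_of_mem ((h m).2 (Finset.mem_range.1 hm)) (1 : ℝ → ℝ≥0∞)]
  simp

variable {lam : ℝ} {X : Set ℝ}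

lemma isGapLimit_count (hlam : 0 < lam) (h : HasGapLaw lam X) (e : ℝ) :
    IsGapLimit lam X fun s => (⌊√(2 * e) * s / Real.pi⌋₊ : ℝ) := by
  rcases (Real.sqrt_nonneg (2 * e)).eq_or_lt with h0 | h0
  · simpa [← h0] using isGapLimit_zero
  · convert! h.floor hlam (div_pos Real.pi_pos h0) using 4
    field_simp

lemma idsMeasure_Iic (hlam : 0 < lam) (h : HasGapLaw lam X) (e : ℝ) : idsMeasure lam (Iic e)
    = ENNReal.ofReal (∫ s, (⌊√(2 * e) * s / Real.pi⌋₊ : ℝ) ∂gapMeasure lam) := by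
  rw [ofReal_integral_eq_lintegral_ofReal (isGapLimit_count hlam h e).1
    (Eventually.of_forall fun _ => Nat.cast_nonneg _), ← lintegral_indicator_one measurableSet_Iic,
    idsMeasure, lintegral_map (measurable_one.indicator measurableSet_Iic) measurable_levelEnergy,
    lintegral_levelMeasure lam (f := fun p => (Iic e).indicator 1 (levelEnergy p))
      ((measurable_one.indicator measurableSet_Iic).comp measurable_levelEnergy)]
  refine lintegral_congr_ae ?_
  filter_upwards [ae_gapMeasure_pos lam] with s hs
  rw [ENNReal.ofReal_natCast]
  exact tsum_indicator_gapEnergy hs e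

lemma Gaps.tsum_energy {l : ℝ} (G : Gaps l X) (hX : (X ∩ box l).Finite) (φ : Eigenbasis l X)
    (g : ℝ → ℝ≥0∞) :
    ∑' i, g (φ.energy i) = ∑ a ∈ G.lefts, ∑' m, g (gapEnergy m (G.len a)) :=
  (φ.toSystem.tsum_energy_eq (G.system hX) g).trans
    (G.tsum_index fun a m => g (gapEnergy m (G.len a)))

lemma HasGapLaw.finite_inter_box (h : HasGapLaw lam X) (l : ℝ) : (X ∩ box l).Finite :=
  LuttingerSy.finite_inter_box h.1 l

lemma HasGapLaw.nonempty_gapsFamily (h : HasGapLaw lam X) : Nonempty (GapsFamily X) :=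
  ⟨fun l => (nonempty_gaps (Ici_one_pos l) (h.finite_inter_box l)).some⟩

/-- A gap of length `s` has `⌊√(2 e) s / π⌋` levels of energy at most `e`, so this is the gap limit
of a floor function. -/
lemma HasGapLaw.tendsto_finiteIDS (hlam : 0 < lam) (h : HasGapLaw lam X)
    (φ : EigenbasisFamily X) (e : ℝ) :
    Tendsto (fun l => finiteIDS (φ l) e) atTop (𝓝 (idsMeasure lam (Iic e))) := by
  obtain ⟨G⟩ := h.nonempty_gapsFamily
  rw [idsMeasure_Iic hlam h]
  refine (ENNReal.tendsto_ofReal ((isGapLimit_count hlam h e).2 G)).congr fun l => ?_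
  rw [finiteIDS, ENNReal.ofReal_div_of_pos (Ici_one_pos l), ← ENNReal.tsum_set_one,
    tsum_subtype {i | (φ l).energy i ≤ e} (fun _ => (1 : ℝ≥0∞))]
  congr 1
  refine Eq.trans ?_ ((G l).tsum_energy (h.finite_inter_box l) (φ l)
    ((Iic e).indicator (1 : ℝ → ℝ≥0∞))).symm
  rw [Gaps.sum, ENNReal.ofReal_sum_of_nonneg fun _ _ => Nat.cast_nonneg _]
  refine Finset.sum_congr rfl fun a ha => ?_
  rw [ENNReal.ofReal_natCast, tsum_indicator_gapEnergy ((G l).len_pos ha)]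

lemma bose_le_inv {β μ E : ℝ} (hβ : 0 < β) (h : μ < E) : bose β μ E ≤ 1 / (β * (E - μ)) := by
  have h0 : 0 < β * (E - μ) := mul_pos hβ (sub_pos.2 h)
  refine one_div_le_one_div_of_le h0 ?_
  linarith [Real.add_one_le_exp (β * (E - μ))]

lemma measurable_bose (β μ : ℝ) : Measurable (bose β μ) := by
  unfold bose
  fun_prop

lemma bose_zero_gapEnergy_le {β s : ℝ} (hβ : 0 < β) (hs : 0 < s) (m : ℕ) :
    bose β 0 (gapEnergy m s) ≤ 2 / (β * Real.pi ^ 2) * s ^ 2 * (1 / ((m + 1 : ℕ) : ℝ) ^ 2) := by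
  refine (bose_le_inv hβ (gapEnergy_pos hs m)).trans (le_of_eq ?_)
  rw [gapEnergy]
  push_cast
  field_simp
  ring

/-- The critical density. -/
def criticalDensity (lam β : ℝ) : ℝ≥0∞ :=
  ∫⁻ p, ENNReal.ofReal (bose β 0 (levelEnergy p)) ∂levelMeasure lam

/-- At `μ = 0` the bound `bose ≤ 1 / (β E)` is a multiple of `s² / (m + 1)²`: summable in the level,
and integrable because gap lengths have a second moment. -/
lemma criticalDensity_ne_top {β : ℝ} (hlam : 0 < lam) (hβ : 0 < β) :
    criticalDensity lam β ≠ ⊤ := by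
  have hs : Summable fun m : ℕ => 1 / ((m + 1 : ℕ) : ℝ) ^ 2 :=
    (summable_nat_add_iff 1).2 (Real.summable_one_div_nat_pow.2 one_lt_two)
  rw [criticalDensity, lintegral_levelMeasure lam
    (f := fun p => ENNReal.ofReal (bose β 0 (levelEnergy p))) ((measurable_bose β 0).comp
      measurable_levelEnergy).ennreal_ofReal]
  have hle : ∀ᵐ s ∂gapMeasure lam, ∑' m, ENNReal.ofReal (bose β 0 (levelEnergy (s, m)))
      ≤ ENNReal.ofReal (2 / (β * Real.pi ^ 2) * s ^ 2 * ∑' m : ℕ, 1 / ((m + 1 : ℕ) : ℝ) ^ 2) := by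
    filter_upwards [ae_gapMeasure_pos lam] with s hs0
    rw [← tsum_mul_left, ENNReal.ofReal_tsum_of_nonneg (fun m => by positivity) (hs.mul_left _)]
    exact ENNReal.tsum_le_tsum fun m => ENNReal.ofReal_le_ofReal (bose_zero_gapEnergy_le hβ hs0 m)
  refine ne_top_of_le_ne_top ?_ (lintegral_mono_ae hle)
  exact (((integrable_sq_gapMeasure hlam).const_mul _).mul_const _).lintegral_lt_top.ne

lemma tendsto_bose {β E : ℝ} (hβ : 0 < β) {f : ℝ → ℝ} {u : Filter ℝ} {c : ℝ}
    (hf : Tendsto f u (𝓝 c)) (h : c < E) :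
    Tendsto (fun x => bose β (f x) E) u (𝓝 (bose β c E)) := by
  have h1 : ContinuousAt (fun μ => bose β μ E) c :=
    ContinuousAt.div continuousAt_const (by fun_prop)
      (sub_pos.2 (Real.one_lt_exp_iff.2 (mul_pos hβ (sub_pos.2 h)))).ne'
  exact h1.tendsto.comp hf

/-- Level energies are nonnegative, so the restriction to `[0, ∞)` loses nothing. Dominated
convergence applies with the weight at `μ = 0` as majorant. -/
lemma isCriticalDensity {β : ℝ} (hlam : 0 < lam) (hβ : 0 < β) :
    IsCriticalDensity β (idsMeasure lam) (criticalDensity lam β).toNNReal := by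
  rw [IsCriticalDensity, ENNReal.coe_toNNReal (criticalDensity_ne_top hlam hβ)]
  have h1 : ∀ μ : ℝ, ∫⁻ e in Ici (0 : ℝ),
      ENNReal.ofReal (1 / (Real.exp (β * (e - μ)) - 1)) ∂idsMeasure lam
      = ∫⁻ p, ENNReal.ofReal (bose β μ (levelEnergy p)) ∂levelMeasure lam := by
    intro μ
    change ∫⁻ e in Ici (0 : ℝ), ENNReal.ofReal (bose β μ e) ∂idsMeasure lam = _
    rw [idsMeasure, setLIntegral_map measurableSet_Ici (measurable_bose β μ).ennreal_ofReal
      measurable_levelEnergy]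
    have : levelEnergy ⁻¹' Ici 0 = univ := eq_univ_of_forall fun p => by
      simp only [mem_preimage, mem_Ici, levelEnergy, gapEnergy]
      positivity
    rw [this, Measure.restrict_univ]
  simp_rw [h1]
  refine tendsto_lintegral_filter_of_dominated_convergence
    (fun p => ENNReal.ofReal (bose β 0 (levelEnergy p)))
    (Eventually.of_forall fun μ =>
      ((measurable_bose β μ).comp measurable_levelEnergy).ennreal_ofReal)
    ?_ (criticalDensity_ne_top hlam hβ) ?_
  · filter_upwards [self_mem_nhdsWithin] with μ hμ
    filter_upwards [ae_levelMeasure_pos lam] with p hp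
    exact ENNReal.ofReal_le_ofReal (bose_mono hβ (le_of_lt hμ) (gapEnergy_pos hp _))
  · filter_upwards [ae_levelMeasure_pos lam] with p hp
    exact ENNReal.tendsto_ofReal (tendsto_bose hβ
      (tendsto_nhdsWithin_of_tendsto_nhds tendsto_id) (gapEnergy_pos hp _))

end

end LuttingerSy

namespace LuttingerSy

noncomputable section

/-! ### Sums over the energy levels -/

lemma bose_sub_bose {β μ t E : ℝ} (hβ : 0 < β) (h : μ < E) (ht : 0 ≤ t) :
    bose β μ E - bose β (μ - t) E
      = (Real.exp (β * t) - 1) * (1 + bose β μ E) * bose β (μ - t) E := by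
  have h1 : 0 < Real.exp (β * (E - μ)) - 1 :=
    sub_pos.2 (Real.one_lt_exp_iff.2 (mul_pos hβ (sub_pos.2 h)))
  have h2 : 0 < Real.exp (β * (E - (μ - t))) - 1 :=
    sub_pos.2 (Real.one_lt_exp_iff.2 (mul_pos hβ (by linarith)))
  have h3 : Real.exp (β * (E - (μ - t))) = Real.exp (β * t) * Real.exp (β * (E - μ)) := by
    rw [← Real.exp_add]
    congr 1
    ring
  rw [h3] at h2
  rw [bose, bose, h3]
  generalize Real.exp (β * (E - μ)) = x at h1 h2
  generalize Real.exp (β * t) = c at h2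
  have h4 := h1.ne'
  have h5 := h2.ne'
  have h6 : 1 + 1 / (x - 1) = x / (x - 1) := by
    rw [eq_div_iff h4, add_mul, one_div_mul_cancel h4]
    ring
  rw [h6, div_sub_div _ _ h4 h5, mul_one_div, ← mul_div_assoc (c - 1) x, div_div]
  congr 1
  ring

/-- The conditions `E ≥ e` and `|μ| ≤ e / 2` keep the weights away from their pole, so they converge
uniformly in the energy as `μ → 0`. -/
lemma abs_bose_sub_le {β μ E e : ℝ} (hβ : 0 < β) (he : 0 < e) (hE : e ≤ E) (hμ : |μ| ≤ e / 2) :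
    |bose β μ E - bose β 0 E|
      ≤ (Real.exp (β * |μ|) - 1) * (1 + bose β (e / 2) e) * bose β (e / 2) e := by
  have key : ∀ a t, a ≤ e / 2 → 0 ≤ t → |bose β a E - bose β (a - t) E|
      ≤ (Real.exp (β * t) - 1) * (1 + bose β (e / 2) e) * bose β (e / 2) e := by
    intro a t ha ht
    have hb : ∀ c, c ≤ e / 2 → 0 < bose β c E ∧ bose β c E ≤ bose β (e / 2) e := fun c hc =>
      ⟨bose_pos hβ (by linarith), (bose_mono hβ hc (by linarith)).trans
        (bose_anti hβ (by linarith) hE)⟩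
    have h1 := hb a ha
    have h2 := hb (a - t) (by linarith)
    have h3 : 0 ≤ Real.exp (β * t) - 1 := sub_nonneg.2 (Real.one_le_exp (by positivity))
    rw [bose_sub_bose hβ (by linarith) ht, abs_of_nonneg
      (mul_nonneg (mul_nonneg h3 (by linarith)) h2.1.le)]
    exact mul_le_mul (mul_le_mul_of_nonneg_left (by linarith) h3) h2.2 h2.1.le
      (mul_nonneg h3 (by linarith))
  rcases le_total 0 μ with h | h
  · have := key μ μ (by rwa [abs_of_nonneg h] at hμ) h
    rw [sub_self] at this
    rwa [abs_of_nonneg h]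
  · have := key 0 (-μ) (by linarith) (by linarith)
    rw [zero_sub, neg_neg, abs_sub_comm] at this
    rwa [abs_of_nonpos h]

/-- The bound is linear in `s`, so summed over all gaps the high levels contribute a density of
order `1 / √R`, uniformly in the box. -/
lemma tsum_tail_le {β μ s R : ℝ} (hβ : 0 < β) (hs : 0 < s) (hR : 2 ≤ R) (hμ : μ ≤ 1) :
    ∑' m, ENNReal.ofReal (if R < gapEnergy m s then bose β μ (gapEnergy m s) else 0)
      ≤ ENNReal.ofReal (8 / (β * Real.pi * √(2 * R)) * s) := by
  have hpi := Real.pi_pos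
  have hR0 : 0 < √(2 * R) := Real.sqrt_pos.2 (by linarith)
  set x := √(2 * R) * s / Real.pi with hx
  have hx0 : 0 < x := by positivity
  have hterm : ∀ m : ℕ, (if R < gapEnergy m s then bose β μ (gapEnergy m s) else 0)
      ≤ 4 * s ^ 2 / (β * Real.pi ^ 2) *
        if ⌊x⌋₊ < m + 1 then (((m + 1 : ℕ) : ℝ) ^ 2)⁻¹ else 0 := by
    intro m
    by_cases h : R < gapEnergy m s
    · have h1 : x < (m + 1 : ℕ) := by
        by_contra h2
        rw [not_lt, hx, le_div_iff₀ hpi, mul_comm] at h2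
        push_cast at h2
        exact absurd ((gapEnergy_le_iff hs).2 h2) (not_le.2 h)
      rw [if_pos h, if_pos ((Nat.floor_lt hx0.le).2 h1)]
      refine (bose_le_inv hβ (by linarith)).trans ?_
      -- Here `μ ≤ 1 ≤ R / 2`, so the shift by `μ` costs at most a factor `2`.
      have h3 : β * (gapEnergy m s / 2) ≤ β * (gapEnergy m s - μ) :=
        mul_le_mul_of_nonneg_left (by linarith) hβ.le
      have h4 := gapEnergy_pos hs m
      refine (one_div_le_one_div_of_le (by positivity) h3).trans (le_of_eq ?_)
      rw [gapEnergy]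
      push_cast
      field_simp
      norm_num
    · rw [if_neg h]
      split_ifs <;> positivity
  refine ENNReal.tsum_le_of_sum_range_le fun N => ?_
  have h1 : ∑ m ∈ Finset.range N, (if ⌊x⌋₊ < m + 1 then (((m + 1 : ℕ) : ℝ) ^ 2)⁻¹ else 0)
      ≤ 2 / x := by
    have h2 := Finset.sum_Ico_add' (fun i : ℕ => if ⌊x⌋₊ < i then ((i : ℝ) ^ 2)⁻¹ else 0) 0 N 1
    rw [Nat.Ico_zero_eq_range] at h2
    rw [h2, ← Finset.sum_filter, show (Finset.Ico (0 + 1) (N + 1)).filter (fun i => ⌊x⌋₊ < i)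
      = Finset.Ioo ⌊x⌋₊ (N + 1) by ext i; simp; omega]
    refine (sum_Ioo_inv_sq_le _ _).trans ?_
    exact div_le_div_of_nonneg_left two_pos.le hx0 (Nat.lt_floor_add_one x).le
  calc _ ≤ ∑ m ∈ Finset.range N, ENNReal.ofReal (4 * s ^ 2 / (β * Real.pi ^ 2) *
        if ⌊x⌋₊ < m + 1 then (((m + 1 : ℕ) : ℝ) ^ 2)⁻¹ else 0) :=
        Finset.sum_le_sum fun m _ => ENNReal.ofReal_le_ofReal (hterm m)
    _ = ENNReal.ofReal (4 * s ^ 2 / (β * Real.pi ^ 2) * ∑ m ∈ Finset.range N,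
        if ⌊x⌋₊ < m + 1 then (((m + 1 : ℕ) : ℝ) ^ 2)⁻¹ else 0) := by
        rw [Finset.mul_sum, ENNReal.ofReal_sum_of_nonneg]
        intro m _
        split_ifs <;> positivity
    _ ≤ ENNReal.ofReal (4 * s ^ 2 / (β * Real.pi ^ 2) * (2 / x)) :=
        ENNReal.ofReal_le_ofReal (mul_le_mul_of_nonneg_left h1 (by positivity))
    _ = _ := by
        congr 1
        rw [hx]
        field_simp
        norm_num

/-- A continuous function that vanishes outside `[1/(2R), 2R]` and equals `1` on `[1/R, R]`. -/
def cutoff (R E : ℝ) : ℝ := max 0 (min 1 (min (2 * R * E - 1) (2 - E / R)))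

lemma cutoff_nonneg (R E : ℝ) : 0 ≤ cutoff R E := le_max_left _ _

lemma cutoff_le_one (R E : ℝ) : cutoff R E ≤ 1 := max_le zero_le_one (min_le_left _ _)

lemma continuous_cutoff (R : ℝ) : Continuous (cutoff R) := by
  unfold cutoff
  fun_prop

lemma cutoff_eq_one {R E : ℝ} (hR : 0 < R) (h1 : 1 / R ≤ E) (h2 : E ≤ R) : cutoff R E = 1 := by
  have h3 : 1 ≤ 2 * R * E - 1 := by
    rw [div_le_iff₀ hR] at h1
    linarith
  have h4 : 1 ≤ 2 - E / R := by
    have := (div_le_one hR).2 h2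
    linarith
  rw [cutoff, min_eq_left (le_min h3 h4), max_eq_right zero_le_one]

lemma cutoff_eq_zero_of_le {R E : ℝ} (hR : 0 < R) (h : E ≤ 1 / (2 * R)) : cutoff R E = 0 := by
  rw [le_div_iff₀ (by positivity)] at h
  exact max_eq_left ((min_le_right _ _).trans ((min_le_left _ _).trans (by linarith)))

lemma cutoff_eq_zero_of_ge {R E : ℝ} (hR : 0 < R) (h : 2 * R ≤ E) : cutoff R E = 0 := by
  have := (le_div_iff₀ hR).2 h
  exact max_eq_left ((min_le_right _ _).trans ((min_le_right _ _).trans (by linarith)))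

/-- The number of levels of energy at most `e` in a gap of length `s`. -/
def levelCount (e s : ℝ) : ℕ := ⌊√(2 * e) * s / Real.pi⌋₊

lemma lt_levelCount_iff {e s : ℝ} (hs : 0 < s) {m : ℕ} :
    m < levelCount e s ↔ gapEnergy m s ≤ e := by
  rw [gapEnergy_le_iff hs, levelCount, ← Nat.succ_le_iff, Nat.le_floor_iff' (Nat.succ_ne_zero m),
    le_div_iff₀ Real.pi_pos, mul_comm Real.pi]
  push_cast
  rfl

lemma levelCount_le {e s : ℝ} (hs : 0 ≤ s) : (levelCount e s : ℝ) ≤ √(2 * e) / Real.pi * s := by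
  refine (Nat.floor_le (by positivity)).trans (le_of_eq ?_)
  ring

lemma tsum_ofReal_eq_sum_levelCount {e s : ℝ} (hs : 0 < s) {f : ℕ → ℝ} (h0 : ∀ m, 0 ≤ f m)
    (h : ∀ m, e ≤ gapEnergy m s → f m = 0) :
    ∑' m, ENNReal.ofReal (f m)
      = ENNReal.ofReal (∑ m ∈ Finset.range (levelCount e s), f m) := by
  rw [ENNReal.ofReal_sum_of_nonneg fun m _ => h0 m]
  refine tsum_eq_sum fun m hm => ?_
  rw [Finset.mem_range, lt_levelCount_iff hs, not_le] at hm
  rw [h m hm.le, ENNReal.ofReal_zero]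

variable {lam : ℝ} {X : Set ℝ}

/-- Although the number of levels jumps with `s`, the sum is continuous: a level enters at energy
`e`, where its term vanishes. Short gaps have no level below `e`, and the number of levels is at
most linear in `s`. -/
lemma HasGapLaw.levels (hlam : 0 < lam) (h : HasGapLaw lam X) {e C : ℝ} (he : 0 < e)
    {f : ℕ → ℝ → ℝ} (hf : ∀ m, ContinuousOn (f m) (Ioi 0)) (hC : ∀ m s, 0 < s → |f m s| ≤ C)
    (h0 : ∀ m s, 0 < s → e ≤ gapEnergy m s → f m s = 0) :
    IsGapLimit lam X fun s => ∑ m ∈ Finset.range (levelCount e s), f m s := by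
  have hC0 : 0 ≤ C := (abs_nonneg _).trans (hC 0 1 one_pos)
  have he' : 0 < √(2 * e) := Real.sqrt_pos.2 (by positivity)
  have hpi := Real.pi_pos
  refine h.of_continuousOn hlam (c := Real.pi / √(2 * e)) (C := C * (√(2 * e) / Real.pi))
    (by positivity) (fun s hs => ContinuousAt.continuousWithinAt ?_) (fun s hs hsc => ?_)
    fun s hs => ?_
  · rw [mem_Ioi] at hs
    -- Near `s` the range may be enlarged to the fixed number of levels at `s + 1`, since the extra
    -- terms are zero.
    have h1 : ContinuousAt (fun t => ∑ m ∈ Finset.range (levelCount e (s + 1)), f m t) s :=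
      tendsto_finsetSum _ fun m _ => (hf m).continuousAt (Ioi_mem_nhds hs)
    refine h1.congr ?_
    filter_upwards [Ioi_mem_nhds hs, Iio_mem_nhds (lt_add_one s)] with t ht0 ht1
    rw [mem_Ioi] at ht0
    rw [mem_Iio] at ht1
    refine (Finset.sum_subset (Finset.range_mono (Nat.floor_le_floor ?_)) fun m _ hm => ?_).symm
    · gcongr
    · refine h0 m t ht0 (le_of_not_ge fun hE => hm ?_)
      exact Finset.mem_range.2 ((lt_levelCount_iff ht0).2 hE)
  · have : levelCount e s = 0 := by
      rw [levelCount, Nat.floor_eq_zero, div_lt_one hpi, mul_comm]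
      exact (lt_div_iff₀ he').1 hsc
    rw [this, Finset.range_zero, Finset.sum_empty]
  · refine (Finset.abs_sum_le_sum_abs _ _).trans
      ((Finset.sum_le_sum fun m _ => hC m s hs).trans ?_)
    rw [Finset.sum_const, Finset.card_range, nsmul_eq_mul, mul_comm, mul_assoc]
    exact mul_le_mul_of_nonneg_left (levelCount_le hs.le) hC0

lemma lintegral_levels {e : ℝ} {f : ℕ → ℝ → ℝ} (hm : ∀ m, Measurable (f m))
    (hint : Integrable (fun s => ∑ m ∈ Finset.range (levelCount e s), f m s) (gapMeasure lam))
    (hnn : ∀ m s, 0 < s → 0 ≤ f m s) (h0 : ∀ m s, 0 < s → e ≤ gapEnergy m s → f m s = 0) :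
    ∫⁻ p, ENNReal.ofReal (f p.2 p.1) ∂levelMeasure lam = ENNReal.ofReal
      (∫ s, ∑ m ∈ Finset.range (levelCount e s), f m s ∂gapMeasure lam) := by
  rw [lintegral_levelMeasure lam (f := fun p => ENNReal.ofReal (f p.2 p.1))
    (measurable_from_prod_countable_left fun m => (hm m).ennreal_ofReal),
    ofReal_integral_eq_lintegral_ofReal hint]
  · refine lintegral_congr_ae ?_
    filter_upwards [ae_gapMeasure_pos lam] with s hs
    exact tsum_ofReal_eq_sum_levelCount hs (fun m => hnn m s hs) fun m => h0 m s hs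
  · filter_upwards [ae_gapMeasure_pos lam] with s hs
    exact Finset.sum_nonneg fun m _ => hnn m s hs

/-! ### Convergence of the chemical potential -/

/-- The ordered eigenvalues and the gap energies agree with multiplicity, so no gap level lies below
the first eigenvalue. -/
lemma Gaps.lt_gapEnergy {l : ℝ} (G : Gaps l X) (hX : (X ∩ box l).Finite) (φ : Eigenbasis l X)
    {μ : ℝ} (hμ : μ < φ.energy 0) {a : ℝ} (ha : a ∈ G.lefts) (m : ℕ) :
    μ < gapEnergy m (G.len a) := by
  by_contra hle
  have h := G.tsum_energy hX φ ((Iic μ).indicator 1)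
  have h1 : ∑' i, (Iic μ).indicator (1 : ℝ → ℝ≥0∞) (φ.energy i) = 0 :=
    ENNReal.tsum_eq_zero.2 fun i => indicator_of_notMem (show φ.energy i ∉ Iic μ from
      not_le.2 (hμ.trans_le (φ.energy_mono (Nat.zero_le i)))) _
  rw [h1, eq_comm, Finset.sum_eq_zero_iff] at h
  have h2 := ENNReal.tsum_eq_zero.1 (h a ha) m
  rw [indicator_of_mem (show gapEnergy m (G.len a) ∈ Iic μ from not_lt.1 hle)] at h2
  exact one_ne_zero h2

lemma Gaps.tsum_bose {l : ℝ} (hl : 0 < l) (G : Gaps l X) (hX : (X ∩ box l).Finite)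
    (φ : Eigenbasis l X) {β ρ μ : ℝ} (hβ : 0 < β) (hρ : 0 < ρ)
    (h : IsChemicalPotential φ β ρ μ) :
    ∑ a ∈ G.lefts, ∑' m, ENNReal.ofReal (bose β μ (gapEnergy m (G.len a)))
      = ENNReal.ofReal (ρ * l) := by
  obtain ⟨h1, h2⟩ := (isChemicalPotential_iff hl hX φ hβ hρ).1 h
  rw [← G.tsum_energy hX φ fun e => ENNReal.ofReal (bose β μ e), ← h2,
    ENNReal.ofReal_tsum_of_nonneg (fun i => (bose_pos hβ
      (h1.trans_le (φ.energy_mono (Nat.zero_le i)))).le) (summable_bose hl hX φ hβ h1)]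

lemma HasGapLaw.eventually_exists_len (h : HasGapLaw lam X) (G : GapsFamily X) {s : ℝ}
    (hs : 0 ≤ s) : ∀ᶠ l in atTop, ∃ a ∈ (G l).lefts, s < (G l).len a := by
  filter_upwards [(h.2 G s hs).eventually (lt_mem_nhds (Real.exp_pos _))] with l hl
  by_contra hcon
  push Not at hcon
  have : (G l).sum (fun L => max (L - s) 0) = 0 :=
    Finset.sum_eq_zero fun a ha => max_eq_right (sub_nonpos.2 (hcon a ha))
  rw [this, zero_div] at hl
  exact lt_irrefl _ hl

/-- The limit `exp (-λ s)` is positive, so arbitrarily long gaps eventually occur, and their lowest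
levels have small energy. -/
lemma HasGapLaw.eventually_energy_le (h : HasGapLaw lam X) (φ : EigenbasisFamily X) {ε : ℝ}
    (hε : 0 < ε) : ∀ᶠ l in atTop, (φ l).energy 0 ≤ ε := by
  obtain ⟨G⟩ := h.nonempty_gapsFamily
  have hpos : 0 < √(2 * ε) := Real.sqrt_pos.2 (by positivity)
  filter_upwards [h.eventually_exists_len G (s := Real.pi / √(2 * ε))
    (div_nonneg Real.pi_pos.le hpos.le)] with l hl
  obtain ⟨a, ha, hs⟩ := hl
  by_contra hcon
  have h1 := (G l).lt_gapEnergy (h.finite_inter_box l) (φ l) (not_le.1 hcon) ha 0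
  refine absurd ((gapEnergy_le_iff ((G l).len_pos ha)).2 ?_) (not_le.2 h1)
  rw [div_lt_iff₀ hpos] at hs
  push_cast
  linarith

lemma continuousOn_gapEnergy (m : ℕ) : ContinuousOn (gapEnergy m) (Ioi 0) := by
  unfold gapEnergy
  refine continuousOn_const.div (by fun_prop) fun s hs => ?_
  have : (0 : ℝ) < s := hs
  positivity

lemma continuousOn_cutoff_mul_bose {β μ : ℝ} (hβ : 0 < β) (hμ : μ ≤ 0) (R : ℝ) (m : ℕ) :
    ContinuousOn (fun s => cutoff R (gapEnergy m s) * bose β μ (gapEnergy m s)) (Ioi 0) := by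
  refine ((continuous_cutoff R).comp_continuousOn (continuousOn_gapEnergy m)).mul ?_
  refine continuousOn_const.div ?_ fun s hs => ?_
  · have := continuousOn_gapEnergy m
    fun_prop
  · have := gapEnergy_pos (mem_Ioi.1 hs) m
    exact (sub_pos.2 (Real.one_lt_exp_iff.2 (mul_pos hβ (by linarith)))).ne'

lemma cutoff_mul_bose_le {β μ R E : ℝ} (hβ : 0 < β) (hR : 0 < R) (hμ : μ ≤ 1 / (2 * R) / 2)
    (hE : μ < E) :
    cutoff R E * bose β μ E ≤ bose β (1 / (2 * R) / 2) (1 / (2 * R)) := by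
  have he : 0 < 1 / (2 * R) := by positivity
  have hpos : 0 < bose β (1 / (2 * R) / 2) (1 / (2 * R)) := bose_pos hβ (by linarith)
  rcases le_total E (1 / (2 * R)) with h | h
  · rw [cutoff_eq_zero_of_le hR h, zero_mul]
    exact hpos.le
  · calc cutoff R E * bose β μ E ≤ 1 * bose β μ E :=
          mul_le_mul_of_nonneg_right (cutoff_le_one _ _) (bose_pos hβ hE).le
      _ ≤ _ := by
          rw [one_mul]
          exact (bose_mono hβ hμ (by linarith)).trans (bose_anti hβ (by linarith) h)

/-- If `μ ≤ -τ`, the density is at most the one at `-τ`. There the weights are bounded by `D`, so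
low levels are negligible because they are few, high levels by the tail bound, and the remaining
part converges to at most `ρc`. -/
lemma HasGapLaw.eventually_lt_chemicalPotential (hlam : 0 < lam) (h : HasGapLaw lam X) {β ρ : ℝ}
    (hβ : 0 < β) (hρ : (criticalDensity lam β).toReal < ρ) (φ : EigenbasisFamily X)
    {μ : Ici (1 : ℝ) → ℝ} (hμ : ∀ l, IsChemicalPotential (φ l) β ρ (μ l)) {τ : ℝ} (hτ : 0 < τ) :
    ∀ᶠ l in atTop, -τ < μ l := by
  obtain ⟨G⟩ := h.nonempty_gapsFamily
  have hpi := Real.pi_pos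
  have hρ0 : 0 < ρ := ENNReal.toReal_nonneg.trans_lt hρ
  -- One `η` is spent on convergence and one on the discarded levels; the third leaves the
  -- contradiction strict.
  set η := (ρ - (criticalDensity lam β).toReal) / 3 with hη
  have hη0 : 0 < η := by
    rw [hη]
    linarith
  set D := bose β (-τ) 0 with hD
  have hD0 : 0 < D := bose_pos hβ (by linarith)
  obtain ⟨R, hR2, hR⟩ : ∃ R : ℝ, 2 ≤ R ∧
      D * (√(2 * (1 / R)) / Real.pi) + 8 / (β * Real.pi * √(2 * R)) ≤ η := by
    have h1 : Tendsto (fun R : ℝ => √(2 * (1 / R))) atTop (𝓝 0) := by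
      have : Tendsto (fun R : ℝ => 2 * (1 / R)) atTop (𝓝 0) := by
        simpa using (tendsto_inv_atTop_zero (𝕜 := ℝ)).const_mul 2
      have h := (Real.continuous_sqrt.tendsto 0).comp this
      rw [Real.sqrt_zero] at h
      exact h
    have h2 : Tendsto (fun R : ℝ => 8 / (β * Real.pi * √(2 * R))) atTop (𝓝 0) :=
      tendsto_const_nhds.div_atTop ((Real.tendsto_sqrt_atTop.comp
        (tendsto_id.const_mul_atTop two_pos)).const_mul_atTop (by positivity))
    have h3 := ((h1.div_const Real.pi).const_mul D).add h2
    rw [zero_div, mul_zero, add_zero] at h3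
    obtain ⟨R, hR1, hR2⟩ := ((eventually_ge_atTop (2 : ℝ)).and
      (h3.eventually (ge_mem_nhds hη0))).exists
    exact ⟨R, hR1, hR2⟩
  have hR0 : 0 < R := by linarith
  set f : ℕ → ℝ → ℝ := fun m s => cutoff R (gapEnergy m s) * bose β (-τ) (gapEnergy m s) with hf
  have hfnn : ∀ m s, 0 < s → 0 ≤ f m s := fun m s hs => mul_nonneg (cutoff_nonneg _ _)
    (bose_pos hβ (by linarith [gapEnergy_pos hs m])).le
  have hf0 : ∀ m s, 0 < s → 2 * R ≤ gapEnergy m s → f m s = 0 := fun m s _ hE => by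
    simp only [hf]
    rw [cutoff_eq_zero_of_ge hR0 hE, zero_mul]
  have hlim := h.levels hlam (e := 2 * R) (C := bose β (1 / (2 * R) / 2) (1 / (2 * R)))
    (by positivity) (fun m => continuousOn_cutoff_mul_bose hβ (by linarith) R m) (fun m s hs => by
      rw [abs_of_nonneg (hfnn m s hs)]
      exact cutoff_mul_bose_le hβ hR0
        ((neg_neg_of_pos hτ).le.trans (by positivity)) (by linarith [gapEnergy_pos hs m])) hf0
  have hval : ∫ s, ∑ m ∈ Finset.range (levelCount (2 * R) s), f m s ∂gapMeasure lam
      ≤ (criticalDensity lam β).toReal := by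
    refine (ENNReal.ofReal_le_iff_le_toReal (criticalDensity_ne_top hlam hβ)).1 ?_
    rw [← lintegral_levels (fun m => ?_) hlim.1 hfnn hf0]
    · refine lintegral_mono_ae ?_
      filter_upwards [ae_levelMeasure_pos lam] with p hp
      refine ENNReal.ofReal_le_ofReal ?_
      have hE := gapEnergy_pos hp p.2
      calc f p.2 p.1 ≤ 1 * bose β (-τ) (gapEnergy p.2 p.1) :=
            mul_le_mul_of_nonneg_right (cutoff_le_one _ _) (bose_pos hβ (by linarith)).le
        _ ≤ _ := by
            rw [one_mul]
            exact bose_mono hβ (by linarith) hE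
    · exact ((continuous_cutoff R).measurable.comp (measurable_gapEnergy m)).mul
        ((measurable_bose β (-τ)).comp (measurable_gapEnergy m))
  filter_upwards [(hlim.2 G).eventually (gt_mem_nhds (lt_of_le_of_lt hval
    (show _ < (criticalDensity lam β).toReal + η by linarith)))] with l hl
  by_contra hcon
  rw [not_lt] at hcon
  have hl0 := Ici_one_pos l
  have hgap : ∀ a ∈ (G l).lefts,
      ∑' m, ENNReal.ofReal (bose β (μ l) (gapEnergy m ((G l).len a)))
        ≤ ENNReal.ofReal (∑ m ∈ Finset.range (levelCount (2 * R) ((G l).len a)),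
          f m ((G l).len a) + η * (G l).len a) := by
    intro a ha
    have hs := (G l).len_pos ha
    set s := (G l).len a with hsdef
    have hterm : ∀ m, ENNReal.ofReal (bose β (μ l) (gapEnergy m s)) ≤ ENNReal.ofReal (f m s)
        + ENNReal.ofReal (if gapEnergy m s ≤ 1 / R then D else 0)
        + ENNReal.ofReal (if R < gapEnergy m s then bose β (-τ) (gapEnergy m s) else 0) := by
      intro m
      have hE := gapEnergy_pos hs m
      have hb := bose_pos hβ (show -τ < gapEnergy m s by linarith)
      have hle : bose β (μ l) (gapEnergy m s) ≤ bose β (-τ) (gapEnergy m s) :=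
        bose_mono hβ hcon (by linarith)
      rw [← ENNReal.ofReal_add (hfnn m s hs) (by split_ifs <;> positivity),
        ← ENNReal.ofReal_add (add_nonneg (hfnn m s hs) (by split_ifs <;> positivity))
          (by split_ifs <;> positivity)]
      refine ENNReal.ofReal_le_ofReal (hle.trans ?_)
      have h0 := hfnn m s hs
      by_cases h1 : gapEnergy m s ≤ 1 / R
      · rw [if_pos h1]
        have : bose β (-τ) (gapEnergy m s) ≤ D := bose_anti hβ (by linarith) hE.le
        split_ifs <;> linarith
      · by_cases h2 : R < gapEnergy m s
        · rw [if_neg h1, if_pos h2]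
          linarith
        · rw [if_neg h1, if_neg h2]
          simp only [hf]
          rw [cutoff_eq_one hR0 (not_le.1 h1).le (not_lt.1 h2)]
          linarith
    refine (ENNReal.tsum_le_tsum hterm).trans ?_
    rw [ENNReal.tsum_add, ENNReal.tsum_add, tsum_ofReal_eq_sum_levelCount hs
      (fun m => hfnn m s hs) fun m => hf0 m s hs]
    have h2 : ∑' m, ENNReal.ofReal (if gapEnergy m s ≤ 1 / R then D else 0)
        ≤ ENNReal.ofReal (D * (√(2 * (1 / R)) / Real.pi) * s) := by
      have : ∀ m, ENNReal.ofReal (if gapEnergy m s ≤ 1 / R then D else 0)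
          = ENNReal.ofReal D * (Iic (1 / R)).indicator (1 : ℝ → ℝ≥0∞) (gapEnergy m s) := by
        intro m
        by_cases h : gapEnergy m s ≤ 1 / R
        · rw [if_pos h, indicator_of_mem (show gapEnergy m s ∈ Iic (1 / R) from h),
            Pi.one_apply, mul_one]
        · rw [if_neg h, indicator_of_notMem (show gapEnergy m s ∉ Iic (1 / R) from h),
            mul_zero, ENNReal.ofReal_zero]
      simp_rw [this]
      rw [ENNReal.tsum_mul_left, tsum_indicator_gapEnergy hs, ← ENNReal.ofReal_natCast,
        ← ENNReal.ofReal_mul hD0.le, mul_assoc]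
      exact ENNReal.ofReal_le_ofReal (mul_le_mul_of_nonneg_left (levelCount_le hs.le) hD0.le)
    refine (add_le_add (add_le_add_right h2 _)
      (tsum_tail_le hβ hs hR2 (by linarith))).trans ?_
    have h3 : 0 ≤ ∑ m ∈ Finset.range (levelCount (2 * R) s), f m s :=
      Finset.sum_nonneg fun m _ => hfnn m s hs
    rw [← ENNReal.ofReal_add h3 (by positivity), ← ENNReal.ofReal_add (by positivity)
      (by positivity)]
    refine ENNReal.ofReal_le_ofReal ?_
    nlinarith
  have hsum := (G l).tsum_bose hl0 (h.finite_inter_box l) (φ l) hβ hρ0 (hμ l)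
  have hnn : ∀ a ∈ (G l).lefts, 0 ≤ ∑ m ∈ Finset.range (levelCount (2 * R) ((G l).len a)),
      f m ((G l).len a) + η * (G l).len a := fun a ha => add_nonneg
    (Finset.sum_nonneg fun m _ => hfnn m _ ((G l).len_pos ha))
    (mul_nonneg hη0.le ((G l).len_pos ha).le)
  have h4 := hsum.symm.trans_le (Finset.sum_le_sum hgap)
  rw [← ENNReal.ofReal_sum_of_nonneg hnn, ENNReal.ofReal_le_ofReal_iff (Finset.sum_nonneg hnn),
    Finset.sum_add_distrib, ← Finset.mul_sum] at h4
  have h5 : ∑ a ∈ (G l).lefts, (G l).len a = l := (G l).sum_len hl0 (h.finite_inter_box l)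
  rw [h5] at h4
  rw [div_lt_iff₀ hl0, Gaps.sum] at hl
  have h6 : ρ = (criticalDensity lam β).toReal + 3 * η := by
    rw [hη]
    ring
  nlinarith

lemma HasGapLaw.tendsto_chemicalPotential (hlam : 0 < lam) (h : HasGapLaw lam X) {β ρ : ℝ}
    (hβ : 0 < β) (hρ : (criticalDensity lam β).toReal < ρ) (φ : EigenbasisFamily X)
    {μ : Ici (1 : ℝ) → ℝ} (hμ : ∀ l, IsChemicalPotential (φ l) β ρ (μ l)) :
    Tendsto μ atTop (𝓝 0) := by
  rw [Metric.tendsto_nhds]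
  intro ε hε
  filter_upwards [h.eventually_lt_chemicalPotential hlam hβ hρ φ hμ hε,
    h.eventually_energy_le φ (half_pos hε)] with l h1 h2
  have h3 := ((isChemicalPotential_iff (Ici_one_pos l) (h.finite_inter_box l) (φ l) hβ
    (ENNReal.toReal_nonneg.trans_lt hρ)).1 (hμ l)).1
  rw [Real.dist_eq, sub_zero, abs_lt]
  constructor <;> linarith

end

end LuttingerSy

namespace LuttingerSy

noncomputable section

/-! ### Occupation of the kinetic-energy eigenstates -/

variable {l : ℝ} {X : Set ℝ}

lemma EigenSystem.tsum_tsum_comm {Y : Set ℝ} {ι κ : Type*} (S : EigenSystem l X ι)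
    (T : EigenSystem l Y κ) (g f : ℝ → ℝ≥0∞) :
    ∑' i, g (S.energy i) *
        ∑' k, f (T.energy k) * ENNReal.ofReal (‖(inner ℂ (T.vec k) (S.vec i) : ℂ)‖ ^ 2)
      = ∑' k, f (T.energy k) *
        ∑' i, g (S.energy i) * ENNReal.ofReal (‖(inner ℂ (S.vec i) (T.vec k) : ℂ)‖ ^ 2) := by
  simp_rw [← ENNReal.tsum_mul_left]
  rw [ENNReal.tsum_comm]
  refine tsum_congr fun k => tsum_congr fun i => ?_
  rw [norm_inner_symm, mul_left_comm]

/-- The probability that a particle in the level `m` of a gap has kinetic energy at most `δ`. -/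
def kineticProb (l b s δ : ℝ) (m : ℕ) : ℝ :=
  ∑ k ∈ Finset.range (levelCount δ l), overlap l b s m k ^ 2

lemma kineticProb_nonneg (l b s δ : ℝ) (m : ℕ) : 0 ≤ kineticProb l b s δ m :=
  Finset.sum_nonneg fun _ _ => sq_nonneg _

namespace Gaps

variable (G : Gaps l X)

lemma norm_inner_boxVec {a : ℝ} (ha : a ∈ G.lefts) (m k : ℕ) :
    ‖(inner ℂ (boxVec l k) (G.vec (⟨a, ha⟩, m)) : ℂ)‖ ^ 2
      = overlap l (a + l / 2) (G.len a) m k ^ 2 := by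
  rw [norm_inner_symm, vec, inner_piece_boxVec (G.le_left a ha) (G.lt_right a ha)
    (G.right_le a ha), Complex.norm_real, Real.norm_eq_abs, sq_abs]
  rfl

lemma kineticProb_le_one {a : ℝ} (ha : a ∈ G.lefts) (δ : ℝ) (m : ℕ) :
    kineticProb l (a + l / 2) (G.len a) δ m ≤ 1 :=
  sum_overlap_sq_le_one (G.le_left a ha) (G.lt_right a ha) (G.right_le a ha) m _

lemma tsum_index_dep (f : ∀ a ∈ G.lefts, ℕ → ℝ≥0∞) (g : ℝ → ℕ → ℝ≥0∞)
    (h : ∀ a ha m, f a ha m = g a m) :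
    ∑' i : G.Index, f i.1 i.1.2 i.2 = ∑ a ∈ G.lefts, ∑' m, g a m := by
  rw [← G.tsum_index g]
  exact tsum_congr fun i => h _ _ _

/-- By Tonelli and independence of the eigenbasis, `φ` and `ψ` may be exchanged for the explicit
sine functions of the gaps and of the box. -/
lemma kineticOccupation_eq (hl : 0 < l) (hX : (X ∩ box l).Finite) (φ : Eigenbasis l X)
    (ψ : Eigenbasis l ∅) {β μ : ℝ} (hβ : 0 < β) (h : fockTrace (gibbsOp φ β μ) ≠ ⊤) (δ : ℝ) :
    kineticOccupation φ ψ β μ δ = (∑ a ∈ G.lefts, ∑' m,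
      ENNReal.ofReal (bose β μ (gapEnergy m (G.len a))) *
        ENNReal.ofReal (kineticProb l (a + l / 2) (G.len a) δ m)) / ENNReal.ofReal l := by
  set n : ℝ → ℝ≥0∞ := fun e => ENNReal.ofReal (bose β μ e) with hn
  set f : ℝ → ℝ≥0∞ := (Iic δ).indicator 1 with hf
  have hf1 : ∀ k, f (gapEnergy k l) = if k < levelCount δ l then 1 else 0 := by
    intro k
    simp only [hf, indicator, mem_Iic, lt_levelCount_iff hl, Pi.one_apply]
  rw [kineticOccupation]
  congr 1
  have h1 : ∑' k : {k : ℕ // ψ.energy k ≤ δ}, meanNumber φ β μ (ψ.vec k)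
      = ∑' k, f (ψ.energy k) *
        ∑' i, n (φ.energy i) * ENNReal.ofReal (‖(inner ℂ (φ.vec i) (ψ.vec k) : ℂ)‖ ^ 2) := by
    refine (tsum_subtype {k | ψ.energy k ≤ δ} fun k => meanNumber φ β μ (ψ.vec k)).trans ?_
    refine tsum_congr fun k => ?_
    by_cases hk : ψ.energy k ≤ δ
    · rw [indicator_of_mem (show k ∈ {k | ψ.energy k ≤ δ} from hk), hf,
        indicator_of_mem (show ψ.energy k ∈ Iic δ from hk), Pi.one_apply, one_mul,
        meanNumber_eq φ hβ h]
    · rw [indicator_of_notMem (show k ∉ {k | ψ.energy k ≤ δ} from hk), hf,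
        indicator_of_notMem (show ψ.energy k ∉ Iic δ from hk), zero_mul]
  have h2 : ∀ k, ∑' i, n (φ.energy i) * ENNReal.ofReal (‖(inner ℂ (φ.vec i) (ψ.vec k) : ℂ)‖ ^ 2)
      = ∑' i, n ((G.system hX).energy i) *
        ENNReal.ofReal (‖(inner ℂ ((G.system hX).vec i) (ψ.toSystem.vec k) : ℂ)‖ ^ 2) := fun k =>
    φ.toSystem.tsum_sq_inner_eq (G.system hX) n (ψ.vec k)
  simp_rw [h1, h2]
  refine ((G.system hX).tsum_tsum_comm ψ.toSystem n f).symm.trans ?_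
  refine G.tsum_index_dep (fun a ha m => n (gapEnergy m (G.len a)) *
    ∑' k, f (ψ.toSystem.energy k) * ENNReal.ofReal
      (‖(inner ℂ (ψ.toSystem.vec k) ((G.system hX).vec (⟨a, ha⟩, m)) : ℂ)‖ ^ 2)) _ fun a ha m => ?_
  congr 1
  rw [ψ.toSystem.tsum_sq_inner_eq (boxSystem hl) f, tsum_boxSystem hl, kineticProb,
    ENNReal.ofReal_sum_of_nonneg fun _ _ => sq_nonneg _, tsum_eq_sum
    (s := Finset.range (levelCount δ l))]
  · refine Finset.sum_congr rfl fun k hk => ?_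
    rw [hf1, if_pos (Finset.mem_range.1 hk), one_mul, system_vec, norm_inner_boxVec]
  · intro k hk
    rw [hf1, if_neg fun h => hk (Finset.mem_range.2 h), zero_mul]

/-- The kinetic spectrum is simple. In the sum over the energy of `ψ.vec k` at most one box sine
survives, and its overlap is bounded. -/
lemma sq_inner_eigenvector_le (hl : 0 < l) (ψ : Eigenbasis l ∅) (k : ℕ) {a : ℝ}
    (ha : a ∈ G.lefts) (m : ℕ) :
    ENNReal.ofReal (‖(inner ℂ (G.vec (⟨a, ha⟩, m)) (ψ.vec k) : ℂ)‖ ^ 2)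
      ≤ ENNReal.ofReal (4 * G.len a / l) := by
  set f : ℝ → ℝ≥0∞ := ({ψ.energy k} : Set ℝ).indicator 1 with hf
  have h1 : ENNReal.ofReal (‖(inner ℂ (G.vec (⟨a, ha⟩, m)) (ψ.vec k) : ℂ)‖ ^ 2)
      ≤ ∑' j, f (ψ.toSystem.energy j) * ENNReal.ofReal
        (‖(inner ℂ (ψ.toSystem.vec j) (G.vec (⟨a, ha⟩, m)) : ℂ)‖ ^ 2) := by
    refine le_trans (le_of_eq ?_) (ENNReal.le_tsum k)
    rw [hf, indicator_of_mem (show ψ.toSystem.energy k ∈ ({ψ.energy k} : Set ℝ) from rfl),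
      Pi.one_apply, one_mul, norm_inner_symm]
    rfl
  refine h1.trans ?_
  rw [ψ.toSystem.tsum_sq_inner_eq (boxSystem hl) f, tsum_boxSystem hl]
  by_cases hex : ∃ j, gapEnergy j l = ψ.energy k
  · obtain ⟨j, hj⟩ := hex
    rw [tsum_eq_single j, hf,
      indicator_of_mem (show gapEnergy j l ∈ ({ψ.energy k} : Set ℝ) from hj),
      Pi.one_apply, one_mul, norm_inner_boxVec]
    · exact ENNReal.ofReal_le_ofReal (overlap_sq_le hl (G.len_pos ha).le _ _ _)
    · intro j' hj'
      rw [hf, indicator_of_notMem, zero_mul]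
      exact fun h => hj' (gapEnergy_injective hl (h.trans hj.symm))
  · rw [ENNReal.tsum_eq_zero.2]
    · exact zero_le
    · intro j
      rw [hf, indicator_of_notMem, zero_mul]
      exact fun h => hex ⟨j, h⟩

lemma meanNumber_le (hl : 0 < l) (hX : (X ∩ box l).Finite) (φ : Eigenbasis l X)
    (ψ : Eigenbasis l ∅) {β ρ μ M : ℝ} (hβ : 0 < β) (hρ : 0 < ρ)
    (h : IsChemicalPotential φ β ρ μ) (hM : ∀ a ∈ G.lefts, G.len a ≤ M) (k : ℕ) :
    meanNumber φ β μ (ψ.vec k) ≤ ENNReal.ofReal (4 * M / l) * ENNReal.ofReal (ρ * l) := by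
  rw [meanNumber_eq φ hβ h.1, ← G.tsum_bose hl hX φ hβ hρ h,
    show ∑' i, ENNReal.ofReal (bose β μ (φ.energy i)) *
      ENNReal.ofReal (‖(inner ℂ (φ.vec i) (ψ.vec k) : ℂ)‖ ^ 2) = _ from
    φ.toSystem.tsum_sq_inner_eq (G.system hX) (fun e => ENNReal.ofReal (bose β μ e)) (ψ.vec k),
    ← G.tsum_index fun a m => ENNReal.ofReal (bose β μ (gapEnergy m (G.len a))),
    ← ENNReal.tsum_mul_left]
  refine ENNReal.tsum_le_tsum fun i => ?_
  rw [mul_comm (ENNReal.ofReal (4 * M / l))]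
  refine mul_le_mul_right ?_ _
  rw [system_vec]
  refine (G.sq_inner_eigenvector_le hl ψ k i.1.2 i.2).trans (ENNReal.ofReal_le_ofReal ?_)
  have := hM _ i.1.2
  gcongr

end Gaps

variable {lam : ℝ}

/-- A single gap is at most `s` plus the whole hinge sum, which is about `exp (-λ s) l`. Choose `s`
large first, then `l`. -/
lemma HasGapLaw.eventually_len_le (hlam : 0 < lam) (h : HasGapLaw lam X) (G : GapsFamily X)
    {η : ℝ} (hη : 0 < η) : ∀ᶠ l in atTop, ∀ a ∈ (G l).lefts, (G l).len a ≤ η * l := by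
  obtain ⟨s, hs0, hs⟩ : ∃ s : ℝ, 0 ≤ s ∧ Real.exp (-(lam * s)) < η / 2 := by
    have h2 := Real.tendsto_exp_neg_atTop_nhds_zero.comp (tendsto_id.const_mul_atTop hlam)
    obtain ⟨s, h3, h4⟩ := ((eventually_ge_atTop (0 : ℝ)).and
      (h2.eventually (gt_mem_nhds (half_pos hη)))).exists
    exact ⟨s, h3, h4⟩
  filter_upwards [(h.2 G s hs0).eventually (gt_mem_nhds hs),
    tendsto_coe_Ici.eventually (eventually_ge_atTop (2 * s / η))] with l h1 h2 a ha
  rw [div_lt_iff₀ (Ici_one_pos l)] at h1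
  rw [div_le_iff₀ hη] at h2
  have h3 : max ((G l).len a - s) 0 ≤ (G l).sum fun L => max (L - s) 0 :=
    Finset.single_le_sum (f := fun a => max ((G l).len a - s) 0) (fun _ _ => le_max_right _ _) ha
  have h4 := le_max_left ((G l).len a - s) 0
  linarith

/-- No kinetic-energy eigenstate is macroscopically occupied. -/
lemma HasGapLaw.tendsto_meanNumber (hlam : 0 < lam) (h : HasGapLaw lam X) {β ρ : ℝ} (hβ : 0 < β)
    (hρ : 0 < ρ) (φ : EigenbasisFamily X) (ψ : EigenbasisFamily ∅) {μ : Ici (1 : ℝ) → ℝ}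
    (hμ : ∀ l, IsChemicalPotential (φ l) β ρ (μ l)) (k : Ici (1 : ℝ) → ℕ) :
    Tendsto (fun l : Ici (1 : ℝ) =>
      meanNumber (φ l) β (μ l) ((ψ l).vec (k l)) / ENNReal.ofReal l) atTop (𝓝 0) := by
  obtain ⟨G⟩ := h.nonempty_gapsFamily
  rw [ENNReal.tendsto_nhds_zero]
  intro ε hε
  obtain ⟨η, hη, hηε⟩ : ∃ η : ℝ, 0 < η ∧ ENNReal.ofReal (4 * η * ρ) ≤ ε := by
    obtain ⟨r, hr0, hr⟩ := ENNReal.lt_iff_exists_nnreal_btwn.1 hε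
    refine ⟨r / (4 * ρ), div_pos (by exact_mod_cast hr0) (by positivity), ?_⟩
    have : 4 * ((r : ℝ) / (4 * ρ)) * ρ = r := by field_simp
    rw [this, ENNReal.ofReal_coe_nnreal]
    exact hr.le
  filter_upwards [h.eventually_len_le hlam G hη] with l hl
  have hl0 := Ici_one_pos l
  refine le_trans ?_ hηε
  refine ENNReal.div_le_of_le_mul (((G l).meanNumber_le hl0 (h.finite_inter_box l) (φ l) (ψ l) hβ hρ
    (hμ l) hl (k l)).trans (le_of_eq ?_))
  rw [← ENNReal.ofReal_mul (by positivity), ← ENNReal.ofReal_mul (by positivity)]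
  congr 1
  field_simp

end

end LuttingerSy

namespace LuttingerSy

noncomputable section

/-! ### Generalized condensation -/

variable {l : ℝ} {X : Set ℝ}

namespace Gaps

variable (G : Gaps l X)

/-- Gaps longer than `A` satisfy `L ≤ 2 (L - A / 2)₊`. The others that fail lie within `d + A` of
the left end or `d` of the right end of the box. -/
lemma sum_len_filter_le {A d : ℝ} (hA : 0 ≤ A) (hd : 0 ≤ d) :
    ∑ a ∈ G.lefts.filter (fun a => ¬(G.len a ≤ A ∧ d ≤ a + l / 2 ∧ a + l / 2 ≤ l - d)), G.len a
      ≤ 2 * G.sum (fun s => max (s - A / 2) 0) + (2 * d + A) := by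
  have hlen : ∀ a ∈ G.lefts, 0 ≤ G.len a ∧ G.len a ≤ G.len a :=
    fun a ha => ⟨(G.len_pos ha).le, le_rfl⟩
  have h1 := G.sum_of_mem_Ioo (c := G.len) hlen
    (s := G.lefts.filter fun a => G.len a ≤ A ∧ a + l / 2 < d) (Finset.filter_subset _ _)
    (u := -l / 2) (v := -l / 2 + (d + A)) (by linarith) fun a ha => by
      rw [Finset.mem_filter] at ha
      exact ⟨G.le_left a ha.1, by linarith [ha.2.1, ha.2.2]⟩
  have h2 := G.sum_of_mem_Ioo (c := G.len) hlen
    (s := G.lefts.filter fun a => l - d < a + l / 2) (Finset.filter_subset _ _)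
    (u := l / 2 - d) (v := l / 2) (by linarith) fun a ha => by
      rw [Finset.mem_filter] at ha
      have := G.right_le a ha.1
      exact ⟨by linarith [ha.2], by rw [len]; linarith⟩
  rw [Finset.sum_filter] at h1 h2 ⊢
  have h3 : ∑ a ∈ G.lefts, (if ¬(G.len a ≤ A ∧ d ≤ a + l / 2 ∧ a + l / 2 ≤ l - d)
        then G.len a else 0)
      ≤ ∑ a ∈ G.lefts, (2 * max (G.len a - A / 2) 0 +
        ((if G.len a ≤ A ∧ a + l / 2 < d then G.len a else 0) +
          if l - d < a + l / 2 then G.len a else 0)) := by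
    refine Finset.sum_le_sum fun a ha => ?_
    have hp := (G.len_pos ha).le
    have h4 := le_max_left (G.len a - A / 2) 0
    have h5 := le_max_right (G.len a - A / 2) 0
    by_cases c1 : G.len a ≤ A
    · by_cases c2 : a + l / 2 < d
      · rw [if_pos (show _ ∧ _ from ⟨c1, c2⟩)]
        split_ifs <;> linarith
      · by_cases c3 : l - d < a + l / 2
        · rw [if_pos c3]
          split_ifs <;> linarith
        · rw [if_neg (not_not.2 ⟨c1, not_lt.1 c2, not_lt.1 c3⟩)]
          split_ifs <;> linarith
    · rw [not_le] at c1
      split_ifs <;> linarith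
  rw [Finset.sum_add_distrib, Finset.sum_add_distrib, ← Finset.mul_sum] at h3
  rw [sum]
  linarith

lemma sum_gapEnergy_mul_overlap_le (hl : 0 < l) (hX : (X ∩ box l).Finite) {a : ℝ}
    (ha : a ∈ G.lefts) (m N : ℕ) :
    ∑ k ∈ Finset.range N, gapEnergy k l * overlap l (a + l / 2) (G.len a) m k ^ 2
      ≤ gapEnergy m (G.len a) := by
  have h := (G.system hX).sum_kinetic_le (boxSystem hl) (⟨a, ha⟩, m)
    ((Finset.range N).map ⟨fun k => (⟨-l / 2, Finset.mem_singleton_self _⟩, k),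
      fun _ _ h => (Prod.mk.inj h).2⟩)
  rw [Finset.sum_map] at h
  refine le_of_eq_of_le (Finset.sum_congr rfl fun k _ => ?_) h
  have h3 : (boxGaps hl).len (-l / 2) = l := by
    change l / 2 - -l / 2 = l
    ring
  rw [← G.norm_inner_boxVec ha, boxSystem, system_vec, system_vec]
  change _ = gapEnergy k ((boxGaps hl).len (-l / 2)) * _
  rw [h3]
  rfl

/-- Markov's inequality for the kinetic-energy distribution, whose mean is at most the energy of the
level. Levels of small energy, where the condensate sits, thus have almost no kinetic energy above
`δ`. -/
lemma one_sub_kineticProb_le (hl : 0 < l) (hX : (X ∩ box l).Finite) {a δ : ℝ}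
    (ha : a ∈ G.lefts) (hδ : 0 < δ) (m : ℕ) :
    1 - kineticProb l (a + l / 2) (G.len a) δ m ≤ gapEnergy m (G.len a) / δ := by
  have hE := gapEnergy_pos (G.len_pos ha) m
  have h1 := tsum_sq_inner (boxSystem hl).vec (G.vec (⟨a, ha⟩, m))
  have h2 := tsum_boxSystem hl 1 (G.vec (⟨a, ha⟩, m))
  simp only [Pi.one_apply, one_mul] at h2
  rw [h2, vec, norm_piece_sineFun (G.le_left a ha) (G.lt_right a ha) (G.right_le a ha), one_pow]
    at h1
  have h3 : ENNReal.ofReal 1 ≤ ENNReal.ofReal (kineticProb l (a + l / 2) (G.len a) δ m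
      + gapEnergy m (G.len a) / δ) := by
    rw [← h1]
    refine ENNReal.tsum_le_of_sum_range_le fun N => ?_
    rw [← ENNReal.ofReal_sum_of_nonneg fun _ _ => by positivity]
    refine ENNReal.ofReal_le_ofReal ?_
    have h4 : ∀ k,
        ‖(inner ℂ (boxVec l k) (piece l a (G.right a) (sineFun a (G.right a) m)) : ℂ)‖ ^ 2
        = overlap l (a + l / 2) (G.len a) m k ^ 2 := fun k => G.norm_inner_boxVec ha m k
    simp_rw [h4]
    have h5 : ∀ k, overlap l (a + l / 2) (G.len a) m k ^ 2
        ≤ (if k < levelCount δ l then overlap l (a + l / 2) (G.len a) m k ^ 2 else 0)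
          + gapEnergy k l * overlap l (a + l / 2) (G.len a) m k ^ 2 / δ := by
      intro k
      have hk := gapEnergy_pos hl k
      split_ifs with h
      · have : 0 ≤ gapEnergy k l * overlap l (a + l / 2) (G.len a) m k ^ 2 / δ := by positivity
        linarith
      · rw [lt_levelCount_iff hl, not_le] at h
        rw [zero_add, le_div_iff₀ hδ, mul_comm]
        exact mul_le_mul_of_nonneg_right h.le (sq_nonneg _)
    refine (Finset.sum_le_sum fun k _ => h5 k).trans ?_
    rw [Finset.sum_add_distrib, ← Finset.sum_div]
    refine add_le_add ?_ (div_le_div_of_nonneg_right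
      (G.sum_gapEnergy_mul_overlap_le hl hX ha m N) hδ.le)
    rw [← Finset.sum_filter]
    refine Finset.sum_le_sum_of_subset_of_nonneg (fun k hk => ?_) fun _ _ _ => sq_nonneg _
    exact Finset.mem_range.2 (Finset.mem_filter.1 hk).2
  rw [ENNReal.ofReal_le_ofReal_iff
    (add_nonneg (kineticProb_nonneg _ _ _ _ _) (by positivity))] at h3
  linarith

/-- The contribution of the levels outside the cutoff. -/
lemma tsum_one_sub_cutoff_le (hl : 0 < l) (hX : (X ∩ box l).Finite) {β μ a δ R : ℝ} (hβ : 0 < β)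
    (ha : a ∈ G.lefts) (hδ : 0 < δ) (hR : 2 ≤ R) (hμ : μ ≤ 1)
    (hE : ∀ m, μ < gapEnergy m (G.len a)) :
    ∑' m, ENNReal.ofReal ((1 - cutoff R (gapEnergy m (G.len a))) *
        (bose β μ (gapEnergy m (G.len a)) * (1 - kineticProb l (a + l / 2) (G.len a) δ m)))
      ≤ ENNReal.ofReal (1 / (R * δ)) * ∑' m, ENNReal.ofReal (bose β μ (gapEnergy m (G.len a)))
        + ENNReal.ofReal (8 / (β * Real.pi * √(2 * R)) * G.len a) := by
  have hR0 : 0 < R := by linarith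
  refine le_trans ?_ (add_le_add_right (tsum_tail_le hβ (G.len_pos ha) hR hμ) _)
  rw [← ENNReal.tsum_mul_left, ← ENNReal.tsum_add]
  refine ENNReal.tsum_le_tsum fun m => ?_
  have hb := bose_pos hβ (hE m)
  have hpos : 0 ≤ 1 / (R * δ) := by positivity
  rw [← ENNReal.ofReal_mul hpos, ← ENNReal.ofReal_add (by positivity)
    (by split_ifs <;> [exact hb.le; exact le_rfl])]
  refine ENNReal.ofReal_le_ofReal ?_
  set E := gapEnergy m (G.len a)
  have hw0 := kineticProb_nonneg l (a + l / 2) (G.len a) δ m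
  have hw1 := G.kineticProb_le_one ha δ m
  have hw2 := G.one_sub_kineticProb_le hl hX ha hδ m
  set w := kineticProb l (a + l / 2) (G.len a) δ m
  have hc0 := cutoff_nonneg R E
  have hc1 := cutoff_le_one R E
  have hle : (1 - cutoff R E) * (bose β μ E * (1 - w)) ≤ bose β μ E * (1 - w) :=
    mul_le_of_le_one_left (mul_nonneg hb.le (by linarith)) (by linarith)
  have hrhs : 0 ≤ 1 / (R * δ) * bose β μ E := by positivity
  by_cases h1 : R < E
  · rw [if_pos h1]
    have : bose β μ E * (1 - w) ≤ bose β μ E := mul_le_of_le_one_right hb.le (by linarith)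
    linarith
  · rw [if_neg h1, add_zero]
    by_cases h2 : 1 / R ≤ E
    · rw [cutoff_eq_one hR0 h2 (not_lt.1 h1), sub_self, zero_mul]
      exact hrhs
    · refine hle.trans ?_
      rw [mul_comm]
      refine mul_le_mul_of_nonneg_right (hw2.trans ?_) hb.le
      rw [← div_div]
      exact div_le_div_of_nonneg_right (not_le.1 h2).le hδ.le

end Gaps

/-- The critical density of the particles of kinetic energy more than `δ`. -/
def highDensity (lam β δ : ℝ) : ℝ≥0∞ :=
  ∫⁻ p, ENNReal.ofReal (bose β 0 (levelEnergy p) * (1 - momentumProb √(2 * δ) p.2 p.1))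
    ∂levelMeasure lam

variable {lam : ℝ}

lemma measurable_highDensity_integrand (β δ : ℝ) : Measurable fun p : ℝ × ℕ =>
    bose β 0 (levelEnergy p) * (1 - momentumProb √(2 * δ) p.2 p.1) :=
  ((measurable_bose β 0).comp measurable_levelEnergy).mul
    (measurable_from_prod_countable_left fun m =>
      measurable_const.sub (continuous_momentumProb √(2 * δ) m).measurable)

lemma highDensity_le {β : ℝ} (hβ : 0 < β) (δ : ℝ) :
    highDensity lam β δ ≤ criticalDensity lam β := by
  refine lintegral_mono_ae ?_
  filter_upwards [ae_levelMeasure_pos lam] with p hp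
  have := momentumProb_nonneg (Real.sqrt_nonneg (2 * δ)) (le_of_lt hp) p.2
  exact ENNReal.ofReal_le_ofReal (mul_le_of_le_one_right
    (bose_pos hβ (gapEnergy_pos hp _)).le (by linarith))

/-- The probability of momentum at most `κ` is `O(κ s)` for each level, so the restriction on the
kinetic energy disappears, dominated by the critical density. -/
lemma tendsto_highDensity (hlam : 0 < lam) {β : ℝ} (hβ : 0 < β) :
    Tendsto (highDensity lam β) (𝓝[>] 0) (𝓝 (criticalDensity lam β)) := by
  refine tendsto_lintegral_filter_of_dominated_convergence
    (fun p => ENNReal.ofReal (bose β 0 (levelEnergy p)))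
    (Eventually.of_forall fun δ => (measurable_highDensity_integrand β δ).ennreal_ofReal)
    (Eventually.of_forall fun δ => ?_) (criticalDensity_ne_top hlam hβ) ?_
  · filter_upwards [ae_levelMeasure_pos lam] with p hp
    have := momentumProb_nonneg (Real.sqrt_nonneg (2 * δ)) (le_of_lt hp) p.2
    exact ENNReal.ofReal_le_ofReal (mul_le_of_le_one_right
      (bose_pos hβ (gapEnergy_pos hp _)).le (by linarith))
  · filter_upwards [ae_levelMeasure_pos lam] with p hp
    have h1 : Tendsto (fun δ : ℝ => √(2 * δ)) (𝓝[>] 0) (𝓝 0) := by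
      have h : Continuous fun δ : ℝ => √(2 * δ) := by fun_prop
      have h' := (h.tendsto 0).mono_left (nhdsWithin_le_nhds (s := Ioi 0))
      rwa [mul_zero, Real.sqrt_zero] at h'
    have h2 : Tendsto (fun δ : ℝ => momentumProb √(2 * δ) p.2 p.1) (𝓝[>] 0) (𝓝 0) := by
      have h3 := (h1.mul_const p.1).const_mul (2 / Real.pi)
      rw [zero_mul, mul_zero] at h3
      exact squeeze_zero (fun δ => momentumProb_nonneg (Real.sqrt_nonneg _) (le_of_lt hp) _)
        (fun δ => momentumProb_le (Real.sqrt_nonneg _) (le_of_lt hp) _) h3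
    have h3 := (h2.const_sub 1).const_mul (bose β 0 (levelEnergy p))
    rw [sub_zero, mul_one] at h3
    exact ENNReal.tendsto_ofReal h3

/-- The summand of `highDensity`, restricted to the levels inside the cutoff. -/
def cutHigh (β δ R : ℝ) (m : ℕ) (s : ℝ) : ℝ :=
  cutoff R (gapEnergy m s) * bose β 0 (gapEnergy m s) * (1 - momentumProb √(2 * δ) m s)

lemma cutHigh_nonneg {β s : ℝ} (hβ : 0 < β) (hs : 0 < s) (δ R : ℝ) (m : ℕ) :
    0 ≤ cutHigh β δ R m s :=
  mul_nonneg (mul_nonneg (cutoff_nonneg _ _) (bose_pos hβ (gapEnergy_pos hs m)).le)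
    (sub_nonneg.2 (momentumProb_le_one (Real.sqrt_nonneg _) hs m))

lemma cutHigh_eq_zero {R s : ℝ} (hR : 0 < R) (β δ : ℝ) {m : ℕ} (h : 2 * R ≤ gapEnergy m s) :
    cutHigh β δ R m s = 0 := by
  rw [cutHigh, cutoff_eq_zero_of_ge hR h, zero_mul, zero_mul]

lemma HasGapLaw.isGapLimit_cutHigh (hlam : 0 < lam) (h : HasGapLaw lam X) {β R : ℝ} (hβ : 0 < β)
    (hR : 0 < R) (δ : ℝ) :
    IsGapLimit lam X fun s => ∑ m ∈ Finset.range (levelCount (2 * R) s), cutHigh β δ R m s := by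
  refine h.levels hlam (by positivity) (C := bose β (1 / (2 * R) / 2) (1 / (2 * R)))
    (fun m => (continuousOn_cutoff_mul_bose hβ le_rfl R m).mul
      (continuous_const.sub (continuous_momentumProb _ m)).continuousOn) (fun m s hs => ?_)
    fun m s _ hE => cutHigh_eq_zero hR β δ hE
  rw [abs_of_nonneg (cutHigh_nonneg hβ hs δ R m)]
  have h1 := momentumProb_nonneg (Real.sqrt_nonneg (2 * δ)) hs.le m
  refine (mul_le_of_le_one_right (mul_nonneg (cutoff_nonneg _ _)
    (bose_pos hβ (gapEnergy_pos hs m)).le) (by linarith)).trans ?_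
  exact cutoff_mul_bose_le hβ hR (by positivity) (gapEnergy_pos hs m)

/-- Every fixed positive energy eventually lies where the cutoff equals `1`; the majorant is the
integrand without cutoff. -/
lemma tendsto_integral_cutHigh (hlam : 0 < lam) (h : HasGapLaw lam X) {β : ℝ} (hβ : 0 < β)
    (δ : ℝ) : Tendsto (fun R : ℝ =>
      ∫ s, ∑ m ∈ Finset.range (levelCount (2 * R) s), cutHigh β δ R m s ∂gapMeasure lam) atTop
      (𝓝 (highDensity lam β δ).toReal) := by
  have hne : highDensity lam β δ ≠ ⊤ :=
    ne_top_of_le_ne_top (criticalDensity_ne_top hlam hβ) (highDensity_le hβ δ)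
  have hmeas : ∀ R m, Measurable (cutHigh β δ R m) := fun R m =>
    (((continuous_cutoff R).measurable.comp (measurable_gapEnergy m)).mul
      ((measurable_bose β 0).comp (measurable_gapEnergy m))).mul
      (measurable_const.sub (continuous_momentumProb _ m).measurable)
  have hlim : Tendsto (fun R : ℝ => ∫⁻ p, ENNReal.ofReal (cutHigh β δ R p.2 p.1) ∂levelMeasure lam)
      atTop (𝓝 (highDensity lam β δ)) := by
    refine tendsto_lintegral_filter_of_dominated_convergence
      (fun p => ENNReal.ofReal (bose β 0 (levelEnergy p) * (1 - momentumProb √(2 * δ) p.2 p.1)))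
      (Eventually.of_forall fun R => measurable_from_prod_countable_left fun m =>
        (hmeas R m).ennreal_ofReal) (Eventually.of_forall fun R => ?_) hne ?_
    · filter_upwards [ae_levelMeasure_pos lam] with p hp
      refine ENNReal.ofReal_le_ofReal ?_
      rw [cutHigh, mul_assoc]
      exact mul_le_of_le_one_left (mul_nonneg (bose_pos hβ (gapEnergy_pos hp _)).le
        (sub_nonneg.2 (momentumProb_le_one (Real.sqrt_nonneg _) hp _))) (cutoff_le_one _ _)
    · filter_upwards [ae_levelMeasure_pos lam] with p hp
      refine tendsto_const_nhds.congr' ?_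
      have hE := gapEnergy_pos hp p.2
      filter_upwards [eventually_gt_atTop 0, eventually_ge_atTop (gapEnergy p.2 p.1),
        eventually_ge_atTop (1 / gapEnergy p.2 p.1)] with R h1 h2 h3
      rw [cutHigh, cutoff_eq_one h1 ((one_div_le hE h1).1 h3) h2, one_mul]
      rfl
  refine ((ENNReal.tendsto_toReal hne).comp hlim).congr' ?_
  filter_upwards [eventually_gt_atTop 0] with R hR
  have h1 := lintegral_levels (hmeas R) (h.isGapLimit_cutHigh hlam hβ hR δ).1
    (fun m s hs => cutHigh_nonneg hβ hs δ R m) fun m s _ hE => cutHigh_eq_zero hR β δ hE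
  rw [Function.comp, h1, ENNReal.toReal_ofReal]
  refine integral_nonneg_of_ae ?_
  filter_upwards [ae_gapMeasure_pos lam] with s hs
  exact Finset.sum_nonneg fun m _ => cutHigh_nonneg hβ hs δ R m

/-- The number of particles of kinetic energy more than `δ`, in the levels inside the cutoff. -/
def Gaps.cutSum (G : Gaps l X) (β μ δ R : ℝ) : ℝ :=
  ∑ a ∈ G.lefts, ∑ m ∈ Finset.range (levelCount (2 * R) (G.len a)),
    cutoff R (gapEnergy m (G.len a)) * bose β μ (gapEnergy m (G.len a)) *
      (1 - kineticProb l (a + l / 2) (G.len a) δ m)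

end

end LuttingerSy

namespace LuttingerSy

noncomputable section

/-! ### The limit of the kinetic-energy distribution -/

variable {l : ℝ} {X : Set ℝ}

/-- Kinetic energy at most `δ` means wave number at most `√(2 δ)`. The bound is uniform over gaps of
length at most `A` away from the ends. -/
lemma abs_kineticProb_sub_le {b s d A : ℝ} (hl : 0 < l) (hs : 0 < s) (hsA : s ≤ A) (hd : 0 < d)
    (hdb : d ≤ b) (hbd : b ≤ l - d) (δ : ℝ) (m : ℕ) :
    |kineticProb l b s δ m - momentumProb √(2 * δ) m s|
      ≤ (4 * √(2 * δ) * A ^ 2 + 2 * A) / l + A * (1 + √(2 * δ) * A) / d := by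
  refine (abs_sum_overlap_sq_sub_le hl hs hd hdb hbd (Real.sqrt_nonneg (2 * δ)) m).trans ?_
  have := hs.trans_le hsA
  gcongr

lemma abs_cutoff_mul_sub_le {β μ R E w Q θ : ℝ} (hβ : 0 < β) (hR : 0 < R)
    (hμ : |μ| ≤ 1 / (2 * R) / 2) (hE : 0 < E) (hw : 0 ≤ w ∧ w ≤ 1) (hQ : |w - Q| ≤ θ) :
    |cutoff R E * bose β μ E * (1 - w) - cutoff R E * bose β 0 E * (1 - Q)|
      ≤ (Real.exp (β * |μ|) - 1) * (1 + bose β (1 / (2 * R) / 2) (1 / (2 * R))) *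
          bose β (1 / (2 * R) / 2) (1 / (2 * R))
        + bose β (1 / (2 * R) / 2) (1 / (2 * R)) * θ := by
  have he : 0 < 1 / (2 * R) := by positivity
  have hC : 0 < bose β (1 / (2 * R) / 2) (1 / (2 * R)) := bose_pos hβ (by linarith)
  have hθ : 0 ≤ θ := (abs_nonneg _).trans hQ
  have hη : 0 ≤ Real.exp (β * |μ|) - 1 := sub_nonneg.2 (Real.one_le_exp (by positivity))
  have hχ0 := cutoff_nonneg R E
  have hχ1 := cutoff_le_one R E
  rcases le_total E (1 / (2 * R)) with h | h
  · rw [cutoff_eq_zero_of_le hR h, zero_mul, zero_mul, zero_mul, zero_mul, sub_zero, abs_zero]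
    positivity
  · have h1 := abs_bose_sub_le hβ he h hμ
    have h2 := cutoff_mul_bose_le hβ hR (show (0 : ℝ) ≤ 1 / (2 * R) / 2 by positivity) hE
    have h3 := (bose_pos hβ hE).le
    have h4 : cutoff R E * bose β μ E * (1 - w) - cutoff R E * bose β 0 E * (1 - Q)
        = cutoff R E * (1 - w) * (bose β μ E - bose β 0 E)
          - cutoff R E * bose β 0 E * (w - Q) := by ring
    rw [h4]
    refine (abs_sub _ _).trans (add_le_add ?_ ?_)
    · rw [abs_mul, abs_of_nonneg (mul_nonneg hχ0 (by linarith [hw.2]))]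
      refine le_trans (mul_le_of_le_one_left (abs_nonneg _) ?_) h1
      exact mul_le_one₀ hχ1 (by linarith [hw.2]) (by linarith [hw.1])
    · rw [abs_mul, abs_of_nonneg (mul_nonneg hχ0 h3)]
      exact mul_le_mul h2 hQ (abs_nonneg _) hC.le

/-- A gap has at most `c` times its length many levels inside the cutoff, so per-level errors turn
into errors proportional to length, and the exceptional gaps have small total length. -/
lemma Gaps.abs_cutSum_sub_le (hl : 0 < l) (G : Gaps l X) (hX : (X ∩ box l).Finite)
    {β μ R A d : ℝ} (hβ : 0 < β) (hR : 0 < R) (hμ : |μ| ≤ 1 / (2 * R) / 2) (hA : 0 < A)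
    (hd : 0 < d) (δ : ℝ) :
    |G.cutSum β μ δ R
        - G.sum fun s => ∑ m ∈ Finset.range (levelCount (2 * R) s), cutHigh β δ R m s|
      ≤ √(2 * (2 * R)) / Real.pi *
        (((Real.exp (β * |μ|) - 1) * (1 + bose β (1 / (2 * R) / 2) (1 / (2 * R))) *
            bose β (1 / (2 * R) / 2) (1 / (2 * R)) + bose β (1 / (2 * R) / 2) (1 / (2 * R)) *
            ((4 * √(2 * δ) * A ^ 2 + 2 * A) / l + A * (1 + √(2 * δ) * A) / d)) * l
          + bose β (1 / (2 * R) / 2) (1 / (2 * R)) *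
            (2 * G.sum (fun s => max (s - A / 2) 0) + (2 * d + A))) := by
  have he : 0 < 1 / (2 * R) := by positivity
  set C := bose β (1 / (2 * R) / 2) (1 / (2 * R)) with hCdef
  have hC : 0 < C := bose_pos hβ (by linarith)
  set η := (Real.exp (β * |μ|) - 1) * (1 + C) * C with hηdef
  have hη : 0 ≤ η := mul_nonneg (mul_nonneg
    (sub_nonneg.2 (Real.one_le_exp (by positivity))) (by linarith)) hC.le
  set θ := (4 * √(2 * δ) * A ^ 2 + 2 * A) / l + A * (1 + √(2 * δ) * A) / d with hθdef
  have hθ : 0 ≤ θ := by positivity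
  set c := √(2 * (2 * R)) / Real.pi with hc
  have hc0 : 0 ≤ c := by positivity
  -- In exceptional gaps the two probabilities need not be close, but both lie in `[0, 1]`, so their
  -- distance is at most `1`.
  set bad : ℝ → Prop := fun a => ¬(G.len a ≤ A ∧ d ≤ a + l / 2 ∧ a + l / 2 ≤ l - d) with hbad
  have hsum := G.sum_len_filter_le hA.le hd.le
  have hgap : ∀ a ∈ G.lefts, |∑ m ∈ Finset.range (levelCount (2 * R) (G.len a)),
        (cutoff R (gapEnergy m (G.len a)) * bose β μ (gapEnergy m (G.len a)) *
          (1 - kineticProb l (a + l / 2) (G.len a) δ m) - cutHigh β δ R m (G.len a))|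
      ≤ c * ((η + C * θ) * G.len a + C * if bad a then G.len a else 0) := by
    intro a ha
    have hs := G.len_pos ha
    have hterm : ∀ m, |cutoff R (gapEnergy m (G.len a)) * bose β μ (gapEnergy m (G.len a)) *
          (1 - kineticProb l (a + l / 2) (G.len a) δ m) - cutHigh β δ R m (G.len a)|
        ≤ η + C * (θ + if bad a then 1 else 0) := by
      intro m
      have hw0 := kineticProb_nonneg l (a + l / 2) (G.len a) δ m
      have hw1 := G.kineticProb_le_one ha δ m
      refine abs_cutoff_mul_sub_le hβ hR hμ (gapEnergy_pos hs m) ⟨hw0, hw1⟩ ?_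
      by_cases hb : bad a
      · rw [if_pos hb]
        have h1 := momentumProb_nonneg (Real.sqrt_nonneg (2 * δ)) hs.le m
        have h2 := momentumProb_le_one (Real.sqrt_nonneg (2 * δ)) hs m
        rw [abs_le]
        constructor <;> linarith
      · rw [if_neg hb, add_zero]
        obtain ⟨h1, h2, h3⟩ := not_not.1 hb
        exact abs_kineticProb_sub_le hl hs h1 hd h2 h3 δ m
    refine (Finset.abs_sum_le_sum_abs _ _).trans
      ((Finset.sum_le_sum fun m _ => hterm m).trans ?_)
    rw [Finset.sum_const, Finset.card_range, nsmul_eq_mul]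
    have hnn : 0 ≤ η + C * (θ + if bad a then 1 else 0) := by
      split_ifs <;> positivity
    refine (mul_le_mul_of_nonneg_right (levelCount_le hs.le) hnn).trans (le_of_eq ?_)
    rw [← hc]
    split_ifs <;> ring
  rw [cutSum, Gaps.sum, ← Finset.sum_sub_distrib]
  simp_rw [← Finset.sum_sub_distrib]
  refine (Finset.abs_sum_le_sum_abs _ _).trans ((Finset.sum_le_sum hgap).trans ?_)
  rw [← Finset.mul_sum, Finset.sum_add_distrib, ← Finset.mul_sum, ← Finset.mul_sum,
    ← Finset.sum_filter]
  have h5 : ∑ a ∈ G.lefts, G.len a = l := G.sum_len hl hX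
  rw [h5]
  refine mul_le_mul_of_nonneg_left ?_ hc0
  exact add_le_add le_rfl (mul_le_mul_of_nonneg_left hsum hC.le)

variable {lam : ℝ}

lemma HasGapLaw.tendsto_cutSum (hlam : 0 < lam) (h : HasGapLaw lam X) {β R : ℝ} (hβ : 0 < β)
    (hR : 0 < R) (δ : ℝ) (G : GapsFamily X) {μ : Ici (1 : ℝ) → ℝ} (hμ : Tendsto μ atTop (𝓝 0)) :
    Tendsto (fun l : Ici (1 : ℝ) => (G l).cutSum β (μ l) δ R / l) atTop
      (𝓝 (∫ s, ∑ m ∈ Finset.range (levelCount (2 * R) s), cutHigh β δ R m s ∂gapMeasure lam)) := by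
  set C := bose β (1 / (2 * R) / 2) (1 / (2 * R)) with hCdef
  have hC : 0 < C := bose_pos hβ (half_lt_self (by positivity))
  set c := √(2 * (2 * R)) / Real.pi with hc
  have hc0 : 0 ≤ c := by positivity
  rw [Metric.tendsto_nhds]
  intro ε hε
  obtain ⟨A, hA, hAε⟩ : ∃ A : ℝ, 0 < A ∧
      c * (C * (2 * Real.exp (-(lam * (A / 2))))) < ε / 2 := by
    have h1 : Tendsto (fun A : ℝ => lam * (A / 2)) atTop atTop :=
      (tendsto_id.atTop_div_const two_pos).const_mul_atTop hlam
    have h2 := (((Real.tendsto_exp_neg_atTop_nhds_zero.comp h1).const_mul 2).const_mul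
      C).const_mul c
    rw [mul_zero, mul_zero, mul_zero] at h2
    obtain ⟨A, h3, h4⟩ := ((eventually_gt_atTop (0 : ℝ)).and
      (h2.eventually (gt_mem_nhds (half_pos hε)))).exists
    exact ⟨A, h3, h4⟩
  have hη : Tendsto (fun l => (Real.exp (β * |μ l|) - 1) * (1 + C) * C) atTop (𝓝 0) := by
    have hcont : Continuous fun x : ℝ => (Real.exp (β * |x|) - 1) * (1 + C) * C := by fun_prop
    have := (hcont.tendsto 0).comp hμ
    rwa [abs_zero, mul_zero, Real.exp_zero, sub_self, zero_mul, zero_mul] at this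
  -- The margin at the ends of the box will be `d = √l`: it diverges, which kills the interference,
  -- while `d / l` tends to `0`.
  have hsq : Tendsto (fun l : Ici (1 : ℝ) => √(l : ℝ)) atTop atTop :=
    Real.tendsto_sqrt_atTop.comp tendsto_coe_Ici
  have hθ : Tendsto (fun l : Ici (1 : ℝ) => (4 * √(2 * δ) * A ^ 2 + 2 * A) / (l : ℝ)
      + A * (1 + √(2 * δ) * A) / √(l : ℝ)) atTop (𝓝 0) := by
    simpa using (tendsto_const_nhds.div_atTop tendsto_coe_Ici).add
      (tendsto_const_nhds.div_atTop hsq)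
  have hd : Tendsto (fun l : Ici (1 : ℝ) => 2 / √(l : ℝ) + A / (l : ℝ)) atTop (𝓝 0) := by
    simpa using (tendsto_const_nhds.div_atTop hsq).add
      (tendsto_const_nhds.div_atTop tendsto_coe_Ici)
  have hB := ((hη.add (hθ.const_mul C)).add ((((h.2 G (A / 2) (by positivity)).const_mul 2).add
    hd).const_mul C)).const_mul c
  rw [mul_zero, add_zero, zero_add, add_zero] at hB
  have hμ' : ∀ᶠ l in atTop, |μ l| ≤ 1 / (2 * R) / 2 := by
    have := hμ.abs
    rw [abs_zero] at this
    exact this.eventually (ge_mem_nhds (by positivity))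
  filter_upwards [hμ', hB.eventually (gt_mem_nhds hAε),
    Metric.tendsto_nhds.1 ((h.isGapLimit_cutHigh hlam hβ hR δ).2 G) (ε / 2) (by positivity)]
    with l h1 h2 h3
  have hl := Ici_one_pos l
  have h4 := (G l).abs_cutSum_sub_le hl (h.finite_inter_box l) hβ hR h1 hA (Real.sqrt_pos.2 hl) δ
  have h5 : |(G l).cutSum β (μ l) δ R / l
      - ((G l).sum fun s => ∑ m ∈ Finset.range (levelCount (2 * R) s), cutHigh β δ R m s) / l|
      < ε / 2 := by
    rw [← sub_div, abs_div, abs_of_pos hl]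
    refine lt_of_le_of_lt ((div_le_div_of_nonneg_right h4 hl.le).trans (le_of_eq ?_)) h2
    rw [← hCdef, ← hc]
    have h6 : √(l : ℝ) / l = 1 / √(l : ℝ) := by
      rw [div_eq_div_iff hl.ne' (Real.sqrt_pos.2 hl).ne', Real.mul_self_sqrt hl.le, one_mul]
    have h7 : (2 : ℝ) / √(l : ℝ) = 2 * (√(l : ℝ) / l) := by
      rw [h6]
      ring
    rw [h7]
    field_simp
  calc _ ≤ _ := dist_triangle _ (((G l).sum fun s =>
        ∑ m ∈ Finset.range (levelCount (2 * R) s), cutHigh β δ R m s) / l) _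
    _ < ε / 2 + ε / 2 := add_lt_add (by rwa [Real.dist_eq]) h3
    _ = ε := add_halves ε

/-- The limit of the mass which the occupation measure of the kinetic-energy eigenstates gives
to `(-∞, δ]`. -/
lemma HasGapLaw.tendsto_kineticOccupation (hlam : 0 < lam) (h : HasGapLaw lam X) {β ρ : ℝ}
    (hβ : 0 < β) (hρ : (criticalDensity lam β).toReal < ρ) (φ : EigenbasisFamily X)
    (ψ : EigenbasisFamily ∅) {μ : Ici (1 : ℝ) → ℝ}
    (hμ : ∀ l, IsChemicalPotential (φ l) β ρ (μ l)) {δ : ℝ} (hδ : 0 < δ) :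
    Tendsto (fun l : Ici (1 : ℝ) => kineticOccupation (φ l) (ψ l) β (μ l) δ) atTop
      (𝓝 (ENNReal.ofReal (ρ - (highDensity lam β δ).toReal))) := by
  obtain ⟨G⟩ := h.nonempty_gapsFamily
  have hρ0 : 0 < ρ := ENNReal.toReal_nonneg.trans_lt hρ
  have hμ0 := h.tendsto_chemicalPotential hlam hβ hρ φ hμ
  -- `T l` is the number of particles of kinetic energy above `δ`. Unlike its complement it receives
  -- little from the condensate, so its limit can be computed with `μ = 0`.
  set T : Ici (1 : ℝ) → ℝ≥0∞ := fun l => ∑ a ∈ (G l).lefts, ∑' m,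
    ENNReal.ofReal (bose β (μ l) (gapEnergy m ((G l).len a)) *
      (1 - kineticProb l (a + l / 2) ((G l).len a) δ m)) with hT
  have hE : ∀ l, ∀ a ∈ (G l).lefts, ∀ m, μ l < gapEnergy m ((G l).len a) := fun l a ha m =>
    (G l).lt_gapEnergy (h.finite_inter_box l) (φ l)
      (lt_energy_of_fockTrace_ne_top (φ l) hβ (hμ l).1 0) ha m
  have hocc : ∀ l : Ici (1 : ℝ), T l ≠ ⊤ ∧ kineticOccupation (φ l) (ψ l) β (μ l) δ
      = ENNReal.ofReal (ρ - (T l).toReal / l) := by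
    intro l
    have hl := Ici_one_pos l
    set S := ∑ a ∈ (G l).lefts, ∑' m, ENNReal.ofReal (bose β (μ l) (gapEnergy m ((G l).len a))) *
        ENNReal.ofReal (kineticProb l (a + l / 2) ((G l).len a) δ m) with hS
    have h1 : S + T l = ENNReal.ofReal (ρ * l) := by
      rw [← (G l).tsum_bose hl (h.finite_inter_box l) (φ l) hβ hρ0 (hμ l), hS, hT]
      simp only
      rw [← Finset.sum_add_distrib]
      refine Finset.sum_congr rfl fun a ha => ?_
      rw [← ENNReal.tsum_add]
      refine tsum_congr fun m => ?_
      have hb := (bose_pos hβ (hE l a ha m)).le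
      have hw0 := kineticProb_nonneg l (a + l / 2) ((G l).len a) δ m
      have hw1 := (G l).kineticProb_le_one ha δ m
      rw [← ENNReal.ofReal_mul hb, ← ENNReal.ofReal_add (mul_nonneg hb hw0)
        (mul_nonneg hb (by linarith))]
      congr 1
      ring
    have hTne : T l ≠ ⊤ := by
      intro htop
      rw [htop, add_top] at h1
      exact ENNReal.ofReal_ne_top h1.symm
    refine ⟨hTne, ?_⟩
    rw [(G l).kineticOccupation_eq hl (h.finite_inter_box l) (φ l) (ψ l) hβ (hμ l).1 δ, ← hS]
    have h2 : S = ENNReal.ofReal (ρ * l - (T l).toReal) := by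
      rw [ENNReal.ofReal_sub _ ENNReal.toReal_nonneg, ENNReal.ofReal_toReal hTne, ← h1,
        ENNReal.add_sub_cancel_right hTne]
    rw [h2, ← ENNReal.ofReal_div_of_pos hl, sub_div, mul_div_cancel_right₀ _ hl.ne']
  refine Tendsto.congr (fun l => (hocc l).2.symm) (ENNReal.tendsto_ofReal ?_)
  refine tendsto_const_nhds.sub ?_
  -- Levels below `1 / R` contribute at most `ρ / (R δ)` per unit length by Markov's inequality,
  -- whatever their occupation; levels above `R` are controlled by the tail bound.
  have hbounds : ∀ R, 2 ≤ R → ∀ l : Ici (1 : ℝ), μ l ≤ 1 → (G l).cutSum β (μ l) δ R ≤ (T l).toReal ∧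
      (T l).toReal ≤ (G l).cutSum β (μ l) δ R
        + (ρ / (R * δ) + 8 / (β * Real.pi * √(2 * R))) * l := by
    intro R hR l hμ1
    have hR0 : 0 < R := by linarith
    have hl := Ici_one_pos l
    set g : ℝ → ℕ → ℝ := fun a m => cutoff R (gapEnergy m ((G l).len a)) *
      bose β (μ l) (gapEnergy m ((G l).len a)) *
        (1 - kineticProb l (a + l / 2) ((G l).len a) δ m) with hg
    have hgnn : ∀ a ∈ (G l).lefts, ∀ m, 0 ≤ g a m := fun a ha m =>
      mul_nonneg (mul_nonneg (cutoff_nonneg _ _) (bose_pos hβ (hE l a ha m)).le)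
        (sub_nonneg.2 ((G l).kineticProb_le_one ha δ m))
    have hcut : ENNReal.ofReal ((G l).cutSum β (μ l) δ R)
        = ∑ a ∈ (G l).lefts, ∑' m, ENNReal.ofReal (g a m) := by
      rw [Gaps.cutSum, ENNReal.ofReal_sum_of_nonneg fun a ha =>
        Finset.sum_nonneg fun m _ => hgnn a ha m]
      refine Finset.sum_congr rfl fun a ha => ?_
      refine (tsum_ofReal_eq_sum_levelCount ((G l).len_pos ha) (hgnn a ha) fun m hm => ?_).symm
      simp only [hg]
      rw [cutoff_eq_zero_of_ge hR0 hm, zero_mul, zero_mul]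
    have hcutnn : 0 ≤ (G l).cutSum β (μ l) δ R :=
      Finset.sum_nonneg fun a ha => Finset.sum_nonneg fun m _ => hgnn a ha m
    have hsplit : T l = ENNReal.ofReal ((G l).cutSum β (μ l) δ R) + ∑ a ∈ (G l).lefts, ∑' m,
        ENNReal.ofReal ((1 - cutoff R (gapEnergy m ((G l).len a))) *
          (bose β (μ l) (gapEnergy m ((G l).len a)) *
            (1 - kineticProb l (a + l / 2) ((G l).len a) δ m))) := by
      rw [hcut, ← Finset.sum_add_distrib]
      refine Finset.sum_congr rfl fun a ha => ?_
      rw [← ENNReal.tsum_add]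
      refine tsum_congr fun m => ?_
      have h1 := mul_nonneg (bose_pos hβ (hE l a ha m)).le
        (sub_nonneg.2 ((G l).kineticProb_le_one ha δ m))
      rw [← ENNReal.ofReal_add (hgnn a ha m)
        (mul_nonneg (sub_nonneg.2 (cutoff_le_one _ _)) h1)]
      congr 1
      simp only [hg]
      ring
    constructor
    · refine (ENNReal.ofReal_le_iff_le_toReal (hocc l).1).1 ?_
      rw [hsplit]
      exact le_self_add
    · refine ENNReal.toReal_le_of_le_ofReal (by positivity) ?_
      rw [hsplit, ENNReal.ofReal_add hcutnn (by positivity)]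
      refine add_le_add le_rfl ?_
      refine (Finset.sum_le_sum fun a ha => (G l).tsum_one_sub_cutoff_le hl (h.finite_inter_box l)
        hβ ha hδ hR hμ1 (hE l a ha)).trans ?_
      rw [Finset.sum_add_distrib, ← Finset.mul_sum,
        (G l).tsum_bose hl (h.finite_inter_box l) (φ l) hβ hρ0 (hμ l),
        ← ENNReal.ofReal_sum_of_nonneg fun a ha => mul_nonneg (by positivity)
          ((G l).len_pos ha).le, ← Finset.mul_sum]
      have h5 : ∑ a ∈ (G l).lefts, (G l).len a = l := (G l).sum_len hl (h.finite_inter_box l)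
      rw [h5, ← ENNReal.ofReal_mul (by positivity), ← ENNReal.ofReal_add (by positivity)
        (by positivity)]
      refine ENNReal.ofReal_le_ofReal (le_of_eq ?_)
      ring
  rw [Metric.tendsto_nhds]
  intro ε hε
  obtain ⟨R, hR2, hR3, hR4⟩ : ∃ R : ℝ, 2 ≤ R ∧ ρ / (R * δ) + 8 / (β * Real.pi * √(2 * R)) < ε / 3 ∧
      |∫ s, ∑ m ∈ Finset.range (levelCount (2 * R) s), cutHigh β δ R m s ∂gapMeasure lam
        - (highDensity lam β δ).toReal| < ε / 3 := by
    have h1 : Tendsto (fun R : ℝ => ρ / (R * δ)) atTop (𝓝 0) :=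
      tendsto_const_nhds.div_atTop (tendsto_id.atTop_mul_const hδ)
    have h2 : Tendsto (fun R : ℝ => 8 / (β * Real.pi * √(2 * R))) atTop (𝓝 0) :=
      tendsto_const_nhds.div_atTop ((Real.tendsto_sqrt_atTop.comp
        (tendsto_id.const_mul_atTop two_pos)).const_mul_atTop (mul_pos hβ Real.pi_pos))
    have h3 := h1.add h2
    rw [add_zero] at h3
    obtain ⟨R, hR1, hR2, hR3⟩ := ((eventually_ge_atTop (2 : ℝ)).and
      ((h3.eventually (gt_mem_nhds (show 0 < ε / 3 by positivity))).and
      (Metric.tendsto_nhds.1 (tendsto_integral_cutHigh hlam h hβ δ) (ε / 3)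
        (by positivity)))).exists
    exact ⟨R, hR1, hR2, by rwa [Real.dist_eq] at hR3⟩
  filter_upwards [Metric.tendsto_nhds.1 (h.tendsto_cutSum hlam hβ (by linarith : 0 < R) δ G hμ0)
    (ε / 3) (by positivity), hμ0.eventually (ge_mem_nhds one_pos)] with l h1 h2
  have hl := Ici_one_pos l
  obtain ⟨h3, h4⟩ := hbounds R hR2 l h2
  have h5 := div_le_div_of_nonneg_right h3 hl.le
  have h6 := div_le_div_of_nonneg_right h4 hl.le
  rw [add_div, mul_div_cancel_right₀ _ hl.ne'] at h6
  rw [Real.dist_eq, abs_lt] at h1 ⊢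
  rw [abs_lt] at hR4
  constructor <;> linarith [h1.1, h1.2, hR4.1, hR4.2]

end

end LuttingerSy

/-! ### Assembly of the claims on one almost sure event -/

theorem mainTheorem5 {Ω : Type*} [MeasurableSpace Ω] (P : Measure Ω) [IsProbabilityMeasure P]
    (lam : ℝ≥0) (hlam : 0 < lam) (X : Ω → Set ℝ) (hX : LuttingerSy.IsPoissonProcess P lam X) :
    -- eigenbases of the kinetic-energy operators and of the Luttinger–Sy Hamiltonians exist
    Nonempty (LuttingerSy.EigenbasisFamily ∅) ∧
    (∀ ω, Nonempty (LuttingerSy.EigenbasisFamily (X ω))) ∧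
    -- `ν` is the (non-random) limiting integrated density of states
    ∃ ν : Measure ℝ,
      (∀ᵐ ω ∂P, ∀ φ : LuttingerSy.EigenbasisFamily (X ω), ∀ e : ℝ,
        Tendsto (fun l : Ici (1 : ℝ) => LuttingerSy.finiteIDS (φ l) e) atTop (𝓝 (ν (Iic e)))) ∧
      ∀ β : ℝ, 0 < β → ∃ ρc : ℝ≥0, LuttingerSy.IsCriticalDensity β ν ρc ∧
        ∀ ρ : ℝ, 0 < ρ →
          -- the chemical potential of the gas of density `ρ` is well defined in every box
          (∀ᵐ ω ∂P, ∀ φ : LuttingerSy.EigenbasisFamily (X ω), ∀ l : Ici (1 : ℝ),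
            ∃! μ : ℝ, LuttingerSy.IsChemicalPotential (φ l) β ρ μ) ∧
          -- no kinetic-energy eigenstate is macroscopically occupied
          (∀ᵐ ω ∂P, ∀ (φ : LuttingerSy.EigenbasisFamily (X ω))
            (ψ : LuttingerSy.EigenbasisFamily ∅) (μ : Ici (1 : ℝ) → ℝ),
            (∀ l, LuttingerSy.IsChemicalPotential (φ l) β ρ (μ l)) →
            ∀ k : Ici (1 : ℝ) → ℕ,
              Tendsto (fun l : Ici (1 : ℝ) =>
                LuttingerSy.meanNumber (φ l) β (μ l) ((ψ l).vec (k l)) / ENNReal.ofReal l)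
                atTop (𝓝 0)) ∧
          -- generalized condensation in the kinetic-energy eigenstates
          ((ρc : ℝ) < ρ → ∃ G : ℝ → ℝ≥0∞,
            (∀ᵐ ω ∂P, ∀ (φ : LuttingerSy.EigenbasisFamily (X ω))
              (ψ : LuttingerSy.EigenbasisFamily ∅) (μ : Ici (1 : ℝ) → ℝ),
              (∀ l, LuttingerSy.IsChemicalPotential (φ l) β ρ (μ l)) →
              ∀ δ : ℝ, 0 < δ →
                Tendsto (fun l : Ici (1 : ℝ) =>
                  LuttingerSy.kineticOccupation (φ l) (ψ l) β (μ l) δ) atTop (𝓝 (G δ))) ∧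
            Tendsto G (𝓝[>] 0) (𝓝 (ENNReal.ofReal (ρ - ρc)))) := by
  have hlam' : (0 : ℝ) < lam := NNReal.coe_pos.2 hlam
  have hlaw := hX.ae_hasGapLaw
  refine ⟨⟨fun l => ((LuttingerSy.boxGaps (LuttingerSy.Ici_one_pos l)).nonempty_eigenbasis
    (LuttingerSy.Ici_one_pos l) (by simp)).some⟩, fun ω => ?_, LuttingerSy.idsMeasure lam, ?_, ?_⟩
  · have hfin : ∀ l, (X ω ∩ LuttingerSy.box l).Finite :=
      LuttingerSy.finite_inter_box (hX.locallyFinite ω)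
    exact ⟨fun l => ((LuttingerSy.nonempty_gaps (LuttingerSy.Ici_one_pos l) (hfin l)).some
      |>.nonempty_eigenbasis (LuttingerSy.Ici_one_pos l) (hfin l)).some⟩
  · filter_upwards [hlaw] with ω hω φ e
    exact hω.tendsto_finiteIDS hlam' φ e
  intro β hβ
  have hne := LuttingerSy.criticalDensity_ne_top hlam' hβ
  refine ⟨_, LuttingerSy.isCriticalDensity hlam' hβ, fun ρ hρ => ⟨?_, ?_, fun hρc => ?_⟩⟩
  · filter_upwards [hlaw] with ω hω φ l
    exact LuttingerSy.existsUnique_chemicalPotential (LuttingerSy.Ici_one_pos l)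
      (hω.finite_inter_box l) (φ l) hβ hρ
  · filter_upwards [hlaw] with ω hω φ ψ μ hμ k
    exact hω.tendsto_meanNumber hlam' hβ hρ φ ψ hμ k
  · refine ⟨fun δ => ENNReal.ofReal (ρ - (LuttingerSy.highDensity lam β δ).toReal), ?_, ?_⟩
    · filter_upwards [hlaw] with ω hω φ ψ μ hμ δ hδ
      exact hω.tendsto_kineticOccupation hlam' hβ hρc φ ψ hμ hδ
    · exact ENNReal.tendsto_ofReal (tendsto_const_nhds.sub
        ((ENNReal.tendsto_toReal hne).comp (LuttingerSy.tendsto_highDensity hlam' hβ)))
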